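/- **Theorem 4.3 (Vinberg construction).** Let $\mathbb K_1,\mathbb K_2$ be real composition algebras, i.e. nonzero unital, not necessarily associative real algebras $\mathbb K$ with a nondegenerate quadratic form satisfying $|xy|^2=|x|^2|y|^2$; write $\langle\,,\rangle$ for the bilinear form with $\langle x,x\rangle=|x|^2$, $\mathbb K'=1^\perp$, and $x\mapsto\overline x$ for the linear map fixing $1$ and equal to $-1$ on $\mathbb K'$. For an algebra $\mathcal A$ let $\operatorname{Der}\mathcal A$ be the Lie algebra of its derivations. Let $L_x,R_x$ be left and right multiplication by $x$, and for $x,y\in\mathbb K$ put $D_{x,y}=[L_x,L_y]+[L_x,R_y]+[R_x,R_y]$. For a $3\times3$ matrix $X$ put $X'=X-\tfrac13(\operatorname{tr}X)\mathbf 1$. Let $\mathbb K_1\otimes\mathbb K_2$ have the product $(u_1\otimes v_1)(u_2\otimes v_2)=u_1u_2\otimes v_1v_2$ and conjugation $\overline{u\otimes v}=\overline u\otimes\overline v$, and let $A_3'(\mathbb K_1\otimes\mathbb K_2)$ be the space of traceless antihermitian $3\times3$ matrices over it. For $x,y\in\mathbb K_1\otimes\mathbb K_2$ define $D_{x,y}$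 bilinearly by $$D_{p\otimes q,\,u\otimes v}=\langle p,u\rangle D_{q,v}+\langle q,v\rangle D_{p,u}.$$ Vinberg's space is the vector space direct sum $V_3(\mathbb K_1,\mathbb K_2)=A_3'(\mathbb K_1\otimes\mathbb K_2)\dotplus\operatorname{Der}\mathbb K_1\dotplus\operatorname{Der}\mathbb K_2$, with the antisymmetric brackets for which $\operatorname{Der}\mathbb K_1\oplus\operatorname{Der}\mathbb K_2$ is a Lie subalgebra with its usual bracket, $[D,A]=D(A)$ (elementwise action) for $D\in\operatorname{Der}\mathbb K_1\oplus\operatorname{Der}\mathbb K_2$ and $A\in A_3'(\mathbb K_1\otimes\mathbb K_2)$, and, for $A=(a_{ij})$, $B=(b_{ij})\in A_3'(\mathbb K_1\otimes\mathbb K_2)$, $$[A,B]=(AB-BA)'+\tfrac13\sum_{i,j}D_{a_{ij},\,b_{ij}}.$$ Let $H_3(\mathbb K_2)$ be the algebra of hermitian $3\times3$ matrices over $\mathbb K_2$ with product $X\cdot Y=XY+YX$ and inner product $\langle X,Y\rangle=\tfrac12\operatorname{tr}(X\cdot Y)$, let $H_3'(\mathbb K_2)$ be its subspace of traceless matrices,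 and put $A*B=(A\cdot B)'$. Tits's magic square algebra is $L_3(\mathbb K_1,\mathbb K_2)=T(\mathbb K_1,H_3(\mathbb K_2))=\operatorname{Der}\mathbb K_1\dotplus\operatorname{Der}H_3(\mathbb K_2)\dotplus\mathbb K_1'\otimes H_3'(\mathbb K_2)$, with the antisymmetric brackets for which $\operatorname{Der}\mathbb K_1\oplus\operatorname{Der}H_3(\mathbb K_2)$ is a Lie subalgebra with its usual bracket and acts as usual on $\mathbb K_1'\otimes H_3'(\mathbb K_2)$, and, for $a,b\in\mathbb K_1'$ and $A,B\in H_3'(\mathbb K_2)$, $$[a\otimes A,\,b\otimes B]=\tfrac13\langle A,B\rangle D_{a,b}-\langle a,b\rangle[L_A,L_B]+\tfrac12[a,b]\otimes(A*B).$$ Then these formulas give well-defined brackets on both spaces, $V_3(\mathbb K_1,\mathbb K_2)$ and $L_3(\mathbb K_1,\mathbb K_2)$ with these brackets are Lie algebras, and they are isomorphic as Lie algebras. -/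

import Mathlib

open scoped TensorProduct

namespace MagicSquare

/-! ### Lie brackets given by bilinear maps -/

section LieBracket

variable {L : Type*} [AddCommGroup L] [Module ℝ L]

/-- A bilinear product is a Lie bracket: it is alternating and satisfies the Jacobi identity. -/
structure IsLieBracket (β : L →ₗ[ℝ] L →ₗ[ℝ] L) : Prop where
  alternating : ∀ x, β x x = 0
  jacobi : ∀ x y z, β x (β y z) + β y (β z x) + β z (β x y) = 0

/-- The vector space `L` equipped with the Lie bracket `β`. -/
def WithBracket (L : Type*) [AddCommGroup L] [Module ℝ L] (β : L →ₗ[ℝ] L →ₗ[ℝ] L) (_ : IsLieBracket β) : Type _ := L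

variable {β : L →ₗ[ℝ] L →ₗ[ℝ] L} {hβ : IsLieBracket β}

instance : AddCommGroup (WithBracket L β hβ) := inferInstanceAs (AddCommGroup L)

instance : Module ℝ (WithBracket L β hβ) := inferInstanceAs (Module ℝ L)

theorem IsLieBracket.antisymm (h : IsLieBracket β) (x y : L) : β x y = -β y x := by
  have h1 := h.alternating (x + y)
  simp only [map_add, LinearMap.add_apply, h.alternating, zero_add, add_zero] at h1
  exact eq_neg_of_add_eq_zero_right h1

instance : LieRing (WithBracket L β hβ) where
  bracket x y := β x y
  add_lie x y z := by
    exact LinearMap.congr_fun (map_add β x y) z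
  lie_add x y z := map_add (β x) y z
  lie_self x := hβ.alternating x
  leibniz_lie x y z := by
    change β x (β y z) = β (β x y) z + β y (β x z)
    have h := hβ.jacobi x y z
    rw [hβ.antisymm z x, map_neg, hβ.antisymm z (β x y)] at h
    rw [← sub_eq_zero, ← h]
    abel

instance : LieAlgebra ℝ (WithBracket L β hβ) where
  lie_smul t x y := map_smul (β x) t y

end LieBracket

/-! ### Derivations -/

section Derivations

variable {A : Type*} [AddCommGroup A] [Module ℝ A]

/-- The derivations of the algebra `A` with product `μ`. -/
def Der (μ : A →ₗ[ℝ] A →ₗ[ℝ] A) : Submodule ℝ (Module.End ℝ A) where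
  carrier := {D | ∀ x y, D (μ x y) = μ (D x) y + μ x (D y)}
  add_mem' {D E} hD hE x y := by
    simp only [LinearMap.add_apply, hD x y, hE x y, map_add]
    abel
  zero_mem' x y := by simp
  smul_mem' c D hD x y := by
    simp only [LinearMap.smul_apply, hD x y, map_smul, smul_add]

/-- The commutator `(S, T) ↦ S T - T S` of linear endomorphisms. -/
noncomputable def endComm (V : Type*) [AddCommGroup V] [Module ℝ V] :
    Module.End ℝ V →ₗ[ℝ] Module.End ℝ V →ₗ[ℝ] Module.End ℝ V :=
  LinearMap.mul ℝ (Module.End ℝ V) - (LinearMap.mul ℝ (Module.End ℝ V)).flip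

theorem endComm_mem_der {μ : A →ₗ[ℝ] A →ₗ[ℝ] A} (D E : Der μ) :
    endComm A D E ∈ Der μ := by
  intro x y
  have hD : ∀ x y, D.1 (μ x y) = μ (D.1 x) y + μ x (D.1 y) := D.2
  have hE : ∀ x y, E.1 (μ x y) = μ (E.1 x) y + μ x (E.1 y) := E.2
  simp only [endComm, LinearMap.sub_apply, LinearMap.flip_apply, LinearMap.mul_apply',
    Module.End.mul_apply, hD, hE, map_add, map_sub]
  abel

/-- The commutator bracket of derivations. -/
noncomputable def derComm {μ : A →ₗ[ℝ] A →ₗ[ℝ] A} (D E : Der μ) : Der μ :=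
  ⟨endComm A D E, endComm_mem_der D E⟩

end Derivations

/-! ### Composition algebras -/

/-- A real composition algebra: a unital, not necessarily associative real algebra `K ≠ 0` with a
nondegenerate quadratic form that is multiplicative. -/
class CompositionAlgebra (K : Type*) [NonAssocRing K] [Module ℝ K] [IsScalarTower ℝ K K]
    [SMulCommClass ℝ K K] where
  /-- the quadratic form `x ↦ |x|²` -/
  normForm : QuadraticForm ℝ K
  nondegenerate : (QuadraticMap.associated (R := ℝ) normForm).Nondegenerate
  map_mul : ∀ x y, normForm (x * y) = normForm x * normForm y
  one_ne_zero : (1 : K) ≠ 0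

section Composition

variable (K : Type*) [NonAssocRing K] [Module ℝ K] [IsScalarTower ℝ K K] [SMulCommClass ℝ K K]

/-- Left multiplication `x ↦ L_x`. -/
noncomputable def leftMul : K →ₗ[ℝ] Module.End ℝ K := LinearMap.mul ℝ K

/-- Right multiplication `x ↦ R_x`. -/
noncomputable def rightMul : K →ₗ[ℝ] Module.End ℝ K := (LinearMap.mul ℝ K).flip

/-- `(x, y) ↦ D_{x,y} = [L_x, L_y] + [L_x, R_y] + [R_x, R_y]`. -/
noncomputable def innerDer : K →ₗ[ℝ] K →ₗ[ℝ] Module.End ℝ K :=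
  (endComm K).compl₁₂ (leftMul K) (leftMul K) + (endComm K).compl₁₂ (leftMul K) (rightMul K) +
    (endComm K).compl₁₂ (rightMul K) (rightMul K)

variable [CompositionAlgebra K]

/-- The inner product `⟨x, y⟩` with `⟨x, x⟩ = |x|²`. -/
noncomputable def ip : LinearMap.BilinForm ℝ K :=
  QuadraticMap.associated (R := ℝ) (CompositionAlgebra.normForm (K := K))

/-- The subspace `K'` orthogonal to the identity. -/
noncomputable def Im : Submodule ℝ K := LinearMap.ker (ip K 1)

/-- Conjugation `x ↦ 2 ⟨1, x⟩ 1 - x`, the linear map that fixes `1` and is `-1` on `K'`. -/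
noncomputable def conj : K →ₗ[ℝ] K :=
  (2 : ℝ) • (ip K 1).smulRight (1 : K) - LinearMap.id

/-- The derivation algebra of the algebra `K`. -/
noncomputable abbrev DerK : Submodule ℝ (Module.End ℝ K) := Der (LinearMap.mul ℝ K)

variable {K}

theorem ip_comm (x y : K) : ip K x y = ip K y x :=
  QuadraticMap.associated_isSymm ℝ (CompositionAlgebra.normForm (K := K)) x y

theorem ip_self (x : K) : ip K x x = CompositionAlgebra.normForm x :=
  QuadraticMap.associated_eq_self_apply ℝ (CompositionAlgebra.normForm (K := K)) x

theorem ip_mul_left (x y z : K) : ip K (x * y) (x * z) = ip K x x * ip K y z := by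
  have h1 : ∀ w, ip K (x * w) (x * w) = ip K x x * ip K w w := fun w => by
    simp only [ip_self, CompositionAlgebra.map_mul]
  have h2 := h1 (y + z)
  simp only [mul_add, map_add, LinearMap.add_apply, h1, ip_comm (x * z) (x * y),
    ip_comm z y] at h2
  linarith

theorem ip_mul_right (x y z : K) : ip K (y * x) (z * x) = ip K y z * ip K x x := by
  have h1 : ∀ w, ip K (w * x) (w * x) = ip K w w * ip K x x := fun w => by
    simp only [ip_self, CompositionAlgebra.map_mul]
  have h2 := h1 (y + z)
  simp only [add_mul, map_add, LinearMap.add_apply, h1, ip_comm (z * x) (y * x),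
    ip_comm z y] at h2
  linarith

theorem ip_mul_mul (x w y z : K) :
    ip K (x * y) (w * z) + ip K (w * y) (x * z) = 2 * ip K x w * ip K y z := by
  have h := ip_mul_left (x + w) y z
  simp only [add_mul, map_add, LinearMap.add_apply, ip_mul_left, ip_comm w x] at h
  linarith

theorem ip_nondegenerate {x y : K} (h : ∀ z, ip K x z = ip K y z) : x = y := by
  rw [← sub_eq_zero]
  refine (CompositionAlgebra.nondegenerate (K := K)).1 _ fun z => ?_
  have := h z
  change ip K (x - y) z = 0
  simp [this]

theorem conj_apply (x : K) : conj K x = (2 * ip K 1 x) • (1 : K) - x := by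
  simp [conj, mul_smul]

theorem ip_one_one : ip K (1 : K) 1 = 1 := by
  have h1 : ∀ y z : K, ip K y z = ip K 1 1 * ip K y z := fun y z => by
    simpa using ip_mul_left (1 : K) y z
  by_contra h
  have h2 : ∀ y z : K, ip K y z = 0 := fun y z => by
    have := h1 y z
    have h3 : (ip K (1 : K) 1 - 1) * ip K y z = 0 := by linarith
    exact (mul_eq_zero.mp h3).resolve_left (sub_ne_zero.mpr h)
  exact CompositionAlgebra.one_ne_zero (K := K) (ip_nondegenerate fun z => by simp [h2])

theorem ip_conj_left (x y : K) : ip K (conj K x) y = ip K x (conj K y) := by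
  simp only [conj_apply, map_sub, map_smul, LinearMap.sub_apply, LinearMap.smul_apply,
    smul_eq_mul, ip_comm x 1]
  ring

theorem conj_conj (x : K) : conj K (conj K x) = x := by
  simp only [conj_apply, map_sub, map_smul, ip_one_one]
  module

theorem ip_mul_left_adj (x y z : K) : ip K (x * y) z = ip K y (conj K x * z) := by
  have h := ip_mul_mul x 1 y z
  simp only [one_mul] at h
  simp only [conj_apply, sub_mul, smul_mul_assoc, one_mul, map_sub, map_smul, smul_eq_mul]
  rw [ip_comm x 1] at h
  linarith

theorem ip_mul_right_adj (x y z : K) : ip K (x * y) z = ip K x (z * conj K y) := by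
  have h := ip_mul_mul x z y 1
  simp only [mul_one] at h
  simp only [conj_apply, mul_sub, mul_smul_comm, mul_one, map_sub, map_smul, smul_eq_mul]
  rw [ip_comm y 1, ip_comm (z * y) x] at h
  linarith

/-- Conjugation is an anti-automorphism. -/
theorem conj_mul (x y : K) : conj K (x * y) = conj K y * conj K x := by
  refine ip_nondegenerate fun z => ?_
  rw [ip_conj_left, ip_mul_left_adj, ip_comm, ip_mul_right_adj, conj_conj,
    ip_comm, ip_comm, ip_mul_left_adj, conj_conj, ip_comm]

end Composition

/-! ### Matrices -/

section Matrices

variable {R : Type*}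

/-- The matrices with entries in `R` that are hermitian with respect to the conjugation `c`. -/
def hermitian [AddCommGroup R] [Module ℝ R] (c : R →ₗ[ℝ] R) :
    Submodule ℝ (Matrix (Fin 3) (Fin 3) R) where
  carrier := {X | ∀ i j, c (X j i) = X i j}
  add_mem' {X Y} hX hY i j := by simp [hX i j, hY i j]
  zero_mem' i j := by simp
  smul_mem' t X hX i j := by simp [hX i j]

/-- The traceless matrices with entries in `R` that are antihermitian with respect to the
conjugation `c`. -/
def antihermitianTraceless [AddCommGroup R] [Module ℝ R] (c : R →ₗ[ℝ] R) :
    Submodule ℝ (Matrix (Fin 3) (Fin 3) R) where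
  carrier := {X | (∀ i j, c (X j i) = -X i j) ∧ X.trace = 0}
  add_mem' {X Y} hX hY :=
    ⟨fun i j => by simp [hX.1 i j, hY.1 i j, add_comm],
      by rw [Matrix.trace_add, hX.2, hY.2, add_zero]⟩
  zero_mem' := ⟨fun i j => by simp, Matrix.trace_zero _ _⟩
  smul_mem' t X hX :=
    ⟨fun i j => by simp [hX.1 i j], by rw [Matrix.trace_smul, hX.2, smul_zero]⟩

/-- The traceless part `X' = X - (tr X / 3) 1` of a `3 × 3` matrix. -/
noncomputable def tracelessPart [AddCommGroup R] [Module ℝ R] (X : Matrix (Fin 3) (Fin 3) R) :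
    Matrix (Fin 3) (Fin 3) R :=
  X - Matrix.diagonal fun _ => (1 / 3 : ℝ) • X.trace

theorem trace_tracelessPart [AddCommGroup R] [Module ℝ R] (X : Matrix (Fin 3) (Fin 3) R) :
    (tracelessPart X).trace = 0 := by
  rw [tracelessPart, Matrix.trace_sub, Matrix.trace_diagonal, Finset.sum_const,
    Finset.card_univ, Fintype.card_fin, sub_eq_zero]
  module

theorem tracelessPart_mem_hermitian [AddCommGroup R] [Module ℝ R] {c : R →ₗ[ℝ] R}
    {X : Matrix (Fin 3) (Fin 3) R} (hX : X ∈ hermitian c) : tracelessPart X ∈ hermitian c := by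
  have hX' : ∀ i j, c (X j i) = X i j := hX
  intro i j
  rw [tracelessPart, Matrix.sub_apply, Matrix.sub_apply, map_sub, hX' i j]
  congr 1
  by_cases h : i = j
  · subst h
    simp [Matrix.trace, hX']
  · rw [Matrix.diagonal_apply_ne _ h, Matrix.diagonal_apply_ne _ (Ne.symm h), map_zero]

end Matrices

section Jordan

variable (K : Type*) [NonAssocRing K] [Module ℝ K] [IsScalarTower ℝ K K] [SMulCommClass ℝ K K]
  [CompositionAlgebra K]

/-- The space `H₃(K)` of hermitian `3 × 3` matrices over `K`. -/
def H3 : Type _ := hermitian (conj K)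

noncomputable instance : AddCommGroup (H3 K) := inferInstanceAs (AddCommGroup (hermitian (conj K)))

noncomputable instance : Module ℝ (H3 K) := inferInstanceAs (Module ℝ (hermitian (conj K)))

/-- The inclusion of `H₃(K)` in the space of all matrices. -/
noncomputable def mat : H3 K →ₗ[ℝ] Matrix (Fin 3) (Fin 3) K := (hermitian (conj K)).subtype

/-- A hermitian matrix as an element of `H₃(K)`. -/
def H3.mk (X : Matrix (Fin 3) (Fin 3) K) (hX : X ∈ hermitian (conj K)) : H3 K :=
  (⟨X, hX⟩ : hermitian (conj K))

/-- The subspace `H₃'(K)` of traceless matrices in `H₃(K)`. -/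
noncomputable def H3Traceless : Submodule ℝ (H3 K) where
  carrier := {X | (mat K X).trace = 0}
  add_mem' {X Y} hX hY := by
    have hX' : (mat K X).trace = 0 := hX
    have hY' : (mat K Y).trace = 0 := hY
    change (mat K (X + Y)).trace = 0
    rw [map_add, Matrix.trace_add, hX', hY', add_zero]
  zero_mem' := by
    change (mat K 0).trace = 0
    rw [map_zero, Matrix.trace_zero]
  smul_mem' t X hX := by
    have hX' : (mat K X).trace = 0 := hX
    change (mat K (t • X)).trace = 0
    rw [map_smul, Matrix.trace_smul, hX', smul_zero]

variable {K}

theorem mat_injective : Function.Injective (mat K) := Subtype.val_injective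

theorem mat_mem (X : H3 K) : mat K X ∈ hermitian (conj K) := X.2

@[simp]
theorem mat_mk (X : Matrix (Fin 3) (Fin 3) K) (hX : X ∈ hermitian (conj K)) :
    mat K (H3.mk K X hX) = X := rfl

theorem anticomm_mem (X Y : H3 K) :
    mat K X * mat K Y + mat K Y * mat K X ∈ hermitian (conj K) := by
  have hX : ∀ i j, conj K (mat K X j i) = mat K X i j := mat_mem X
  have hY : ∀ i j, conj K (mat K Y j i) = mat K Y i j := mat_mem Y
  intro i j
  simp only [Matrix.add_apply, Matrix.mul_apply, map_add, map_sum, conj_mul, hX, hY]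
  exact add_comm _ _

variable (K)

/-- The Jordan product `X · Y = XY + YX` on `H₃(K)`. -/
noncomputable def jordanMul : H3 K →ₗ[ℝ] H3 K →ₗ[ℝ] H3 K :=
  LinearMap.mk₂ ℝ (fun X Y => H3.mk K (mat K X * mat K Y + mat K Y * mat K X) (anticomm_mem X Y))
    (fun X X' Y => mat_injective <| by
      simp only [mat_mk, map_add, Matrix.add_mul, Matrix.mul_add]; abel)
    (fun t X Y => mat_injective <| by
      simp only [mat_mk, map_smul, Matrix.smul_mul, Matrix.mul_smul, smul_add])
    (fun X Y Y' => mat_injective <| by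
      simp only [mat_mk, map_add, Matrix.add_mul, Matrix.mul_add]; abel)
    (fun t X Y => mat_injective <| by
      simp only [mat_mk, map_smul, Matrix.smul_mul, Matrix.mul_smul, smul_add])

/-- The derivation algebra of the Jordan algebra `H₃(K)`. -/
noncomputable abbrev DerH3 : Submodule ℝ (Module.End ℝ (H3 K)) := Der (jordanMul K)

variable {K}

/-- The inner product `⟨X, Y⟩ = ½ tr (X · Y)` on `H₃(K)`. The trace of a hermitian matrix is a
real multiple `t 1` of the identity of `K`, and `⟨1, t 1⟩ = t`. -/
noncomputable def hermIp (X Y : H3 K) : ℝ :=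
  (1 / 2) * ip K 1 (mat K (jordanMul K X Y)).trace

/-- The product `A * B` on `H₃'(K)`: the traceless part of `A · B`. -/
noncomputable def starMul (A B : H3Traceless K) : H3Traceless K :=
  ⟨H3.mk K (tracelessPart (mat K (jordanMul K A B)))
    (tracelessPart_mem_hermitian (mat_mem (jordanMul K A B))), trace_tracelessPart _⟩

end Jordan

/-! ### The two constructions -/

section Constructions

variable (K₁ K₂ : Type*)
  [NonAssocRing K₁] [Module ℝ K₁] [IsScalarTower ℝ K₁ K₁] [SMulCommClass ℝ K₁ K₁]
  [NonAssocRing K₂] [Module ℝ K₂] [IsScalarTower ℝ K₂ K₂] [SMulCommClass ℝ K₂ K₂]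

/-- The bilinear map on `K₁ ⊗ K₂` with `(p ⊗ q, u ⊗ v) ↦ ⟨q, v⟩ D_{p,u}`, the `Der K₁` part of `D_{p ⊗ q, u ⊗ v}`. -/
noncomputable def tensorDer₁ [CompositionAlgebra K₂] :
    K₁ ⊗[ℝ] K₂ →ₗ[ℝ] K₁ ⊗[ℝ] K₂ →ₗ[ℝ] Module.End ℝ K₁ :=
  (TensorProduct.map₂ (innerDer K₁) (ip K₂)).compr₂
    (TensorProduct.rid ℝ (Module.End ℝ K₁)).toLinearMap

/-- The bilinear map on `K₁ ⊗ K₂` with `(p ⊗ q, u ⊗ v) ↦ ⟨p, u⟩ D_{q,v}`, the `Der K₂` part of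
`D_{p ⊗ q, u ⊗ v}`. -/
noncomputable def tensorDer₂ [CompositionAlgebra K₁] :
    K₁ ⊗[ℝ] K₂ →ₗ[ℝ] K₁ ⊗[ℝ] K₂ →ₗ[ℝ] Module.End ℝ K₂ :=
  (TensorProduct.map₂ (ip K₁) (innerDer K₂)).compr₂
    (TensorProduct.lid ℝ (Module.End ℝ K₂)).toLinearMap

variable [CompositionAlgebra K₁] [CompositionAlgebra K₂]

/-- `A₃'(K₁ ⊗ K₂)`, with respect to the conjugation `u ⊗ v ↦ ū ⊗ v̄`. -/
noncomputable abbrev A3Tensor : Submodule ℝ (Matrix (Fin 3) (Fin 3) (K₁ ⊗[ℝ] K₂)) :=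
  antihermitianTraceless (TensorProduct.map (conj K₁) (conj K₂))

/-- Vinberg's space `V₃(K₁, K₂) = A₃'(K₁ ⊗ K₂) ∔ Der K₁ ∔ Der K₂`. -/
abbrev VinbergSpace : Type _ := A3Tensor K₁ K₂ × DerK K₁ × DerK K₂

/-- Tits's space `L₃(K₁, K₂) = T(K₁, H₃(K₂)) = Der K₁ ∔ Der H₃(K₂) ∔ K₁' ⊗ H₃'(K₂)`. -/
abbrev TitsSpace : Type _ := DerK K₁ × DerH3 K₂ × (Im K₁ ⊗[ℝ] H3Traceless K₂)

/-- The inclusion of `K₁' ⊗ H₃'(K₂)` in `K₁ ⊗ H₃(K₂)`. -/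
noncomputable def tensorIncl : Im K₁ ⊗[ℝ] H3Traceless K₂ →ₗ[ℝ] K₁ ⊗[ℝ] H3 K₂ :=
  TensorProduct.map (Im K₁).subtype (H3Traceless K₂).subtype

variable {K₁ K₂}

/-- `β` is given by Vinberg's formulas. (Together with antisymmetry they determine `β`.) -/
structure IsVinbergBracket
    (β : VinbergSpace K₁ K₂ →ₗ[ℝ] VinbergSpace K₁ K₂ →ₗ[ℝ] VinbergSpace K₁ K₂) : Prop where
  /-- `Der K₁ ⊕ Der K₂` is a subalgebra with its usual bracket. -/
  der_der : ∀ (D₁ E₁ : DerK K₁) (D₂ E₂ : DerK K₂),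
    β (0, D₁, D₂) (0, E₁, E₂) = (0, derComm D₁ E₁, derComm D₂ E₂)
  /-- Derivations act on matrices elementwise: `[D, A] = D(A)`. -/
  der_matrix : ∀ (D₁ : DerK K₁) (D₂ : DerK K₂) (A : A3Tensor K₁ K₂),
    ((β (0, D₁, D₂) (A, 0)).1 : Matrix (Fin 3) (Fin 3) (K₁ ⊗[ℝ] K₂)) =
        A.1.map ⇑(LinearMap.rTensor K₂ D₁.1 + LinearMap.lTensor K₁ D₂.1) ∧
      (β (0, D₁, D₂) (A, 0)).2 = 0
  /-- `[A, B] = (AB - BA)' + ⅓ ∑ D_{a_ij, b_ij}`. -/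
  matrix_matrix : ∀ A B : A3Tensor K₁ K₂,
    ((β (A, 0) (B, 0)).1 : Matrix (Fin 3) (Fin 3) (K₁ ⊗[ℝ] K₂)) =
        tracelessPart (A.1 * B.1 - B.1 * A.1) ∧
      ((β (A, 0) (B, 0)).2.1 : Module.End ℝ K₁) =
        (1 / 3 : ℝ) • ∑ i, ∑ j, tensorDer₁ K₁ K₂ (A.1 i j) (B.1 i j) ∧
      ((β (A, 0) (B, 0)).2.2 : Module.End ℝ K₂) =
        (1 / 3 : ℝ) • ∑ i, ∑ j, tensorDer₂ K₁ K₂ (A.1 i j) (B.1 i j)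

/-- `γ` is given by Tits's formulas. (Together with antisymmetry they determine `γ`.) -/
structure IsTitsBracket
    (γ : TitsSpace K₁ K₂ →ₗ[ℝ] TitsSpace K₁ K₂ →ₗ[ℝ] TitsSpace K₁ K₂) : Prop where
  /-- `Der K₁ ⊕ Der H₃(K₂)` is a subalgebra with its usual bracket. -/
  der_der : ∀ (D₁ E₁ : DerK K₁) (D₂ E₂ : DerH3 K₂),
    γ (D₁, D₂, 0) (E₁, E₂, 0) = (derComm D₁ E₁, derComm D₂ E₂, 0)
  /-- `Der K₁ ⊕ Der H₃(K₂)` acts as usual on `K₁' ⊗ H₃'(K₂)`. -/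
  der_tensor : ∀ (D₁ : DerK K₁) (D₂ : DerH3 K₂) (t : Im K₁ ⊗[ℝ] H3Traceless K₂),
    (γ (D₁, D₂, 0) (0, 0, t)).1 = 0 ∧ (γ (D₁, D₂, 0) (0, 0, t)).2.1 = 0 ∧
      tensorIncl K₁ K₂ (γ (D₁, D₂, 0) (0, 0, t)).2.2 =
        (LinearMap.rTensor (H3 K₂) D₁.1 + LinearMap.lTensor K₁ D₂.1) (tensorIncl K₁ K₂ t)
  /-- `[a ⊗ A, b ⊗ B] = ⅓ ⟨A, B⟩ D_{a,b} - ⟨a, b⟩ [L_A, L_B] + ½ [a, b] ⊗ (A * B)`. -/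
  tensor_tensor : ∀ (a b : Im K₁) (A B : H3Traceless K₂),
    ((γ (0, 0, a ⊗ₜ A) (0, 0, b ⊗ₜ B)).1 : Module.End ℝ K₁) =
        (1 / 3 * hermIp A.1 B.1 : ℝ) • innerDer K₁ a b ∧
      ((γ (0, 0, a ⊗ₜ A) (0, 0, b ⊗ₜ B)).2.1 : Module.End ℝ (H3 K₂)) =
        -(ip K₁ a b • endComm (H3 K₂) (jordanMul K₂ A) (jordanMul K₂ B)) ∧
      tensorIncl K₁ K₂ (γ (0, 0, a ⊗ₜ A) (0, 0, b ⊗ₜ B)).2.2 =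
        (1 / 2 : ℝ) • (((a : K₁) * b - b * a) ⊗ₜ[ℝ] (starMul A B : H3 K₂))

end Constructions

end MagicSquare

set_option linter.unusedSectionVars false

/-! Both spaces consist of the same pieces, grouped differently. A derivation of H₃(K₂) is uniquely
X ↦ [A, X] plus an elementwise derivation, so Der H₃(K₂) = A₃'(K₂) ∔ Der K₂ (`derH3Equiv`).
Splitting K₁ = ℝ1 ∔ K₁' gives A₃'(K₁ ⊗ K₂) = A₃'(K₂) ∔ K₁' ⊗ H₃'(K₂), because an imaginary factor
turns a hermitian matrix into an antihermitian one (`antiEquiv`). Together these give the linear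
isomorphism `vinbergEquiv`.

The Jacobi identity is proved once, for Tits's bracket. The criterion `isLieBracket_extBracket`
reduces it to conditions which, on pure tensors, mostly factor into an identity in K₁ times one in
H₃(K₂): the cyclic identity for D (`imInnerDer_cyclic`) meets the symmetric form ⟨A, B * C⟩, and the
linearised Jordan identity (`jordanInnerDer_cyclic`) meets the cyclic form ⟨a, [b, c]⟩. The two
factors interact only in the tensor component for three tensors; there the associator (a, b, c) is
multiplied by the linearised Cayley–Hamilton identity (`starForm_cyclic`).

Vinberg's bracket is the transport of Tits's, so its Jacobi identity and the isomorphism are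
automatic; what remains is to recognise Vinberg's formulas. This rests on `endComm_adOp_adOp` and
`endComm_jordanMul_jordanMul`, where the term ⅓∑D repairs both the removal of the trace and the
nonassociativity of the entries. Both come from identities for associators of 3 × 3 matrices, which
hold because associators of entries are alternating and change sign under conjugation. That all
derivations are obtained (`exists_adOp_add_derOp`) is a triality argument: after subtracting
suitable [A, ·], a derivation kills the diagonal and acts on the three off-diagonal entries by
essentially one map, which must be a derivation of K₂. -/

namespace MagicSquare

/-! ### Composition algebras: alternativity, inner derivations, skewness of derivations. -/

section CompositionIdentities

variable {K : Type*} [NonAssocRing K] [Module ℝ K] [IsScalarTower ℝ K K] [SMulCommClass ℝ K K]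

theorem leftMul_apply (x y : K) : leftMul K x y = x * y := rfl

theorem rightMul_apply (x y : K) : rightMul K x y = y * x := rfl

theorem endComm_apply {V : Type*} [AddCommGroup V] [Module ℝ V] (S T : Module.End ℝ V) (v : V) :
    endComm V S T v = S (T v) - T (S v) := rfl

theorem endComm_eq {V : Type*} [AddCommGroup V] [Module ℝ V] (S T : Module.End ℝ V) :
    endComm V S T = S * T - T * S := rfl

theorem innerDer_eq (x y : K) : innerDer K x y = endComm K (leftMul K x) (leftMul K y) +
    endComm K (leftMul K x) (rightMul K y) + endComm K (rightMul K x) (rightMul K y) := rfl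

theorem innerDer_swap_one_left (x : K) : innerDer K 1 x = 0 := by
  ext u
  simp [innerDer_eq, endComm_apply, leftMul_apply, rightMul_apply]

theorem innerDer_swap_one_right (x : K) : innerDer K x 1 = 0 := by
  ext u
  simp [innerDer_eq, endComm_apply, leftMul_apply, rightMul_apply]

theorem associator_smul_left (r : ℝ) (x y z : K) :
    associator (r • x) y z = r • associator x y z := by
  simp only [associator_apply, smul_mul_assoc, smul_sub]

theorem associator_one_left (y z : K) : associator 1 y z = 0 := by
  simp [associator_apply]

theorem associator_sub_left (x x' y z : K) :
    associator (x - x') y z = associator x y z - associator x' y z := by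
  simp only [associator_apply, sub_mul]; abel

theorem associator_add_left (x x' y z : K) :
    associator (x + x') y z = associator x y z + associator x' y z := by
  simp only [associator_apply, add_mul]; abel

theorem associator_add_mid (x y y' z : K) :
    associator x (y + y') z = associator x y z + associator x y' z := by
  simp only [associator_apply, add_mul, mul_add]; abel

theorem associator_add_right (x y z z' : K) :
    associator x y (z + z') = associator x y z + associator x y z' := by
  simp only [associator_apply, mul_add]; abel

theorem associator_neg_left (x y z : K) : associator (-x) y z = -associator x y z := by
  simp only [associator_apply, neg_mul]; abel

theorem Der.map_mul {D : Module.End ℝ K} (hD : D ∈ DerK K) (x y : K) :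
    D (x * y) = D x * y + x * D y := hD x y

theorem Der.map_one {D : Module.End ℝ K} (hD : D ∈ DerK K) : D 1 = 0 := by
  have h := Der.map_mul hD 1 1
  simpa using h

/-- Inner derivations are equivariant under derivations. -/
theorem endComm_innerDer {D : Module.End ℝ K} (hD : D ∈ DerK K) (x y : K) :
    endComm K D (innerDer K x y) = innerDer K (D x) y + innerDer K x (D y) := by
  ext u
  simp only [innerDer_eq, endComm_apply, leftMul_apply, rightMul_apply, LinearMap.add_apply,
    map_add, map_sub, Der.map_mul hD, mul_add, add_mul]
  abel

variable [CompositionAlgebra K]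

/-- Multiplication by x̄ is adjoint to multiplication by x, so pairing with any z reduces this to
the polarised composition law. Alternativity follows from this and its mirror image. -/
theorem conj_mul_mul_self (x y : K) : conj K x * (x * y) = ip K x x • y := by
  refine ip_nondegenerate fun z => ?_
  rw [ip_mul_left_adj, conj_conj, ip_mul_left, map_smul,
    LinearMap.smul_apply, smul_eq_mul]

theorem mul_mul_conj_self (x y : K) : (y * x) * conj K x = ip K x x • y := by
  refine ip_nondegenerate fun z => ?_
  rw [ip_mul_right_adj, conj_conj, ip_mul_right, map_smul,
    LinearMap.smul_apply, smul_eq_mul, mul_comm]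

theorem conj_one : conj K (1 : K) = 1 := by
  rw [conj_apply, ip_one_one]; module

theorem conj_mul_self (x : K) : conj K x * x = ip K x x • (1 : K) := by
  simpa using conj_mul_mul_self x 1

theorem mul_conj_self (x : K) : x * conj K x = ip K x x • (1 : K) := by
  simpa using mul_mul_conj_self x 1

theorem mul_self_eq (x : K) : x * x = (2 * ip K 1 x) • x - ip K x x • (1 : K) := by
  have h := mul_conj_self x
  rw [conj_apply, mul_sub, mul_smul_comm, mul_one] at h
  rw [← h]; abel

/-- Since x̄ differs from -x by a multiple of 1, the law x̄(xy) = |x|² y and the quadratic equation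
of x together say x(xy) = x²y. -/
theorem associator_self_left (x y : K) : associator x x y = 0 := by
  have h := conj_mul_mul_self x y
  rw [conj_apply, sub_mul, smul_mul_assoc, one_mul] at h
  rw [associator_apply, mul_self_eq, sub_mul, smul_mul_assoc, smul_mul_assoc, one_mul, ← h]
  abel

theorem associator_self_right (x y : K) : associator y x x = 0 := by
  have h := mul_mul_conj_self x y
  rw [conj_apply, mul_sub, mul_smul_comm, mul_one] at h
  rw [associator_apply, mul_self_eq, mul_sub, mul_smul_comm, mul_smul_comm, mul_one, ← h]
  abel

theorem associator_swap_left (x y z : K) : associator x y z = -associator y x z := by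
  have h := associator_self_left (x + y) z
  rw [associator_add_left, associator_add_mid, associator_add_mid, associator_self_left,
    associator_self_left, zero_add, add_zero] at h
  exact eq_neg_of_add_eq_zero_left h

theorem associator_swap_right (x y z : K) : associator x y z = -associator x z y := by
  have h := associator_self_right (y + z) x
  rw [associator_add_right, associator_add_mid, associator_add_mid, associator_self_right,
    associator_self_right, zero_add, add_zero] at h
  exact eq_neg_of_add_eq_zero_right h

theorem associator_rotate (x y z : K) : associator x y z = associator y z x := by
  rw [associator_swap_left, associator_swap_right, neg_neg]

theorem associator_conj_left (x y z : K) : associator (conj K x) y z = -associator x y z := by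
  rw [conj_apply, associator_sub_left, associator_smul_left, associator_one_left, smul_zero,
    zero_sub]

/-- By alternativity the three operator commutators differ from ad [x, y] only by associators of x,
y, u, each equal to ± (x, y, u). -/
theorem innerDer_apply (x y u : K) : innerDer K x y u =
    ((x * y - y * x) * u - u * (x * y - y * x)) - (3 : ℝ) • associator x y u := by
  have h1 := associator_swap_left x y u
  have h2 := associator_swap_right x y u
  have h3 := associator_rotate u x y
  have h4 := associator_rotate u y x
  simp only [innerDer_eq, endComm_apply, leftMul_apply, rightMul_apply, LinearMap.add_apply]
  simp only [associator_apply, sub_mul, mul_sub] at *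
  linear_combination (norm := module) 2 • h1 - h2 - h3 + h4

theorem innerDer_swap (x y : K) : innerDer K x y = -innerDer K y x := by
  ext u
  rw [LinearMap.neg_apply, innerDer_apply, innerDer_apply, associator_swap_left x y]
  simp only [sub_mul, mul_sub]
  module

theorem innerDer_conj_right (x y : K) : innerDer K x (conj K y) = -innerDer K x y := by
  rw [conj_apply, map_sub, map_smul, innerDer_swap_one_right, smul_zero, zero_sub]

theorem commutator_conj (x y : K) :
    x * conj K y - conj K y * x = -(x * y - y * x) := by
  simp only [conj_apply, mul_sub, sub_mul, mul_smul_comm, smul_mul_assoc, mul_one, one_mul]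
  abel

/-- A consequence of the four-variable identity `associator_cocycle`, taken in nine orders of the
variables. Alternativity moves every product into the first slot and sorts the other arguments; the
coefficients then solve a linear system. -/
theorem commutator_associator (x y z u : K) :
    associator x y z * u - u * associator x y z =
      associator (x * y) z u + associator (y * z) x u + associator (z * x) y u := by
  have mid : ∀ a p q d : K, associator a (p * q) d = -associator (p * q) a d :=
    fun a p q d => associator_swap_left _ _ _
  have right : ∀ a b p q : K, associator a b (p * q) = associator (p * q) a b :=
    fun a b p q => (associator_rotate _ _ _).symm
  have h1 := associator_cocycle x y z u
  have h2 := associator_cocycle x y u z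
  have h3 := associator_cocycle x z y u
  have h4 := associator_cocycle x z u y
  have h5 := associator_cocycle x u y z
  have h6 := associator_cocycle x u z y
  have h7 := associator_cocycle y z x u
  have h8 := associator_cocycle y u x z
  have h9 := associator_cocycle u x y z
  simp only [mid, right, fun t : K => associator_swap_left y x t,
    fun t : K => associator_swap_left z x t, fun t : K => associator_swap_left u x t,
    fun t : K => associator_swap_left z y t, fun t : K => associator_swap_left u y t,
    fun t : K => associator_swap_left u z t,
    fun t : K => associator_swap_right t z x, fun t : K => associator_swap_right t u x,
    fun t : K => associator_swap_right t z y, fun t : K => associator_swap_right t u y,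
    fun t : K => associator_swap_right t u z, mul_neg, neg_mul, neg_neg] at *
  linear_combination (norm := module) -(1/2 : ℝ) • h1 - (1/2 : ℝ) • h2 - (1/2 : ℝ) • h3
    + (1/2 : ℝ) • h4 - (1/2 : ℝ) • h5 + (1/2 : ℝ) • h6 + h7 + h8 - h9

/-- The cyclic sum of [xy, z] is three times the associator (x, y, z). By `innerDer_apply` the claim
is therefore three times `commutator_associator`. -/
theorem innerDer_mul_cyclic (x y z : K) :
    innerDer K (x * y) z + innerDer K (y * z) x + innerDer K (z * x) y = 0 := by
  ext u
  have h := commutator_associator x y z u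
  have h1 := associator_rotate x y z
  have h2 := associator_rotate y z x
  have e1 := congrArg (· * u) h1
  have e2 := congrArg (u * ·) h1
  have e3 := congrArg (· * u) h2
  have e4 := congrArg (u * ·) h2
  simp only [LinearMap.add_apply, innerDer_apply, LinearMap.zero_apply]
  generalize associator (x * y) z u = p at *
  generalize associator (y * z) x u = q at *
  generalize associator (z * x) y u = r at *
  simp only [associator_apply, sub_mul, mul_sub] at *
  linear_combination (norm := module) 3 • h - 2 • e1 + 2 • e2 - e3 + e4

/-- `D_{x,y}` is a derivation. -/
theorem innerDer_mem_der (x y : K) : innerDer K x y ∈ DerK K := by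
  -- Alternativity makes left and right multiplications infinitesimal autotopies: L_x acts on the
  -- factors of a product by L_x + R_x and -L_x, and R_x by -R_x and L_x + R_x. For the combination
  -- of commutators in D, all three components agree once [R_x, L_y] = [L_x, R_y] is known.
  have hL : ∀ x u v : K, x * (u * v) = (x * u + u * x) * v - u * (x * v) := fun x u v => by
    have := associator_swap_left x u v
    simp only [associator_apply, add_mul] at *
    linear_combination (norm := module) -this
  have hR : ∀ x u v : K, (u * v) * x = -((u * x) * v) + u * (x * v + v * x) := fun x u v => by
    have := associator_swap_right u x v
    simp only [associator_apply, mul_add] at *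
    linear_combination (norm := module) this
  have hLR : ∀ x u v : K, x * (u * v) + (u * v) * x = (x * u) * v + u * (v * x) := fun x u v => by
    rw [hL, hR]; simp only [mul_add, add_mul]; abel
  -- This is [R_x, L_y] = [L_x, R_y].
  have hc : ∀ u : K, (y * u) * x - y * (u * x) = x * (u * y) - (x * u) * y := fun u => by
    have h1 := associator_rotate x u y
    have h2 := associator_rotate u y x
    have h3 := associator_swap_right y u x
    simp only [associator_apply] at *
    linear_combination (norm := module) h3 + h1 +h2
  intro u v
  simp only [LinearMap.mul_apply', innerDer_eq, endComm_apply, leftMul_apply, rightMul_apply,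
    LinearMap.add_apply]
  have c1 := congrArg (· * v) (hc u)
  have c2 := congrArg (u * ·) (hc v)
  have e1 := congrArg (x * ·) (hL y u v)
  have e2 := congrArg (y * ·) (hL x u v)
  have e3 := congrArg (x * ·) (hR y u v)
  have e4 := congrArg (· * y) (hL x u v)
  have e5 := congrArg (· * x) (hR y u v)
  have e6 := congrArg (· * y) (hR x u v)
  simp only [mul_add, add_mul, mul_sub, sub_mul, mul_neg, neg_mul] at *
  rw [e1, e2, e3, e4, e5, e6]
  simp only [hL x (_ * _) v, hL x u (_ * _), hL y (_ * _) v, hL y u (_ * _),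
    hR x (_ * _) v, hR x u (_ * _), hR y (_ * _) v, hR y u (_ * _)]
  linear_combination (norm := module) c1 + c2

theorem mul_add_mul_swap (x y : K) :
    x * y + y * x = (2 * ip K 1 x) • y + (2 * ip K 1 y) • x - (2 * ip K x y) • (1 : K) := by
  have h := mul_self_eq (x + y)
  simp only [mul_add, add_mul, mul_self_eq x, mul_self_eq y, map_add, LinearMap.add_apply,
    ip_comm y x] at h
  linear_combination (norm := module) h

/-- Differentiating the quadratic equation of x along D gives one expression for x Dx + Dx x, and
polarising it gives another; compare them. If ⟨1, Dx⟩ were nonzero, x would be real and Dx would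
vanish. -/
theorem Der.ip_map_self_aux {D : Module.End ℝ K} (hD : D ∈ DerK K) (x : K) :
    ip K 1 (D x) • x = ip K x (D x) • (1 : K) := by
  have h := congrArg D (mul_self_eq x)
  rw [Der.map_mul hD, map_sub, map_smul, map_smul, Der.map_one hD, smul_zero, sub_zero, add_comm,
    mul_add_mul_swap] at h
  linear_combination (norm := module) (1 / 2 : ℝ) • h

/-- Derivations take values in the imaginary elements. -/
theorem Der.ip_one {D : Module.End ℝ K} (hD : D ∈ DerK K) (x : K) : ip K 1 (D x) = 0 := by
  by_contra h
  have h1 := Der.ip_map_self_aux hD x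
  have h2 : x = (ip K 1 (D x))⁻¹ • ip K x (D x) • (1 : K) := by
    rw [← h1, smul_smul, inv_mul_cancel₀ h, one_smul]
  apply h
  rw [h2, map_smul, map_smul D, Der.map_one hD, smul_zero, smul_zero, map_zero]

/-- Derivations are skew with respect to the inner product. -/
theorem Der.ip_skew {D : Module.End ℝ K} (hD : D ∈ DerK K) (x y : K) :
    ip K (D x) y + ip K x (D y) = 0 := by
  have h : ∀ x, ip K x (D x) = 0 := fun x => by
    have h1 := congrArg (ip K 1) (Der.ip_map_self_aux hD x)
    rw [Der.ip_one hD, zero_smul, map_zero, map_smul, ip_one_one, smul_eq_mul, mul_one] at h1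
    exact h1.symm
  have h1 := h (x + y)
  simp only [map_add, LinearMap.add_apply, h, zero_add, add_zero] at h1
  rw [ip_comm (D x)]
  linarith

theorem Der.map_conj {D : Module.End ℝ K} (hD : D ∈ DerK K) (x : K) :
    D (conj K x) = conj K (D x) := by
  rw [conj_apply, conj_apply, map_sub, map_smul, Der.map_one hD, Der.ip_one hD]
  simp

/-- Imaginary elements anticommute up to a scalar, so a can be carried across b and then c; the
rebracketing leaves associators. -/
theorem mul_sub_mul_imaginary {a b c : K} (ha : ip K 1 a = 0) (hb : ip K 1 b = 0)
    (hc : ip K 1 c = 0) : (b * c) * a - a * (b * c) =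
      associator a b c + (2 * ip K a b) • c - (2 * ip K a c) • b := by
  have h1 := associator_rotate a b c
  have h2 := associator_swap_left b a c
  have h3 := mul_add_mul_swap a c
  have h4 := mul_add_mul_swap a b
  rw [ha, hb] at h4
  rw [ha, hc] at h3
  have e3 := congrArg (b * ·) h3
  have e4 := congrArg (· * c) h4
  simp only [associator_apply, mul_add, add_mul, mul_sub, sub_mul, mul_zero, zero_mul, zero_smul,
    mul_smul_comm, smul_mul_assoc, mul_one, one_mul] at *
  linear_combination (norm := module) e3 - e4 + h2 - h1

theorem commutator_commutator_imaginary {a b c : K} (ha : ip K 1 a = 0) (hb : ip K 1 b = 0)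
    (hc : ip K 1 c = 0) : (b * c - c * b) * a - a * (b * c - c * b) =
      (2 : ℝ) • associator a b c + (4 * ip K a b) • c - (4 * ip K a c) • b := by
  have h1 := mul_sub_mul_imaginary ha hb hc
  have h2 := mul_sub_mul_imaginary ha hc hb
  rw [associator_swap_right] at h2
  simp only [sub_mul, mul_sub]
  linear_combination (norm := module) h1 - h2

theorem innerDer_apply_imaginary {a b c : K} (ha : ip K 1 a = 0) (hb : ip K 1 b = 0)
    (hc : ip K 1 c = 0) : innerDer K b c a =
      (4 * ip K a b) • c - (4 * ip K a c) • b - associator a b c := by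
  rw [innerDer_apply, commutator_commutator_imaginary ha hb hc, ← associator_rotate a b c]
  module

end CompositionIdentities

/-! ### Associators of hermitian and antihermitian 3 × 3 matrices. -/

section MatrixAssociators

variable {K : Type*} [NonAssocRing K] [Module ℝ K] [IsScalarTower ℝ K K] [SMulCommClass ℝ K K]
  [CompositionAlgebra K]

theorem matrix_associator_apply (X Y Z : Matrix (Fin 3) (Fin 3) K) (i l : Fin 3) :
    associator X Y Z i l = ∑ j, ∑ k, associator (X i j) (Y j k) (Z k l) := by
  simp only [associator_apply, Matrix.sub_apply, Matrix.mul_apply, Finset.sum_mul, Finset.mul_sum,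
    Finset.sum_sub_distrib]
  congr 1
  rw [Finset.sum_comm]

variable {X Y Z A B : Matrix (Fin 3) (Fin 3) K}

theorem associator_swap_entries (i j k l : Fin 3) (z : K) :
    associator (X i j) (Y k l) z = -associator (Y k l) (X i j) z :=
  associator_swap_left _ _ _

theorem associator_swap_entries' (i j k l : Fin 3) (z : K) :
    associator z (X i j) (Y k l) = -associator z (Y k l) (X i j) :=
  associator_swap_right _ _ _

/-- A diagonal entry is its own conjugate, while conjugating an argument changes the sign of an
associator. -/
theorem associator_hermitian_diag (hX : X ∈ hermitian (conj K))
    (i : Fin 3) (y z : K) : associator (X i i) y z = 0 := by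
  have h : associator (X i i) y z = -associator (X i i) y z := by
    rw [← associator_conj_left, hX i i]
  have h2 : (2 : ℝ) • associator (X i i) y z = 0 := by
    rw [two_smul]
    nth_rewrite 1 [h]
    rw [neg_add_cancel]
  exact (smul_eq_zero.mp h2).resolve_left two_ne_zero

theorem associator_hermitian_diag_mid (hX : X ∈ hermitian (conj K))
    (i : Fin 3) (y z : K) : associator y (X i i) z = 0 := by
  rw [associator_swap_left, associator_hermitian_diag hX, neg_zero]

theorem associator_hermitian_diag_right (hX : X ∈ hermitian (conj K))
    (i : Fin 3) (y z : K) : associator y z (X i i) = 0 := by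
  rw [← associator_rotate, associator_hermitian_diag hX]

theorem associator_hermitian_swap (hX : X ∈ hermitian (conj K))
    (i j : Fin 3) (y z : K) : associator (X j i) y z = -associator (X i j) y z := by
  rw [← hX i j, associator_conj_left, neg_neg]

theorem associator_hermitian_swap_mid (hX : X ∈ hermitian (conj K))
    (i j : Fin 3) (y z : K) : associator y (X j i) z = -associator y (X i j) z := by
  rw [associator_swap_left, associator_hermitian_swap hX, associator_swap_left y]

theorem associator_hermitian_swap_right (hX : X ∈ hermitian (conj K))
    (i j : Fin 3) (y z : K) : associator y z (X j i) = -associator y z (X i j) := by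
  rw [← associator_rotate, associator_hermitian_swap hX, associator_rotate]

/-- Two signs cancel: one from antihermiticity, one from conjugation inside the associator. -/
theorem associator_antihermitian_swap
    (hA : A ∈ antihermitianTraceless (conj K)) (i j : Fin 3) (y z : K) :
    associator (A j i) y z = associator (A i j) y z := by
  rw [← neg_neg (A i j), ← hA.1 i j, associator_neg_left, associator_conj_left, neg_neg]

theorem associator_antihermitian_swap_mid
    (hA : A ∈ antihermitianTraceless (conj K)) (i j : Fin 3) (y z : K) :
    associator y (A j i) z = associator y (A i j) z := by
  rw [associator_swap_left, associator_antihermitian_swap hA, ← associator_swap_left]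

theorem associator_antihermitian_trace
    (hA : A ∈ antihermitianTraceless (conj K)) (y z : K) :
    associator (A 2 2) y z = -associator (A 0 0) y z - associator (A 1 1) y z := by
  have h := hA.2
  rw [Matrix.trace_fin_three] at h
  rw [eq_neg_of_add_eq_zero_right h, associator_neg_left, associator_add_left]
  abel

theorem associator_antihermitian_trace_mid
    (hA : A ∈ antihermitianTraceless (conj K)) (y z : K) :
    associator y (A 2 2) z = -associator y (A 0 0) z - associator y (A 1 1) z := by
  rw [associator_swap_left, associator_antihermitian_trace hA, associator_swap_left y,
    associator_swap_left y]
  abel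

/-- The associator identity behind `[A, X · Y] = [A, X] · Y + X · [A, Y]`. -/
theorem associator_antihermitian_hermitian_hermitian
    (hA : A ∈ antihermitianTraceless (conj K)) (hX : X ∈ hermitian (conj K))
    (hY : Y ∈ hermitian (conj K)) :
    associator A X Y - associator X A Y + associator X Y A +
      (associator A Y X - associator Y A X + associator Y X A) = 0 := by
  have a2 := associator_antihermitian_trace hA
  have as := associator_antihermitian_swap hA
  have xd := associator_hermitian_diag_mid hX
  have xs := associator_hermitian_swap_mid hX
  have yd := associator_hermitian_diag_right hY
  have ys := associator_hermitian_swap_right hY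
  -- In each entry the rewriting brings every associator to a normal form: matrices in the order A,
  -- X, Y, off-diagonal indices above the diagonal, the last diagonal entry of A eliminated by the
  -- trace. Real diagonal entries of X and Y drop out, and the rest cancels additively.
  ext i l
  fin_cases i <;> fin_cases l <;>
    simp only [Matrix.add_apply, Matrix.sub_apply, matrix_associator_apply, Fin.sum_univ_three,
      Matrix.zero_apply, Fin.zero_eta, Fin.mk_one, Fin.reduceFinMk,
      associator_swap_entries (X := X) (Y := A), associator_swap_entries (X := Y) (Y := A),
      associator_swap_entries' (X := X) (Y := A), associator_swap_entries' (X := Y) (Y := A),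
      associator_swap_entries' (X := Y) (Y := X), xd, yd, xs 0 1, xs 0 2, xs 1 2,
      ys 0 1, ys 0 2, ys 1 2, as 0 1, as 0 2, as 1 2, a2] <;>
    abel

/-- The associator identity behind `[ad A, ad B] = ad [A, B]' + ⅓ ∑ D_{a_ij, b_ij}`. -/
theorem associator_antihermitian_antihermitian_hermitian
    (hA : A ∈ antihermitianTraceless (conj K)) (hB : B ∈ antihermitianTraceless (conj K))
    (hZ : Z ∈ hermitian (conj K)) (i l : Fin 3) :
    (associator A B Z + associator B Z A + associator Z A B - associator B A Z
      - associator A Z B - associator Z B A) i l =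
      ∑ j, ∑ k, associator (A j k) (B j k) (Z i l) := by
  have a2 := associator_antihermitian_trace hA
  have as := associator_antihermitian_swap hA
  have b2 := associator_antihermitian_trace_mid hB
  have bs := associator_antihermitian_swap_mid hB
  have zd := associator_hermitian_diag_right hZ
  have zs := associator_hermitian_swap_right hZ
  fin_cases i <;> fin_cases l <;>
    simp only [Matrix.add_apply, Matrix.sub_apply, matrix_associator_apply, Fin.sum_univ_three,
      Fin.zero_eta, Fin.mk_one, Fin.reduceFinMk,
      associator_swap_entries (X := B) (Y := A), associator_swap_entries (X := Z) (Y := A),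
      associator_swap_entries' (X := B) (Y := A), associator_swap_entries' (X := Z) (Y := A),
      associator_swap_entries' (X := Z) (Y := B), zd, zs 0 1, zs 0 2, zs 1 2,
      bs 0 1, bs 0 2, bs 1 2, b2, as 0 1, as 0 2, as 1 2, a2] <;>
    abel

/-- The associator identity behind `[L_X, L_Y] = ad [X, Y]' - ⅓ ∑ D_{x_ij, y_ij}`. -/
theorem associator_hermitian_hermitian_hermitian
    (hX : X ∈ hermitian (conj K)) (hY : Y ∈ hermitian (conj K))
    (hZ : Z ∈ hermitian (conj K)) (i l : Fin 3) :
    (associator Y X Z - associator X Y Z - associator X Z Y + associator Y Z X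
      + associator Z Y X - associator Z X Y) i l =
      ∑ j, ∑ k, associator (X j k) (Y j k) (Z i l) := by
  have xd := associator_hermitian_diag hX
  have xs := associator_hermitian_swap hX
  have yd := associator_hermitian_diag_mid hY
  have ys := associator_hermitian_swap_mid hY
  have zd := associator_hermitian_diag_right hZ
  have zs := associator_hermitian_swap_right hZ
  fin_cases i <;> fin_cases l <;>
    simp only [Matrix.add_apply, Matrix.sub_apply, matrix_associator_apply, Fin.sum_univ_three,
      Fin.zero_eta, Fin.mk_one, Fin.reduceFinMk,
      associator_swap_entries (X := Y) (Y := X), associator_swap_entries (X := Z) (Y := X),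
      associator_swap_entries' (X := Y) (Y := X), associator_swap_entries' (X := Z) (Y := X),
      associator_swap_entries' (X := Z) (Y := Y), zd, zs 0 1, zs 0 2, zs 1 2,
      yd, ys 0 1, ys 0 2, ys 1 2, xd, xs 0 1, xs 0 2, xs 1 2] <;>
    abel

/-- The symmetrised associator of hermitian matrices is a scalar matrix. -/
theorem associator_hermitian_symm_sum
    (hX : X ∈ hermitian (conj K)) (hY : Y ∈ hermitian (conj K))
    (hZ : Z ∈ hermitian (conj K)) :
    ∃ s : K, associator X Y Z + associator Y Z X + associator Z X Y + associator Y X Z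
      + associator X Z Y + associator Z Y X = Matrix.diagonal fun _ => s := by
  have xd := associator_hermitian_diag hX
  have xs := associator_hermitian_swap hX
  have yd := associator_hermitian_diag_mid hY
  have ys := associator_hermitian_swap_mid hY
  have zd := associator_hermitian_diag_right hZ
  have zs := associator_hermitian_swap_right hZ
  -- The scalar is read off at the corner; the normal forms show that the three diagonal entries
  -- agree and the others vanish.
  refine ⟨(associator X Y Z + associator Y Z X + associator Z X Y + associator Y X Z
      + associator X Z Y + associator Z Y X) 0 0, ?_⟩
  ext i l
  fin_cases i <;> fin_cases l <;>
    simp [Matrix.add_apply, matrix_associator_apply, Fin.sum_univ_three,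
      associator_swap_entries (X := Y) (Y := X), associator_swap_entries (X := Z) (Y := X),
      associator_swap_entries' (X := Y) (Y := X), associator_swap_entries' (X := Z) (Y := X),
      associator_swap_entries' (X := Z) (Y := Y), zd, zs 0 1, zs 0 2, zs 1 2,
      yd, ys 0 1, ys 0 2, ys 1 2, xd, xs 0 1, xs 0 2, xs 1 2] <;>
    abel

end MatrixAssociators

theorem tracelessPart_mem_antihermitian {R : Type*} [AddCommGroup R] [Module ℝ R] {c : R →ₗ[ℝ] R}
    {X : Matrix (Fin 3) (Fin 3) R} (h : ∀ i j, c (X j i) = -X i j) :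
    tracelessPart X ∈ antihermitianTraceless c := by
  refine ⟨fun i j => ?_, trace_tracelessPart _⟩
  rw [tracelessPart, Matrix.sub_apply, Matrix.sub_apply, map_sub, h, neg_sub', sub_right_inj]
  by_cases hij : i = j
  · subst hij
    simp only [Matrix.diagonal_apply_eq, map_smul, Matrix.trace, map_sum, Matrix.diag_apply, h,
      Finset.sum_neg_distrib, smul_neg]
  · rw [Matrix.diagonal_apply_ne _ hij, Matrix.diagonal_apply_ne _ (Ne.symm hij), map_zero,
      neg_zero]

/-! ### Operators on H₃(K), their commutators, the Jordan identity and the trace form. -/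

section JordanOperators

variable {K : Type*} [NonAssocRing K] [Module ℝ K] [IsScalarTower ℝ K K] [SMulCommClass ℝ K K]
  [CompositionAlgebra K]

theorem mat_jordanMul (X Y : H3 K) :
    mat K (jordanMul K X Y) = mat K X * mat K Y + mat K Y * mat K X := rfl

theorem jordanMul_comm (X Y : H3 K) : jordanMul K X Y = jordanMul K Y X :=
  mat_injective (by rw [mat_jordanMul, mat_jordanMul, add_comm])

theorem conj_mat (X : H3 K) (i j : Fin 3) : conj K (mat K X j i) = mat K X i j := mat_mem X i j

theorem H3.ext_mat {X Y : H3 K} (h : ∀ i j, mat K X i j = mat K Y i j) : X = Y :=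
  mat_injective (Matrix.ext h)

theorem commutator_mem_hermitian (A : antihermitianTraceless (conj K)) (X : H3 K) :
    A.1 * mat K X - mat K X * A.1 ∈ hermitian (conj K) := by
  intro i j
  simp only [Matrix.sub_apply, Matrix.mul_apply, map_sub, map_sum, conj_mul, conj_mat, A.2.1,
    mul_neg, neg_mul, Finset.sum_neg_distrib]
  abel

variable (K) in
/-- The action `X ↦ [A, X]` of traceless antihermitian matrices on `H₃(K)`. -/
noncomputable def adOp : antihermitianTraceless (conj K) →ₗ[ℝ] Module.End ℝ (H3 K) :=
  LinearMap.mk₂ ℝ (fun A X => H3.mk K (A.1 * mat K X - mat K X * A.1)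
      (commutator_mem_hermitian A X))
    (fun A A' X => mat_injective <| by
      simp only [mat_mk, map_add, Matrix.add_mul, Matrix.mul_add, Submodule.coe_add]; abel)
    (fun t A X => mat_injective <| by
      simp only [mat_mk, map_smul, Matrix.smul_mul, Matrix.mul_smul, smul_sub, Submodule.coe_smul])
    (fun A X Y => mat_injective <| by
      simp only [mat_mk, map_add, Matrix.add_mul, Matrix.mul_add]; abel)
    (fun t A X => mat_injective <| by
      simp only [mat_mk, map_smul, Matrix.smul_mul, Matrix.mul_smul, smul_sub])

theorem mat_adOp (A : antihermitianTraceless (conj K)) (X : H3 K) :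
    mat K (adOp K A X) = A.1 * mat K X - mat K X * A.1 := rfl

theorem map_mem_hermitian (D : DerK K) (X : H3 K) : (mat K X).map D.1 ∈ hermitian (conj K) := by
  intro i j
  rw [Matrix.map_apply, Matrix.map_apply, ← Der.map_conj D.2, conj_mat]

variable (K) in
/-- The elementwise action of the derivations of `K` on `H₃(K)`. -/
noncomputable def derOp : DerK K →ₗ[ℝ] Module.End ℝ (H3 K) :=
  LinearMap.mk₂ ℝ (fun D X => H3.mk K ((mat K X).map D.1) (map_mem_hermitian D X))
    (fun D D' X => H3.ext_mat fun i j => by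
      simp only [mat_mk, map_add, Matrix.add_apply, Matrix.map_apply, Submodule.coe_add,
        LinearMap.add_apply])
    (fun t D X => H3.ext_mat fun i j => by
      simp only [mat_mk, map_smul, Matrix.smul_apply, Matrix.map_apply, Submodule.coe_smul,
        LinearMap.smul_apply])
    (fun D X Y => H3.ext_mat fun i j => by
      simp only [mat_mk, map_add, Matrix.add_apply, Matrix.map_apply])
    (fun t D X => H3.ext_mat fun i j => by
      simp only [mat_mk, map_smul, Matrix.smul_apply, Matrix.map_apply])

theorem mat_derOp (D : DerK K) (X : H3 K) (i j : Fin 3) :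
    mat K (derOp K D X) i j = D.1 (mat K X i j) := rfl

theorem derOp_mem_der (D : DerK K) : derOp K D ∈ DerH3 K := by
  intro X Y
  refine H3.ext_mat fun i j => ?_
  simp only [mat_derOp, mat_jordanMul, map_add, Matrix.add_apply, Matrix.mul_apply, map_sum,
    Der.map_mul D.2, Finset.sum_add_distrib]
  abel

/-- With associative entries the Leibniz rule for [A, ·] would be formal; the defect is the sum of
matrix associators that vanishes by `associator_antihermitian_hermitian_hermitian`. -/
theorem adOp_mem_der (A : antihermitianTraceless (conj K)) : adOp K A ∈ DerH3 K := by
  intro X Y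
  refine mat_injective ?_
  have h := associator_antihermitian_hermitian_hermitian A.2 (mat_mem X) (mat_mem Y)
  simp only [associator_apply] at h
  simp only [mat_jordanMul, mat_adOp, map_add, Matrix.mul_add, Matrix.add_mul, Matrix.mul_sub,
    Matrix.sub_mul]
  linear_combination (norm := abel) -h

/-- The elementwise action of the derivations of `K` on traceless antihermitian matrices. -/
noncomputable def derAnti (D : DerK K) (A : antihermitianTraceless (conj K)) :
    antihermitianTraceless (conj K) :=
  ⟨A.1.map D.1, fun i j => by
      rw [Matrix.map_apply, Matrix.map_apply, ← Der.map_conj D.2, A.2.1, map_neg], by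
      have h := congrArg D.1 A.2.2
      rwa [map_zero, Matrix.trace, map_sum] at h⟩

theorem endComm_derOp_adOp (D : DerK K) (A : antihermitianTraceless (conj K)) :
    endComm (H3 K) (derOp K D) (adOp K A) = adOp K (derAnti D A) := by
  refine LinearMap.ext fun X => H3.ext_mat fun i j => ?_
  simp only [endComm_apply, map_sub, mat_derOp, mat_adOp, Matrix.sub_apply, Matrix.mul_apply,
    map_sum, Der.map_mul D.2, Finset.sum_add_distrib, derAnti, Matrix.map_apply]
  abel

theorem endComm_derOp_derOp (D E : DerK K) :
    endComm (H3 K) (derOp K D) (derOp K E) = derOp K (derComm D E) := by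
  refine LinearMap.ext fun X => H3.ext_mat fun i j => ?_
  simp only [endComm_apply, map_sub, mat_derOp, Matrix.sub_apply, derComm]

/-- The commutator `(AB - BA)'` of traceless antihermitian matrices. -/
noncomputable def antiComm (A B : antihermitianTraceless (conj K)) :
    antihermitianTraceless (conj K) :=
  ⟨tracelessPart (A.1 * B.1 - B.1 * A.1), tracelessPart_mem_antihermitian fun i j => by
    simp only [Matrix.sub_apply, Matrix.mul_apply, map_sub, map_sum, conj_mul, A.2.1, B.2.1,
      neg_mul_neg]
    abel⟩

/-- The commutator `(XY - YX)'` of hermitian matrices. -/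
noncomputable def hermComm (X Y : H3 K) : antihermitianTraceless (conj K) :=
  ⟨tracelessPart (mat K X * mat K Y - mat K Y * mat K X),
    tracelessPart_mem_antihermitian fun i j => by
      simp only [Matrix.sub_apply, Matrix.mul_apply, map_sub, map_sum, conj_mul, conj_mat]
      abel⟩

/-- The derivation `∑ D_{x_ij, y_ij}`. -/
noncomputable def sumInnerDer (X Y : Matrix (Fin 3) (Fin 3) K) : DerK K :=
  ⟨∑ i, ∑ j, innerDer K (X i j) (Y i j),
    Submodule.sum_mem _ fun _ _ => Submodule.sum_mem _ fun _ _ => innerDer_mem_der _ _⟩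

theorem sumInnerDer_apply (X Y : Matrix (Fin 3) (Fin 3) K) (z : K) :
    (sumInnerDer X Y).1 z = ((∑ j, ∑ k, (X j k * Y j k - Y j k * X j k)) * z
      - z * (∑ j, ∑ k, (X j k * Y j k - Y j k * X j k)))
      - (3 : ℝ) • ∑ j, ∑ k, associator (X j k) (Y j k) z := by
  simp only [sumInnerDer, LinearMap.sum_apply, innerDer_apply, mul_sub, sub_mul,
    Finset.sum_sub_distrib, Finset.sum_mul, Finset.mul_sum, Finset.smul_sum]

theorem trace_commutator (X Y : Matrix (Fin 3) (Fin 3) K) :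
    (X * Y - Y * X).trace = ∑ j, ∑ k, (X j k * Y k j - Y k j * X j k) := by
  simp only [Matrix.trace_fin_three, Matrix.sub_apply, Matrix.mul_apply, Fin.sum_univ_three]
  abel

theorem trace_commutator_antihermitian (A B : antihermitianTraceless (conj K)) :
    (A.1 * B.1 - B.1 * A.1).trace = ∑ j, ∑ k, (A.1 j k * B.1 j k - B.1 j k * A.1 j k) := by
  rw [trace_commutator]
  refine Finset.sum_congr rfl fun j _ => Finset.sum_congr rfl fun k _ => ?_
  rw [← neg_neg (B.1 k j), ← B.2.1, mul_neg, neg_mul, ← neg_sub', commutator_conj, neg_neg]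

theorem trace_commutator_hermitian (X Y : H3 K) :
    (mat K X * mat K Y - mat K Y * mat K X).trace =
      -∑ j, ∑ k, (mat K X j k * mat K Y j k - mat K Y j k * mat K X j k) := by
  rw [trace_commutator, ← Finset.sum_neg_distrib]
  refine Finset.sum_congr rfl fun j _ => ?_
  rw [← Finset.sum_neg_distrib]
  refine Finset.sum_congr rfl fun k _ => ?_
  rw [← conj_mat Y k j, commutator_conj]

theorem tracelessPart_commutator_apply (M Z : Matrix (Fin 3) (Fin 3) K) (i l : Fin 3) :
    (tracelessPart M * Z - Z * tracelessPart M) i l =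
      (M * Z - Z * M) i l - (1 / 3 : ℝ) • (M.trace * Z i l - Z i l * M.trace) := by
  simp only [tracelessPart, Matrix.sub_mul, Matrix.mul_sub, Matrix.sub_apply,
    Matrix.diagonal_mul, Matrix.mul_diagonal, smul_mul_assoc, mul_smul_comm]
  module

/-- Removing the trace of [A, B] costs -⅓[tr [A, B], z] in each entry z. The commutator part of ⅓∑D
restores it, because tr [A, B] = ∑[a_ij, b_ij]; the associator part of ⅓∑D, where the 3 of
`innerDer_apply` cancels the ⅓, is the nonassociative defect. -/
theorem endComm_adOp_adOp (A B : antihermitianTraceless (conj K)) :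
    endComm (H3 K) (adOp K A) (adOp K B) =
      adOp K (antiComm A B) + derOp K ((1 / 3 : ℝ) • sumInnerDer A.1 B.1) := by
  refine LinearMap.ext fun X => H3.ext_mat fun i l => ?_
  have h := associator_antihermitian_antihermitian_hermitian A.2 B.2 (mat_mem X) i l
  rw [LinearMap.add_apply, map_add, Matrix.add_apply, map_smul, LinearMap.smul_apply, map_smul,
    Matrix.smul_apply, mat_derOp, sumInnerDer_apply, mat_adOp]
  simp only [antiComm]
  rw [tracelessPart_commutator_apply, trace_commutator_antihermitian]
  rw [← h]
  simp only [endComm_apply, map_sub, mat_adOp, associator_apply, Matrix.mul_sub, Matrix.sub_mul,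
    Matrix.sub_apply, Matrix.add_apply]
  module

/-- The same compensation as for antihermitian matrices, with the opposite sign of D: for hermitian
matrices tr [X, Y] = -∑[x_ij, y_ij]. -/
theorem endComm_jordanMul_jordanMul (X Y : H3 K) :
    endComm (H3 K) (jordanMul K X) (jordanMul K Y) =
      adOp K (hermComm X Y) - derOp K ((1 / 3 : ℝ) • sumInnerDer (mat K X) (mat K Y)) := by
  refine LinearMap.ext fun Z => H3.ext_mat fun i l => ?_
  have h := associator_hermitian_hermitian_hermitian (mat_mem X) (mat_mem Y) (mat_mem Z) i l
  rw [LinearMap.sub_apply, map_sub, Matrix.sub_apply, map_smul, LinearMap.smul_apply, map_smul,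
    Matrix.smul_apply, mat_derOp, sumInnerDer_apply, mat_adOp]
  simp only [hermComm]
  rw [tracelessPart_commutator_apply, trace_commutator_hermitian]
  rw [← h]
  simp only [endComm_apply, map_sub, mat_jordanMul, associator_apply, Matrix.mul_sub,
    Matrix.sub_mul, Matrix.mul_add, Matrix.add_mul, Matrix.sub_apply, Matrix.add_apply, neg_mul,
    mul_neg]
  module

theorem endComm_jordanMul_mem_der (X Y : H3 K) :
    endComm (H3 K) (jordanMul K X) (jordanMul K Y) ∈ DerH3 K := by
  rw [endComm_jordanMul_jordanMul]
  exact Submodule.sub_mem _ (adOp_mem_der _) (derOp_mem_der _)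

/-- Replacing z_ij by the conjugate of z_ji changes the sign of D and turns each sum into one of
D_{x_ik y_kj, z_ji} over closed index cycles. After relabelling, the three sums cancel termwise by
`innerDer_mul_cyclic`. -/
theorem sumInnerDer_cyclic (X Y Z : H3 K) :
    sumInnerDer (mat K X * mat K Y) (mat K Z) + sumInnerDer (mat K Y * mat K Z) (mat K X)
      + sumInnerDer (mat K Z * mat K X) (mat K Y) = 0 := by
  have e : ∀ X Y Z : H3 K, (sumInnerDer (mat K X * mat K Y) (mat K Z)).1 =
      -∑ i, ∑ k, ∑ j, innerDer K (mat K X i k * mat K Y k j) (mat K Z j i) := fun X Y Z => by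
    change ∑ i, ∑ j, innerDer K ((mat K X * mat K Y) i j) (mat K Z i j) = _
    rw [← Finset.sum_neg_distrib]
    refine Finset.sum_congr rfl fun i _ => ?_
    rw [Finset.sum_comm, ← Finset.sum_neg_distrib]
    refine Finset.sum_congr rfl fun j _ => ?_
    rw [Matrix.mul_apply, map_sum, LinearMap.sum_apply, ← Finset.sum_neg_distrib]
    refine Finset.sum_congr rfl fun k _ => ?_
    rw [← conj_mat Z i j, innerDer_conj_right]
  apply Subtype.ext
  rw [Submodule.coe_add, Submodule.coe_add, e, e, e]
  have e2 : ∑ i, ∑ k, ∑ j, innerDer K (mat K Y i k * mat K Z k j) (mat K X j i) =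
      ∑ i, ∑ k, ∑ j, innerDer K (mat K Y k j * mat K Z j i) (mat K X i k) := by
    simp only [Fin.sum_univ_three]; abel
  have e3 : ∑ i, ∑ k, ∑ j, innerDer K (mat K Z i k * mat K X k j) (mat K Y j i) =
      ∑ i, ∑ k, ∑ j, innerDer K (mat K Z j i * mat K X i k) (mat K Y k j) := by
    simp only [Fin.sum_univ_three]; abel
  rw [e2, e3, ← neg_add, ← neg_add, ← Finset.sum_add_distrib, ← Finset.sum_add_distrib]
  simp only [← Finset.sum_add_distrib, innerDer_mul_cyclic]
  simp

theorem sumInnerDer_add_left (X X' Y : Matrix (Fin 3) (Fin 3) K) :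
    sumInnerDer (X + X') Y = sumInnerDer X Y + sumInnerDer X' Y := by
  apply Subtype.ext
  simp only [sumInnerDer, Matrix.add_apply, map_add, LinearMap.add_apply, Finset.sum_add_distrib,
    Submodule.coe_add]

theorem tracelessPart_add {R : Type*} [AddCommGroup R] [Module ℝ R]
    (X Y : Matrix (Fin 3) (Fin 3) R) :
    tracelessPart (X + Y) = tracelessPart X + tracelessPart Y := by
  simp only [tracelessPart, Matrix.trace_add, smul_add, ← Matrix.diagonal_add]
  abel

/-- For associative entries the cyclic sum of [X · Y, Z] is zero. Here it equals the symmetrised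
associator, a scalar matrix, and so has no traceless part. -/
theorem hermComm_cyclic (X Y Z : H3 K) :
    hermComm (jordanMul K X Y) Z + hermComm (jordanMul K Y Z) X
      + hermComm (jordanMul K Z X) Y = 0 := by
  obtain ⟨s, hs⟩ := associator_hermitian_symm_sum (mat_mem X) (mat_mem Y) (mat_mem Z)
  apply Subtype.ext
  simp only [hermComm, Submodule.coe_add, ← tracelessPart_add, mat_jordanMul]
  have h : (mat K X * mat K Y + mat K Y * mat K X) * mat K Z
        - mat K Z * (mat K X * mat K Y + mat K Y * mat K X)
      + ((mat K Y * mat K Z + mat K Z * mat K Y) * mat K X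
        - mat K X * (mat K Y * mat K Z + mat K Z * mat K Y))
      + ((mat K Z * mat K X + mat K X * mat K Z) * mat K Y
        - mat K Y * (mat K Z * mat K X + mat K X * mat K Z)) = Matrix.diagonal fun _ => s := by
    rw [← hs]
    simp only [associator_apply, Matrix.mul_add, Matrix.add_mul]
    abel
  rw [h, tracelessPart, Matrix.trace_diagonal, Submodule.coe_zero, sub_eq_zero]
  congr 1
  ext
  rw [Finset.sum_const, Finset.card_univ, Fintype.card_fin]
  module

/-- The linearised Jordan identity. -/
theorem jordan_identity (X Y Z : H3 K) :
    endComm (H3 K) (jordanMul K (jordanMul K X Y)) (jordanMul K Z)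
      + endComm (H3 K) (jordanMul K (jordanMul K Y Z)) (jordanMul K X)
      + endComm (H3 K) (jordanMul K (jordanMul K Z X)) (jordanMul K Y) = 0 := by
  have h1 := hermComm_cyclic X Y Z
  have h2 := sumInnerDer_cyclic X Y Z
  have h3 := sumInnerDer_cyclic Y X Z
  have h4 : sumInnerDer (mat K (jordanMul K X Y)) (mat K Z)
      + sumInnerDer (mat K (jordanMul K Y Z)) (mat K X)
      + sumInnerDer (mat K (jordanMul K Z X)) (mat K Y) = 0 := by
    simp only [mat_jordanMul, sumInnerDer_add_left]
    linear_combination (norm := abel) h2 + h3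
  -- The identity now separates into an antihermitian part and an elementwise part, each of which
  -- vanishes by its own cyclic identity.
  simp only [endComm_jordanMul_jordanMul]
  have h5 := congrArg (adOp K) h1
  have h6 := congrArg (derOp K) h4
  simp only [map_add, map_zero, map_smul] at *
  linear_combination (norm := module) h5 - (1 / 3 : ℝ) • h6

/-- The real trace `⟨1, tr X⟩`. -/
noncomputable def reTrace : H3 K →ₗ[ℝ] ℝ :=
  (ip K 1) ∘ₗ (Matrix.traceLinearMap (Fin 3) ℝ K) ∘ₗ mat K

theorem reTrace_apply (X : H3 K) : reTrace X = ip K 1 (mat K X).trace := rfl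

theorem eq_ip_one_smul {x : K} (h : conj K x = x) : x = ip K 1 x • (1 : K) := by
  rw [conj_apply] at h
  linear_combination (norm := module) -(1 / 2 : ℝ) • h

theorem mat_diag (X : H3 K) (i : Fin 3) : mat K X i i = ip K 1 (mat K X i i) • (1 : K) :=
  eq_ip_one_smul (conj_mat X i i)

theorem trace_eq_reTrace (X : H3 K) : (mat K X).trace = reTrace X • (1 : K) :=
  eq_ip_one_smul (by simp only [Matrix.trace, map_sum, Matrix.diag_apply, conj_mat])

theorem mem_H3Traceless {X : H3 K} : X ∈ H3Traceless K ↔ reTrace X = 0 := by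
  change (mat K X).trace = 0 ↔ _
  refine ⟨fun h => by rw [reTrace_apply, h, map_zero], fun h => by
    rw [trace_eq_reTrace, h, zero_smul]⟩

theorem ip_one_mul_comm (x y : K) : ip K 1 (x * y) = ip K 1 (y * x) := by
  rw [ip_comm, ip_mul_left_adj, mul_one, ip_comm 1, ip_mul_right_adj, one_mul]

theorem ip_one_mul_conj (x y : K) : ip K 1 (x * conj K y) = ip K x y := by
  rw [ip_comm, ip_mul_right_adj, conj_conj, one_mul]

theorem hermIp_eq (X Y : H3 K) : hermIp X Y = ∑ i, ∑ j, ip K (mat K X i j) (mat K Y i j) := by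
  have h : ∀ X Y : H3 K, ip K 1 (mat K X * mat K Y).trace =
      ∑ i, ∑ j, ip K (mat K X i j) (mat K Y i j) := fun X Y => by
    simp only [Matrix.trace, Matrix.diag_apply, Matrix.mul_apply, map_sum]
    refine Finset.sum_congr rfl fun i _ => Finset.sum_congr rfl fun j _ => ?_
    rw [← conj_mat Y j i, ip_one_mul_conj]
  rw [hermIp, mat_jordanMul, Matrix.trace_add, map_add, h, h]
  simp only [fun i j => ip_comm (mat K Y i j) (mat K X i j)]
  ring

theorem hermIp_reTrace (X Y : H3 K) : hermIp X Y = 1 / 2 * reTrace (jordanMul K X Y) := rfl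

theorem hermIp_comm (X Y : H3 K) : hermIp X Y = hermIp Y X := by
  rw [hermIp_reTrace, jordanMul_comm, ← hermIp_reTrace]

/-- Associativity of the trace form follows entrywise from the adjointness of multiplications by an
element and its conjugate; the entries themselves need not associate. -/
theorem hermIp_jordanMul (X Y Z : H3 K) :
    hermIp (jordanMul K X Y) Z = hermIp X (jordanMul K Y Z) := by
  simp only [hermIp_eq, mat_jordanMul, Matrix.add_apply, Matrix.mul_apply, map_add, map_sum,
    LinearMap.add_apply, LinearMap.sum_apply]
  have h1 : ∀ i j k, ip K (mat K X i k * mat K Y k j) (mat K Z i j) =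
      ip K (mat K X i k) (mat K Z i j * mat K Y j k) := fun i j k => by
    rw [ip_mul_right_adj, conj_mat]
  have h2 : ∀ i j k, ip K (mat K Y i k * mat K X k j) (mat K Z i j) =
      ip K (mat K X k j) (mat K Y k i * mat K Z i j) := fun i j k => by
    rw [ip_mul_left_adj, conj_mat]
  simp only [h1, h2, Fin.sum_univ_three]
  ring

theorem reTrace_adOp (A : antihermitianTraceless (conj K)) (X : H3 K) :
    reTrace (adOp K A X) = 0 := by
  rw [reTrace_apply, mat_adOp, trace_commutator, map_sum]
  simp only [map_sum, map_sub, fun j k => ip_one_mul_comm (A.1 j k) (mat K X k j), sub_self,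
    Finset.sum_const_zero]

theorem reTrace_derOp (D : DerK K) (X : H3 K) : reTrace (derOp K D X) = 0 := by
  simp only [reTrace_apply, Matrix.trace, Matrix.diag_apply, mat_derOp, map_sum, Der.ip_one D.2,
    Finset.sum_const_zero]

end JordanOperators

/-! ### Coordinates on H₃(K) and the Cayley–Hamilton identity. -/

section JordanCoordinates

variable {K : Type*} [NonAssocRing K] [Module ℝ K] [IsScalarTower ℝ K K] [SMulCommClass ℝ K K]
  [CompositionAlgebra K]

theorem mul_conj_add_mul_conj (x y : K) :
    x * conj K y + y * conj K x = (2 * ip K x y) • (1 : K) := by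
  have h := mul_conj_self (x + y)
  simp only [map_add, mul_add, add_mul, mul_conj_self x, mul_conj_self y, LinearMap.add_apply,
    ip_comm y x] at h
  linear_combination (norm := module) h

theorem conj_mul_add_conj_mul (x y : K) :
    conj K x * y + conj K y * x = (2 * ip K x y) • (1 : K) := by
  have h := conj_mul_self (x + y)
  simp only [map_add, mul_add, add_mul, conj_mul_self x, conj_mul_self y, LinearMap.add_apply,
    ip_comm y x] at h
  linear_combination (norm := module) h

theorem conj_eq_neg {x : K} (hx : ip K 1 x = 0) : conj K x = -x := by
  rw [conj_apply, hx]; simp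

/-- Cyclic invariance of the real part of a triple product, which makes the cubic term of the
determinant well defined. -/
theorem ip_conj_mul_rotate (x y z : K) :
    ip K x (conj K (y * z)) = ip K z (conj K (x * y)) := by
  rw [conj_mul, ← ip_mul_right_adj, ← ip_conj_left, ip_comm]

theorem smul_one_injective {r s : ℝ} (h : r • (1 : K) = s • (1 : K)) : r = s := by
  have h := congrArg (ip K 1) h
  simpa [ip_one_one] using h

/-- The hermitian matrix with diagonal `r, s, t` and entries `x, y, z` in the positions
`(2, 3)`, `(3, 1)`, `(1, 2)`. -/
noncomputable def ofCoords (r s t : ℝ) (x y z : K) : H3 K :=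
  H3.mk K !![r • 1, z, conj K y; conj K z, s • 1, x; y, conj K x, t • 1] (by
    intro i j
    fin_cases i <;> fin_cases j <;> simp [conj_conj, conj_one])

theorem H3.ext_coords {X Y : H3 K} (h0 : mat K X 0 0 = mat K Y 0 0)
    (h1 : mat K X 1 1 = mat K Y 1 1) (h2 : mat K X 2 2 = mat K Y 2 2)
    (hx : mat K X 1 2 = mat K Y 1 2) (hy : mat K X 2 0 = mat K Y 2 0)
    (hz : mat K X 0 1 = mat K Y 0 1) : X = Y := by
  have hx' : mat K X 2 1 = mat K Y 2 1 := by rw [← conj_mat, hx, conj_mat]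
  have hy' : mat K X 0 2 = mat K Y 0 2 := by rw [← conj_mat, hy, conj_mat]
  have hz' : mat K X 1 0 = mat K Y 1 0 := by rw [← conj_mat, hz, conj_mat]
  refine H3.ext_mat fun i j => ?_
  fin_cases i <;> fin_cases j <;> assumption

theorem mat_ofCoords (r s t : ℝ) (x y z : K) : mat K (ofCoords r s t x y z) =
    !![r • 1, z, conj K y; conj K z, s • 1, x; y, conj K x, t • 1] := rfl

theorem exists_ofCoords (X : H3 K) : ∃ r s t x y z, X = ofCoords r s t x y z := by
  exact ⟨_, _, _, mat K X 1 2, mat K X 2 0, mat K X 0 1,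
    H3.ext_coords (mat_diag X 0) (mat_diag X 1) (mat_diag X 2) rfl rfl rfl⟩

theorem ofCoords_inj {r s t r' s' t' : ℝ} {x y z x' y' z' : K} :
    ofCoords r s t x y z = ofCoords r' s' t' x' y' z' ↔
      r = r' ∧ s = s' ∧ t = t' ∧ x = x' ∧ y = y' ∧ z = z' := by
  constructor
  · intro h
    have h' : ∀ i j, mat K (ofCoords r s t x y z) i j = mat K (ofCoords r' s' t' x' y' z') i j :=
      fun i j => by rw [h]
    exact ⟨smul_one_injective (h' 0 0), smul_one_injective (h' 1 1), smul_one_injective (h' 2 2),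
      h' 1 2, h' 2 0, h' 0 1⟩
  · rintro ⟨rfl, rfl, rfl, rfl, rfl, rfl⟩
    rfl

theorem ofCoords_add (r s t r' s' t' : ℝ) (x y z x' y' z' : K) :
    ofCoords r s t x y z + ofCoords r' s' t' x' y' z' =
      ofCoords (r + r') (s + s') (t + t') (x + x') (y + y') (z + z') := by
  refine H3.ext_coords ?_ ?_ ?_ ?_ ?_ ?_ <;> simp [mat_ofCoords, add_smul]

theorem ofCoords_smul (c r s t : ℝ) (x y z : K) :
    c • ofCoords r s t x y z = ofCoords (c * r) (c * s) (c * t) (c • x) (c • y) (c • z) := by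
  refine H3.ext_coords ?_ ?_ ?_ ?_ ?_ ?_ <;> simp [mat_ofCoords, mul_smul]

theorem ofCoords_zero : ofCoords 0 0 0 0 0 (0 : K) = 0 := by
  refine H3.ext_coords ?_ ?_ ?_ ?_ ?_ ?_ <;> simp [mat_ofCoords]

theorem jordanMul_ofCoords (r s t r' s' t' : ℝ) (x y z x' y' z' : K) :
    jordanMul K (ofCoords r s t x y z) (ofCoords r' s' t' x' y' z') =
      ofCoords (2 * (r * r' + ip K y y' + ip K z z')) (2 * (s * s' + ip K x x' + ip K z z'))
        (2 * (t * t' + ip K x x' + ip K y y'))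
        ((s + t) • x' + (s' + t') • x + conj K (y' * z) + conj K (y * z'))
        ((t + r) • y' + (t' + r') • y + conj K (z' * x) + conj K (z * x'))
        ((r + s) • z' + (r' + s') • z + conj K (x' * y) + conj K (x * y')) := by
  have hx := mul_conj_add_mul_conj x x'
  have hx' := conj_mul_add_conj_mul x x'
  have hy := mul_conj_add_mul_conj y y'
  have hy' := conj_mul_add_conj_mul y y'
  have hz := mul_conj_add_mul_conj z z'
  have hz' := conj_mul_add_conj_mul z z'
  refine H3.ext_coords ?_ ?_ ?_ ?_ ?_ ?_ <;>
    simp [mat_jordanMul, mat_ofCoords, conj_mul]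
  · linear_combination (norm := module) hz + hy'
  · linear_combination (norm := module) hx + hz'
  · linear_combination (norm := module) hy + hx'
  · module
  · module
  · module

theorem reTrace_ofCoords (r s t : ℝ) (x y z : K) :
    reTrace (ofCoords r s t x y z) = r + s + t := by
  simp [reTrace_apply, mat_ofCoords, Matrix.trace_fin_three, ip_one_one]

variable (K) in
/-- The identity matrix in `H₃(K)`. -/
noncomputable def H3.one : H3 K := ofCoords 1 1 1 0 0 0

theorem mat_one : mat K (H3.one K) = 1 := by
  rw [H3.one, mat_ofCoords]
  ext i j
  fin_cases i <;> fin_cases j <;> simp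

theorem jordanMul_one (X : H3 K) : jordanMul K X (H3.one K) = (2 : ℝ) • X :=
  mat_injective (by rw [mat_jordanMul, mat_one, map_smul, mul_one, one_mul, two_smul])

theorem reTrace_one : reTrace (H3.one K) = 3 := by
  rw [H3.one, reTrace_ofCoords]; norm_num

/-- The Cayley–Hamilton identity for traceless hermitian matrices. -/
theorem cayley_hamilton {X : H3 K} (hX : reTrace X = 0) :
    ∃ c : ℝ, jordanMul K X (jordanMul K X X) = (2 * hermIp X X) • X + c • H3.one K := by
  obtain ⟨r, s, t, x, y, z, rfl⟩ := exists_ofCoords X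
  rw [reTrace_ofCoords] at hX
  obtain rfl : t = -r - s := by linarith
  have hx := ip_conj_mul_rotate x y z
  have hy := ip_conj_mul_rotate y z x
  -- The constant is four times the determinant of X, with rst written through r² + s² + t² using t
  -- = -r - s. The factor four arises because the product X · X is 2X².
  refine ⟨4 * r ^ 3 - 2 * r * (r ^ 2 + s ^ 2 + (-r - s) ^ 2)
    - 4 * (r * ip K x x + s * ip K y y + (-r - s) * ip K z z) + 8 * ip K x (conj K (y * z)), ?_⟩
  simp only [hermIp_reTrace, jordanMul_ofCoords, H3.one, ofCoords_add, ofCoords_smul,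
    reTrace_ofCoords, ofCoords_inj]
  have e1 : ∀ u v : K, conj K (u * conj K (v * u)) = ip K u u • v := fun u v => by
    rw [conj_mul, conj_conj, mul_mul_conj_self]
  have e2 : ∀ u v : K, conj K (conj K (u * v) * u) = ip K u u • v := fun u v => by
    rw [conj_mul, conj_conj, conj_mul_mul_self]
  simp only [map_add, add_mul, mul_add, map_smul, smul_mul_assoc, mul_smul_comm, smul_add, e1, e2,
    smul_eq_mul, hx, hy]
  refine ⟨?_, ?_, ?_, ?_, ?_, ?_⟩
  · ring
  · ring
  · ring
  · module
  · module
  · module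

end JordanCoordinates

/-! ### Derivations of H₃(K): the splitting into A₃'(K) and Der K. -/

section JordanDerivations

variable {K : Type*} [NonAssocRing K] [Module ℝ K] [IsScalarTower ℝ K K] [SMulCommClass ℝ K K]
  [CompositionAlgebra K]

theorem exists_antihermitian (p q w a b c : K) (hp : ip K 1 p = 0) (hq : ip K 1 q = 0)
    (hw : ip K 1 w = 0) (h : p + q + w = 0) : ∃ A : antihermitianTraceless (conj K),
      A.1 = !![p, c, -conj K b; -conj K c, q, a; b, -conj K a, w] := by
  refine ⟨⟨_, ?_, ?_⟩, rfl⟩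
  · intro i j
    fin_cases i <;> fin_cases j <;> simp [conj_conj, conj_eq_neg hp, conj_eq_neg hq, conj_eq_neg hw]
  · rw [Matrix.trace_fin_three]
    exact h

theorem antihermitian_eq (A : antihermitianTraceless (conj K)) :
    A.1 = !![A.1 0 0, A.1 0 1, -conj K (A.1 2 0); -conj K (A.1 0 1), A.1 1 1, A.1 1 2;
      A.1 2 0, -conj K (A.1 1 2), A.1 2 2] := by
  ext i j
  fin_cases i <;> fin_cases j <;> simp [A.2.1]

theorem adOp_ofCoords {A : antihermitianTraceless (conj K)} {p q w a b c : K}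
    (hA : A.1 = !![p, c, -conj K b; -conj K c, q, a; b, -conj K a, w])
    (r s t : ℝ) (x y z : K) : adOp K A (ofCoords r s t x y z) =
      ofCoords (2 * (ip K c z - ip K b y)) (2 * (ip K a x - ip K c z)) (2 * (ip K b y - ip K a x))
        (q * x - x * w + (t - s) • a + conj K (b * z) - conj K (y * c))
        (w * y - y * p + (r - t) • b + conj K (c * x) - conj K (z * a))
        (p * z - z * q + (s - r) • c + conj K (a * y) - conj K (x * b)) := by
  have hx := mul_conj_add_mul_conj a x
  have hx' := conj_mul_add_conj_mul a x
  have hy := mul_conj_add_mul_conj b y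
  have hy' := conj_mul_add_conj_mul b y
  have hz := mul_conj_add_mul_conj c z
  have hz' := conj_mul_add_conj_mul c z
  refine H3.ext_coords ?_ ?_ ?_ ?_ ?_ ?_ <;>
    simp [mat_adOp, hA, mat_ofCoords, conj_mul]
  · linear_combination (norm := module) hz - hy'
  · linear_combination (norm := module) hx - hz'
  · linear_combination (norm := module) hy - hx'
  · module
  · module
  · module

theorem derOp_ofCoords (d : DerK K) (r s t : ℝ) (x y z : K) :
    derOp K d (ofCoords r s t x y z) = ofCoords 0 0 0 (d.1 x) (d.1 y) (d.1 z) := by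
  refine H3.ext_coords ?_ ?_ ?_ ?_ ?_ ?_ <;>
    simp [mat_derOp, mat_ofCoords, Der.map_one d.2]

/-- The decomposition of `Der H₃(K)` is direct. -/
theorem adOp_add_derOp_injective {A : antihermitianTraceless (conj K)} {d : DerK K}
    (h : adOp K A + derOp K d = 0) : A = 0 ∧ d = 0 := by
  have h' : ∀ r s t x y z, adOp K A (ofCoords r s t x y z) + derOp K d (ofCoords r s t x y z) =
      ofCoords 0 0 0 0 0 0 := fun r s t x y z => by
    rw [ofCoords_zero, ← LinearMap.add_apply, h, LinearMap.zero_apply]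
  simp only [adOp_ofCoords (antihermitian_eq A), derOp_ofCoords, ofCoords_add, ofCoords_inj] at h'
  -- On the diagonal idempotents the elementwise derivation vanishes, so the images exhibit the
  -- off-diagonal entries of A.
  have h1 := h' 1 0 0 0 0 0
  have h2 := h' 0 1 0 0 0 0
  simp at h1 h2
  obtain ⟨hb, hc⟩ := h1
  obtain ⟨ha, -⟩ := h2
  -- With all off-diagonal entries equal to 1, the images are the differences of the diagonal
  -- entries of A; these are thus equal, and zero because their sum is.
  have h3 := h' 0 0 0 1 1 1
  simp [ha, hb, hc, Der.map_one d.2] at h3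
  obtain ⟨e1, e2, e3⟩ := h3
  have htr := A.2.2
  rw [Matrix.trace_fin_three] at htr
  have h0 : A.1 0 0 = 0 := by
    linear_combination (norm := module) (1 / 3 : ℝ) • (htr + e3 - e2)
  have hA : A = 0 := by
    apply Subtype.ext
    rw [antihermitian_eq A]
    ext i j
    have h11 : A.1 1 1 = 0 := by rw [← sub_eq_zero.mp e3, h0]
    have h22 : A.1 2 2 = 0 := by rw [sub_eq_zero.mp e2, h0]
    fin_cases i <;> fin_cases j <;> simp [ha, hb, hc, h0, h11, h22]
  refine ⟨hA, Subtype.ext (LinearMap.ext fun x => ?_)⟩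
  have h4 := h' 0 0 0 x 0 0
  simpa [hA] using h4.2.2.2.1

theorem jordanMul_diag_zero (r s t : ℝ) (x y z : K) :
    jordanMul K (ofCoords 1 0 0 0 0 0) (ofCoords r s t x y z) = ofCoords (2 * r) 0 0 0 y z := by
  simp [jordanMul_ofCoords]

theorem jordanMul_diag_one (r s t : ℝ) (x y z : K) :
    jordanMul K (ofCoords 0 1 0 0 0 0) (ofCoords r s t x y z) = ofCoords 0 (2 * s) 0 x 0 z := by
  simp [jordanMul_ofCoords]

theorem jordanMul_diag_two (r s t : ℝ) (x y z : K) :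
    jordanMul K (ofCoords 0 0 1 0 0 0) (ofCoords r s t x y z) = ofCoords 0 0 (2 * t) x y 0 := by
  simp [jordanMul_ofCoords]

/-- A derivation that kills the diagonal matrices preserves the Peirce spaces. -/
theorem exists_triality_of_map_diag {D : Module.End ℝ (H3 K)} (hD : D ∈ DerH3 K)
    (h0 : D (ofCoords 1 0 0 0 0 0) = 0) (h1 : D (ofCoords 0 1 0 0 0 0) = 0)
    (h2 : D (ofCoords 0 0 1 0 0 0) = 0) : ∃ Tx Ty Tz : Module.End ℝ K,
      (∀ r s t x y z, D (ofCoords r s t x y z) = ofCoords 0 0 0 (Tx x) (Ty y) (Tz z)) ∧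
      (∀ x y, Tz (conj K (x * y)) = conj K (Tx x * y + x * Ty y)) ∧
      ip K 1 (Tx 1) = 0 ∧ ip K 1 (Ty 1) = 0 := by
  have hD' : ∀ X Y, D (jordanMul K X Y) = jordanMul K (D X) Y + jordanMul K X (D Y) := hD
  -- D commutes with multiplication by each diagonal idempotent, so it preserves their joint
  -- eigenspaces, the three off-diagonal entry spaces.
  have p0 : ∀ X, D (jordanMul K (ofCoords 1 0 0 0 0 0) X) =
      jordanMul K (ofCoords 1 0 0 0 0 0) (D X) :=
    fun X => by rw [hD', h0, map_zero, LinearMap.zero_apply, zero_add]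
  have p1 : ∀ X, D (jordanMul K (ofCoords 0 1 0 0 0 0) X) =
      jordanMul K (ofCoords 0 1 0 0 0 0) (D X) :=
    fun X => by rw [hD', h1, map_zero, LinearMap.zero_apply, zero_add]
  have p2 : ∀ X, D (jordanMul K (ofCoords 0 0 1 0 0 0) X) =
      jordanMul K (ofCoords 0 0 1 0 0 0) (D X) :=
    fun X => by rw [hD', h2, map_zero, LinearMap.zero_apply, zero_add]
  let entry : Fin 3 → Fin 3 → H3 K →ₗ[ℝ] K := fun i j =>
    (LinearMap.proj j ∘ₗ LinearMap.proj i) ∘ₗ (Matrix.ofLinearEquiv ℝ).symm.toLinearMap ∘ₗ mat K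
  let Fx : K →ₗ[ℝ] H3 K := ⟨⟨fun x => ofCoords 0 0 0 x 0 0, fun x y => by simp [ofCoords_add]⟩,
    fun c x => by simp [ofCoords_smul]⟩
  let Fy : K →ₗ[ℝ] H3 K := ⟨⟨fun x => ofCoords 0 0 0 0 x 0, fun x y => by simp [ofCoords_add]⟩,
    fun c x => by simp [ofCoords_smul]⟩
  let Fz : K →ₗ[ℝ] H3 K := ⟨⟨fun x => ofCoords 0 0 0 0 0 x, fun x y => by simp [ofCoords_add]⟩,
    fun c x => by simp [ofCoords_smul]⟩
  have hx : ∀ x, D (ofCoords 0 0 0 x 0 0) = ofCoords 0 0 0 (entry 1 2 (D (Fx x))) 0 0 :=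
      fun x => by
    have e1 := p1 (ofCoords 0 0 0 x 0 0)
    have e2 := p2 (ofCoords 0 0 0 x 0 0)
    change _ = ofCoords 0 0 0 (entry 1 2 (D (ofCoords 0 0 0 x 0 0))) 0 0
    obtain ⟨r, s, t, x', y, z, h⟩ := exists_ofCoords (D (ofCoords 0 0 0 x 0 0))
    simp only [jordanMul_diag_one, jordanMul_diag_two, mul_zero, h, ofCoords_inj] at e1 e2
    rw [h, ofCoords_inj]
    exact ⟨e1.1, e2.2.1, e1.2.2.1, rfl, e1.2.2.2.2.1, e2.2.2.2.2.2⟩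
  have hy : ∀ x, D (ofCoords 0 0 0 0 x 0) = ofCoords 0 0 0 0 (entry 2 0 (D (Fy x))) 0 :=
      fun x => by
    have e1 := p2 (ofCoords 0 0 0 0 x 0)
    have e2 := p0 (ofCoords 0 0 0 0 x 0)
    change _ = ofCoords 0 0 0 0 (entry 2 0 (D (ofCoords 0 0 0 0 x 0))) 0
    obtain ⟨r, s, t, x', y, z, h⟩ := exists_ofCoords (D (ofCoords 0 0 0 0 x 0))
    simp only [jordanMul_diag_zero, jordanMul_diag_two, mul_zero, h, ofCoords_inj] at e1 e2
    rw [h, ofCoords_inj]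
    exact ⟨e1.1, e1.2.1, e2.2.2.1, e2.2.2.2.1, rfl, e1.2.2.2.2.2⟩
  have hz : ∀ x, D (ofCoords 0 0 0 0 0 x) = ofCoords 0 0 0 0 0 (entry 0 1 (D (Fz x))) :=
      fun x => by
    have e1 := p0 (ofCoords 0 0 0 0 0 x)
    have e2 := p1 (ofCoords 0 0 0 0 0 x)
    change _ = ofCoords 0 0 0 0 0 (entry 0 1 (D (ofCoords 0 0 0 0 0 x)))
    obtain ⟨r, s, t, x', y, z, h⟩ := exists_ofCoords (D (ofCoords 0 0 0 0 0 x))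
    simp only [jordanMul_diag_zero, jordanMul_diag_one, mul_zero, h, ofCoords_inj] at e1 e2
    rw [h, ofCoords_inj]
    exact ⟨e2.1, e1.2.1, e1.2.2.1, e1.2.2.2.1, e2.2.2.2.2.1, rfl⟩
  have hd : ∀ r s t, D (ofCoords r s t 0 0 0) = 0 := fun r s t => by
    have e : ofCoords r s t 0 0 0 = r • ofCoords 1 0 0 0 0 0 + s • ofCoords 0 1 0 0 0 0 +
        t • ofCoords 0 0 1 0 0 (0 : K) := by
      simp [ofCoords_smul, ofCoords_add]
    rw [e, map_add, map_add, map_smul, map_smul, map_smul, h0, h1, h2]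
    simp
  refine ⟨entry 1 2 ∘ₗ D ∘ₗ Fx, entry 2 0 ∘ₗ D ∘ₗ Fy, entry 0 1 ∘ₗ D ∘ₗ Fz, ?_, ?_, ?_, ?_⟩
  · intro r s t x y z
    have e : ofCoords r s t x y z = ofCoords r s t 0 0 0 + ofCoords 0 0 0 x 0 0 +
        ofCoords 0 0 0 0 y 0 + ofCoords 0 0 0 0 0 z := by
      simp [ofCoords_add]
    rw [e, map_add, map_add, map_add, hd, hx, hy, hz]
    simp only [ofCoords_add, zero_add, add_zero]
    rfl
  · intro x y
    have e := hD' (ofCoords 0 0 0 x 0 0) (ofCoords 0 0 0 0 y 0)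
    simp only [hx, hy, jordanMul_ofCoords, mul_zero, map_zero, zero_mul, add_zero, zero_add,
      LinearMap.zero_apply, smul_zero, zero_smul, hz, ofCoords_add, ofCoords_inj] at e
    rw [map_add]
    exact e.2.2.2.2.2
  -- The square of this element is diagonal, hence killed by D; the diagonal of the Leibniz rule
  -- then gives ⟨1, Tx 1⟩ = 0.
  · have e := hD' (ofCoords 0 0 0 1 0 0) (ofCoords 0 0 0 1 0 0)
    simp only [hx, jordanMul_ofCoords, mul_zero, map_zero, zero_mul, add_zero, zero_add,
      smul_zero, zero_smul, hd, ← ofCoords_zero, ofCoords_add, ofCoords_inj] at e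
    have e1 := e.2.1
    rw [ip_comm _ 1] at e1
    change ip K 1 (entry 1 2 (D (Fx 1))) = 0
    linarith
  · have e := hD' (ofCoords 0 0 0 0 1 0) (ofCoords 0 0 0 0 1 0)
    simp only [hy, jordanMul_ofCoords, mul_zero, map_zero, zero_mul, add_zero, zero_add,
      smul_zero, zero_smul, hd, ← ofCoords_zero, ofCoords_add, ofCoords_inj] at e
    have e1 := e.1
    rw [ip_comm _ 1] at e1
    change ip K 1 (entry 2 0 (D (Fy 1))) = 0
    linarith

/-- Differentiating E_i · E_i = 2E_i leaves only the off-diagonal entries of D(E_i) in row and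
column i; differentiating E_i · E_j = 0 makes the shared entries of D(E_i) and D(E_j) opposite. The
images have exactly the shape [A, E_i]. -/
theorem exists_map_diag {D : Module.End ℝ (H3 K)} (hD : D ∈ DerH3 K) : ∃ a b c : K,
    D (ofCoords 1 0 0 0 0 0) = ofCoords 0 0 0 0 b (-c) ∧
    D (ofCoords 0 1 0 0 0 0) = ofCoords 0 0 0 (-a) 0 c ∧
    D (ofCoords 0 0 1 0 0 0) = ofCoords 0 0 0 a (-b) 0 := by
  have hD' : ∀ X Y, D (jordanMul K X Y) = jordanMul K (D X) Y + jordanMul K X (D Y) := hD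
  have e0 := hD' (ofCoords 1 0 0 0 0 0) (ofCoords 1 0 0 0 0 0)
  have e1 := hD' (ofCoords 0 1 0 0 0 0) (ofCoords 0 1 0 0 0 0)
  have e2 := hD' (ofCoords 0 0 1 0 0 0) (ofCoords 0 0 1 0 0 0)
  have e01 := hD' (ofCoords 1 0 0 0 0 0) (ofCoords 0 1 0 0 0 0)
  have e02 := hD' (ofCoords 1 0 0 0 0 0) (ofCoords 0 0 1 0 0 0)
  have e12 := hD' (ofCoords 0 1 0 0 0 0) (ofCoords 0 0 1 0 0 0)
  rw [jordanMul_comm (D _)] at e0 e1 e2 e01 e02 e12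
  have d0 : ofCoords (2 * 1) 0 0 0 0 (0 : K) = (2 : ℝ) • ofCoords 1 0 0 0 0 0 := by
    simp [ofCoords_smul]
  have d1 : ofCoords 0 (2 * 1) 0 0 0 (0 : K) = (2 : ℝ) • ofCoords 0 1 0 0 0 0 := by
    simp [ofCoords_smul]
  have d2 : ofCoords 0 0 (2 * 1) 0 0 (0 : K) = (2 : ℝ) • ofCoords 0 0 1 0 0 0 := by
    simp [ofCoords_smul]
  obtain ⟨r0, s0, t0, x0, y0, z0, h0⟩ := exists_ofCoords (D (ofCoords 1 0 0 0 0 0))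
  obtain ⟨r1, s1, t1, x1, y1, z1, h1⟩ := exists_ofCoords (D (ofCoords 0 1 0 0 0 0))
  obtain ⟨r2, s2, t2, x2, y2, z2, h2⟩ := exists_ofCoords (D (ofCoords 0 0 1 0 0 0))
  have hzero : ofCoords (2 * 0) 0 0 0 0 (0 : K) = 0 := by rw [mul_zero, ofCoords_zero]
  rw [jordanMul_diag_zero, d0, map_smul, h0, jordanMul_diag_zero, ofCoords_smul, ofCoords_add,
    ofCoords_inj] at e0
  rw [jordanMul_diag_one, d1, map_smul, h1, jordanMul_diag_one, ofCoords_smul, ofCoords_add,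
    ofCoords_inj] at e1
  rw [jordanMul_diag_two, d2, map_smul, h2, jordanMul_diag_two, ofCoords_smul, ofCoords_add,
    ofCoords_inj] at e2
  rw [jordanMul_diag_zero, hzero, map_zero, h0, h1, jordanMul_diag_one, jordanMul_diag_zero,
    ofCoords_add, ← ofCoords_zero, ofCoords_inj] at e01
  rw [jordanMul_diag_zero, hzero, map_zero, h0, h2, jordanMul_diag_two, jordanMul_diag_zero,
    ofCoords_add, ← ofCoords_zero, ofCoords_inj] at e02
  have hzero' : ofCoords 0 (2 * 0) 0 0 0 (0 : K) = 0 := by rw [mul_zero, ofCoords_zero]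
  rw [jordanMul_diag_one, hzero', map_zero, h1, h2, jordanMul_diag_two, jordanMul_diag_one,
    ofCoords_add, ← ofCoords_zero, ofCoords_inj] at e12
  have half : ∀ a : K, (2 : ℝ) • a = 0 + 0 → a = 0 := fun a h => by
    rw [add_zero] at h
    exact (smul_eq_zero.mp h).resolve_left two_ne_zero
  obtain ⟨e01r, e01s, e01t, e01x, e01y, e01z⟩ := e01
  obtain ⟨e02r, e02s, e02t, e02x, e02y, e02z⟩ := e02
  obtain ⟨e12r, e12s, e12t, e12x, e12y, e12z⟩ := e12
  obtain ⟨e0r, e0s, e0t, e0x, -, -⟩ := e0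
  obtain ⟨e1r, e1s, e1t, -, e1y, -⟩ := e1
  obtain ⟨e2r, e2s, e2t, -, -, e2z⟩ := e2
  refine ⟨x2, y0, z1, ?_, ?_, ?_⟩
  · rw [h0, ofCoords_inj]
    exact ⟨by linarith, by linarith, by linarith, half _ e0x, rfl, eq_neg_of_add_eq_zero_left e01z.symm⟩
  · rw [h1, ofCoords_inj]
    exact ⟨by linarith, by linarith, by linarith, eq_neg_of_add_eq_zero_left e12x.symm, half _ e1y, rfl⟩
  · rw [h2, ofCoords_inj]
    exact ⟨by linarith, by linarith, by linarith, rfl, eq_neg_of_add_eq_zero_right e02y.symm, half _ e2z⟩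

/-- Every derivation of `H₃(K)` is the sum of some `ad A` and an elementwise derivation. -/
theorem exists_adOp_add_derOp {D : Module.End ℝ (H3 K)} (hD : D ∈ DerH3 K) :
    ∃ (A : antihermitianTraceless (conj K)) (d : DerK K), adOp K A + derOp K d = D := by
  obtain ⟨a, b, c, h0, h1, h2⟩ := exists_map_diag hD
  -- This A has [A, E_i] = D(E_i), so D - ad A kills the diagonal.
  obtain ⟨A, hA⟩ := exists_antihermitian 0 0 0 a b c (map_zero _) (map_zero _) (map_zero _)
    (by simp)
  have hD1 : D - adOp K A ∈ DerH3 K := Submodule.sub_mem _ hD (adOp_mem_der A)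
  obtain ⟨Tx, Ty, Tz, hT, hTm, hx, hy⟩ := exists_triality_of_map_diag hD1
    (by rw [LinearMap.sub_apply, h0, adOp_ofCoords hA]; simp)
    (by rw [LinearMap.sub_apply, h1, adOp_ofCoords hA]; simp)
    (by rw [LinearMap.sub_apply, h2, adOp_ofCoords hA]; simp)
  set u := Tx 1 with hu
  set v := Ty 1 with hv
  -- The diagonal (p, q, w) of B is the traceless solution of q - w = u and w - p = v. Subtracting
  -- ad B therefore makes the first two maps of the triality triple kill 1.
  obtain ⟨B, hB⟩ := exists_antihermitian ((1 / 3 : ℝ) • (v - u) - v) ((1 / 3 : ℝ) • (v - u) + u)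
    ((1 / 3 : ℝ) • (v - u)) 0 0 0 (by simp [hx, hy]) (by simp [hx, hy]) (by simp [hx, hy])
    (by module)
  have hD2 : D - adOp K A - adOp K B ∈ DerH3 K := Submodule.sub_mem _ hD1 (adOp_mem_der B)
  obtain ⟨Sx, Sy, Sz, hS, hSm, -, -⟩ := exists_triality_of_map_diag hD2
    (by rw [LinearMap.sub_apply, hT, adOp_ofCoords hB]; simp)
    (by rw [LinearMap.sub_apply, hT, adOp_ofCoords hB]; simp)
    (by rw [LinearMap.sub_apply, hT, adOp_ofCoords hB]; simp)
  have h3 := hS 0 0 0 1 1 0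
  rw [LinearMap.sub_apply, hT, adOp_ofCoords hB, sub_eq_add_neg, ← neg_one_smul ℝ (ofCoords _ _ _ _ _ _),
    ofCoords_smul, ofCoords_add, ofCoords_inj] at h3
  have hSx : Sx 1 = 0 := by
    rw [← h3.2.2.2.1]; simp [hu]
  have hSy : Sy 1 = 0 := by
    rw [← h3.2.2.2.2.1]; simp [hv]
  -- Putting 1 for either factor in the triality relation identifies the three maps up to
  -- conjugation; the relation then becomes the Leibniz rule for Sx.
  have hxz : ∀ x, Sz (conj K x) = conj K (Sx x) := fun x => by
    simpa [hSy] using hSm x 1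
  have hyz : ∀ x, Sz (conj K x) = conj K (Sy x) := fun x => by
    simpa [hSx] using hSm 1 x
  have hinj : Function.Injective (conj K) := fun x y h => by
    rw [← conj_conj x, h, conj_conj]
  have hxy : ∀ x, Sy x = Sx x := fun x => hinj (by rw [← hxz, ← hyz])
  have hder : Sx ∈ DerK K := fun x y => hinj (by
    rw [LinearMap.mul_apply', ← hxz, hSm, hxy]; rfl)
  refine ⟨A + B, ⟨Sx, hder⟩, ?_⟩
  have hfin : derOp K ⟨Sx, hder⟩ = D - adOp K A - adOp K B := by
    refine LinearMap.ext fun X => ?_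
    obtain ⟨r, s, t, x, y, z, rfl⟩ := exists_ofCoords X
    rw [hS, derOp_ofCoords, hxy]
    congr 1
    rw [← conj_conj z, hxz, ← Der.map_conj hder]
  rw [hfin, map_add]
  abel

end JordanDerivations

/-! ### The traceless product A * B and the action of derivations on it. -/

section JordanTraceless

variable {K : Type*} [NonAssocRing K] [Module ℝ K] [IsScalarTower ℝ K K] [SMulCommClass ℝ K K]
  [CompositionAlgebra K]

/-- By the explicit description of derivations it suffices to treat commutators, where Re(xy) =
Re(yx), and elementwise derivations, whose values are imaginary. -/
theorem reTrace_derivation {D : Module.End ℝ (H3 K)} (hD : D ∈ DerH3 K) (X : H3 K) :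
    reTrace (D X) = 0 := by
  obtain ⟨A, d, rfl⟩ := exists_adOp_add_derOp hD
  rw [LinearMap.add_apply, map_add, reTrace_adOp, reTrace_derOp, add_zero]

theorem derivation_one {D : Module.End ℝ (H3 K)} (hD : D ∈ DerH3 K) : D (H3.one K) = 0 := by
  have h := hD (H3.one K) (H3.one K)
  rw [jordanMul_comm (D _), jordanMul_one, jordanMul_comm, jordanMul_one, map_smul] at h
  linear_combination (norm := module) -(1 / 2 : ℝ) • h

theorem hermIp_derivation {D : Module.End ℝ (H3 K)} (hD : D ∈ DerH3 K) (X Y : H3 K) :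
    hermIp (D X) Y + hermIp X (D Y) = 0 := by
  have h := reTrace_derivation hD (jordanMul K X Y)
  rw [hD X Y, map_add] at h
  rw [hermIp_reTrace, hermIp_reTrace]
  linarith

variable (K) in
/-- The inner product of `H₃(K)` as a bilinear form. -/
noncomputable def hermForm : H3 K →ₗ[ℝ] H3 K →ₗ[ℝ] ℝ :=
  (1 / 2 : ℝ) • (jordanMul K).compr₂ reTrace

theorem hermForm_apply (X Y : H3 K) : hermForm K X Y = hermIp X Y := rfl

theorem coe_starMul (A B : H3Traceless K) : (starMul A B : H3 K) =
    jordanMul K A B - (2 / 3 * hermIp A.1 B.1) • H3.one K := by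
  refine mat_injective ?_
  change tracelessPart (mat K (jordanMul K A B)) = _
  rw [map_sub, map_smul, mat_one, tracelessPart, trace_eq_reTrace, hermIp_reTrace]
  congr 1
  ext i j
  rw [Matrix.smul_apply]
  by_cases h : i = j
  · subst h
    rw [Matrix.diagonal_apply_eq, Matrix.one_apply_eq]
    module
  · rw [Matrix.diagonal_apply_ne _ h, Matrix.one_apply_ne h, smul_zero]

variable (K) in
/-- The product `A * B` as a bilinear map. -/
noncomputable def starForm : H3Traceless K →ₗ[ℝ] H3Traceless K →ₗ[ℝ] H3Traceless K :=
  LinearMap.mk₂ ℝ starMul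
    (fun A A' B => Subtype.ext <| by
      simp only [coe_starMul, Submodule.coe_add, ← hermForm_apply, map_add, LinearMap.add_apply]
      module)
    (fun c A B => Subtype.ext <| by
      simp only [coe_starMul, Submodule.coe_smul, ← hermForm_apply, map_smul,
        LinearMap.smul_apply, smul_eq_mul]
      module)
    (fun A B B' => Subtype.ext <| by
      simp only [coe_starMul, Submodule.coe_add, ← hermForm_apply, map_add]
      module)
    (fun c A B => Subtype.ext <| by
      simp only [coe_starMul, Submodule.coe_smul, ← hermForm_apply, map_smul, smul_eq_mul]
      module)

theorem coe_starForm (A B : H3Traceless K) : (starForm K A B : H3 K) =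
    jordanMul K A B - (2 / 3 * hermForm K A.1 B.1) • H3.one K := coe_starMul A B

theorem starForm_comm (A B : H3Traceless K) : starForm K A B = starForm K B A :=
  Subtype.ext (by rw [coe_starForm, coe_starForm, jordanMul_comm, hermForm_apply, hermIp_comm,
    ← hermForm_apply])

theorem hermForm_comm (X Y : H3 K) : hermForm K X Y = hermForm K Y X := hermIp_comm X Y

theorem hermForm_one {X : H3 K} (hX : X ∈ H3Traceless K) : hermForm K X (H3.one K) = 0 := by
  rw [hermForm_apply, hermIp_reTrace, jordanMul_one, map_smul, mem_H3Traceless.mp hX]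
  simp

theorem hermForm_starForm (A B C : H3Traceless K) :
    hermForm K (starForm K A B) C = hermForm K A (starForm K B C) := by
  rw [coe_starForm, coe_starForm, map_sub, map_sub, LinearMap.sub_apply, map_smul, map_smul,
    LinearMap.smul_apply, hermForm_comm (H3.one K), hermForm_one A.2, hermForm_one C.2]
  simp only [hermForm_apply, hermIp_jordanMul, smul_zero]

/-- Substitute B · C = B * C + ⅔⟨B, C⟩1, and use that 1 acts as multiplication by 2. -/
theorem jordanMul_starForm (A B C : H3Traceless K) : jordanMul K A (jordanMul K B C) =
    starForm K A (starForm K B C) + (4 / 3 * hermForm K B.1 C.1) • (A : H3 K)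
      + (2 / 3 * hermForm K A.1 (starForm K B C)) • H3.one K := by
  rw [coe_starForm A, coe_starForm B, map_sub (jordanMul K A), map_smul (jordanMul K A),
    jordanMul_one]
  module

theorem cayley_hamilton_linearised {A B C : H3 K} (hA : reTrace A = 0) (hB : reTrace B = 0)
    (hC : reTrace C = 0) : ∃ c : ℝ, jordanMul K A (jordanMul K B C)
      + jordanMul K B (jordanMul K C A) + jordanMul K C (jordanMul K A B) =
      (2 : ℝ) • (hermForm K B C • A + hermForm K C A • B + hermForm K A B • C)
        + c • H3.one K := by
  obtain ⟨c1, h1⟩ := cayley_hamilton hA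
  obtain ⟨c2, h2⟩ := cayley_hamilton hB
  obtain ⟨c3, h3⟩ := cayley_hamilton hC
  obtain ⟨c12, h12⟩ := cayley_hamilton (X := A + B) (by rw [map_add, hA, hB, add_zero])
  obtain ⟨c13, h13⟩ := cayley_hamilton (X := A + C) (by rw [map_add, hA, hC, add_zero])
  obtain ⟨c23, h23⟩ := cayley_hamilton (X := B + C) (by rw [map_add, hB, hC, add_zero])
  obtain ⟨c123, h123⟩ := cayley_hamilton (X := A + B + C)
    (by rw [map_add, map_add, hA, hB, hC, add_zero, add_zero])
  -- Inclusion–exclusion over the seven partial sums polarises the cubic identity. Full polarisation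
  -- counts each A · (B · C) twice, whence the half.
  refine ⟨(1 / 2) * (c123 - c12 - c13 - c23 + c1 + c2 + c3), ?_⟩
  simp only [← hermForm_apply, map_add, LinearMap.add_apply, jordanMul_comm B A,
    jordanMul_comm C A, jordanMul_comm C B, hermForm_comm B A, hermForm_comm C A,
    hermForm_comm C B] at *
  linear_combination (norm := module) (1 / 2 : ℝ) • (h123 - h12 - h13 - h23 + h1 + h2 + h3)

/-- The linearised Cayley–Hamilton identity for the product `A * B`. -/
theorem starForm_cyclic (A B C : H3Traceless K) : starForm K A (starForm K B C)
      + starForm K B (starForm K C A) + starForm K C (starForm K A B) =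
      (2 / 3 : ℝ) • (hermForm K B.1 C.1 • A + hermForm K C.1 A.1 • B + hermForm K A.1 B.1 • C) := by
  obtain ⟨c, hc⟩ := cayley_hamilton_linearised (mem_H3Traceless.mp A.2) (mem_H3Traceless.mp B.2)
    (mem_H3Traceless.mp C.2)
  rw [jordanMul_starForm, jordanMul_starForm, jordanMul_starForm] at hc
  set P := starForm K A (starForm K B C) + starForm K B (starForm K C A)
    + starForm K C (starForm K A B) with hP
  set Q := (2 / 3 : ℝ) • (hermForm K B.1 C.1 • A + hermForm K C.1 A.1 • B
    + hermForm K A.1 B.1 • C) with hQ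
  -- Modulo multiples of the identity the claim is the linearised Cayley–Hamilton identity, with ⅔ =
  -- 2 - 4/3. Both sides being traceless, the multiple is zero.
  obtain ⟨c', h⟩ : ∃ c' : ℝ, ((P - Q : H3Traceless K) : H3 K) = c' • H3.one K := by
    refine ⟨c - 2 / 3 * hermForm K A.1 (starForm K B C) - 2 / 3 * hermForm K B.1 (starForm K C A)
      - 2 / 3 * hermForm K C.1 (starForm K A B), ?_⟩
    simp only [hP, hQ, Submodule.coe_sub, Submodule.coe_add, Submodule.coe_smul]
    linear_combination (norm := module) hc
  have h2 := congrArg reTrace h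
  rw [mem_H3Traceless.mp (P - Q).2, map_smul, reTrace_one, smul_eq_mul] at h2
  have h3 : c' = 0 := by linarith
  rw [h3, zero_smul] at h
  exact sub_eq_zero.mp (Subtype.ext h)

/-- The commutator `[L_X, L_Y]` as a bilinear map to `Der H₃(K)`. -/
noncomputable def jordanInnerDer : H3Traceless K →ₗ[ℝ] H3Traceless K →ₗ[ℝ] DerH3 K :=
  LinearMap.mk₂ ℝ (fun A B => ⟨endComm (H3 K) (jordanMul K A) (jordanMul K B),
      endComm_jordanMul_mem_der _ _⟩)
    (fun A A' B => Subtype.ext <| by simp only [Submodule.coe_add, map_add, LinearMap.add_apply])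
    (fun c A B => Subtype.ext <| by
      simp only [Submodule.coe_smul, map_smul, LinearMap.smul_apply])
    (fun A B B' => Subtype.ext <| by simp only [Submodule.coe_add, map_add])
    (fun c A B => Subtype.ext <| by simp only [Submodule.coe_smul, map_smul])

theorem coe_jordanInnerDer (A B : H3Traceless K) : (jordanInnerDer A B).1 =
    endComm (H3 K) (jordanMul K A) (jordanMul K B) := rfl

variable (K) in
/-- The action of `Der H₃(K)` on traceless matrices. -/
noncomputable def derTraceless : DerH3 K →ₗ[ℝ] Module.End ℝ (H3Traceless K) :=
  LinearMap.mk₂ ℝ (fun D A => ⟨D.1 A, mem_H3Traceless.mpr (reTrace_derivation D.2 _)⟩)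
    (fun _ _ _ => rfl) (fun _ _ _ => rfl)
    (fun D _ _ => Subtype.ext <| map_add D.1 _ _) (fun _ D _ => Subtype.ext <| map_smul D.1 _ _)

theorem coe_derTraceless (D : DerH3 K) (A : H3Traceless K) :
    (derTraceless K D A : H3 K) = D.1 A := rfl

/-- Expand A · (B · C) - B · (A · C) by `jordanMul_starForm`; the multiples of the identity cancel
by associativity of the form. -/
theorem derTraceless_jordanInnerDer (A B C : H3Traceless K) :
    derTraceless K (jordanInnerDer A B) C = starForm K A (starForm K B C)
      - starForm K B (starForm K C A) + (4 / 3 * hermForm K B.1 C.1) • A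
      - (4 / 3 * hermForm K C.1 A.1) • B := by
  apply Subtype.ext
  rw [coe_derTraceless, coe_jordanInnerDer, endComm_apply, jordanMul_starForm,
    jordanMul_starForm, starForm_comm A C, hermForm_comm A.1 C.1, ← hermForm_starForm B C A,
    hermForm_comm A.1 (starForm K B C).1]
  simp only [Submodule.coe_sub, Submodule.coe_add, Submodule.coe_smul]
  module

theorem derTraceless_starForm (D : DerH3 K) (A B : H3Traceless K) :
    derTraceless K D (starForm K A B) =
      starForm K (derTraceless K D A) B + starForm K A (derTraceless K D B) := by
  apply Subtype.ext
  have h1 := hermIp_derivation D.2 A B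
  have h2 : D.1 (jordanMul K A B) = _ := D.2 A B
  simp only [Submodule.coe_add, coe_derTraceless, coe_starForm, map_sub, map_smul,
    derivation_one D.2, h2, hermForm_apply]
  rw [eq_neg_of_add_eq_zero_left h1]
  module

theorem derComm_jordanInnerDer (D : DerH3 K) (A B : H3Traceless K) :
    derComm D (jordanInnerDer A B) =
      jordanInnerDer (derTraceless K D A) B + jordanInnerDer A (derTraceless K D B) := by
  apply Subtype.ext
  have h2 : ∀ X Y, D.1 (jordanMul K X Y) = jordanMul K (D.1 X) Y + jordanMul K X (D.1 Y) := D.2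
  refine LinearMap.ext fun X => ?_
  simp only [Submodule.coe_add, derComm, LinearMap.add_apply, coe_jordanInnerDer, endComm_apply,
    coe_derTraceless, map_sub, h2, map_add]
  abel

end JordanTraceless

/-! ### The imaginary part K' with half-commutator, inner derivations and associator. -/

section Imaginary

variable {K : Type*} [NonAssocRing K] [Module ℝ K] [IsScalarTower ℝ K K] [SMulCommClass ℝ K K]
  [CompositionAlgebra K]

theorem mem_Im {x : K} : x ∈ Im K ↔ ip K 1 x = 0 := Iff.rfl

theorem commutator_mem_Im (x y : K) : x * y - y * x ∈ Im K := by
  rw [mem_Im, map_sub, ip_one_mul_comm, sub_self]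

variable (K) in
/-- Half of the commutator of imaginary elements. -/
noncomputable def imComm : Im K →ₗ[ℝ] Im K →ₗ[ℝ] Im K :=
  LinearMap.mk₂ ℝ (fun a b => (1 / 2 : ℝ) • ⟨(a * b - b * a : K), commutator_mem_Im _ _⟩)
    (fun a a' b => Subtype.ext <| by
      simp only [Submodule.coe_add, Submodule.coe_smul, add_mul, mul_add]; module)
    (fun c a b => Subtype.ext <| by
      simp only [Submodule.coe_smul, smul_mul_assoc, mul_smul_comm]; module)
    (fun a b b' => Subtype.ext <| by
      simp only [Submodule.coe_add, Submodule.coe_smul, add_mul, mul_add]; module)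
    (fun c a b => Subtype.ext <| by
      simp only [Submodule.coe_smul, smul_mul_assoc, mul_smul_comm]; module)

theorem coe_imComm (a b : Im K) : (imComm K a b : K) = (1 / 2 : ℝ) • (a * b - b * a : K) := rfl

theorem imComm_swap (a b : Im K) : imComm K a b = -imComm K b a :=
  Subtype.ext (by rw [Submodule.coe_neg, coe_imComm, coe_imComm]; module)

variable (K) in
/-- `D_{a,b}` for imaginary `a, b`, as a bilinear map to `Der K`. -/
noncomputable def imInnerDer : Im K →ₗ[ℝ] Im K →ₗ[ℝ] DerK K :=
  LinearMap.mk₂ ℝ (fun a b => ⟨innerDer K a b, innerDer_mem_der _ _⟩)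
    (fun a a' b => Subtype.ext <| by simp only [Submodule.coe_add, map_add, LinearMap.add_apply])
    (fun c a b => Subtype.ext <| by
      simp only [Submodule.coe_smul, map_smul, LinearMap.smul_apply])
    (fun a b b' => Subtype.ext <| by simp only [Submodule.coe_add, map_add])
    (fun c a b => Subtype.ext <| by simp only [Submodule.coe_smul, map_smul])

theorem coe_imInnerDer (a b : Im K) : (imInnerDer K a b).1 = innerDer K a b := rfl

theorem imInnerDer_swap (a b : Im K) : imInnerDer K a b = -imInnerDer K b a :=
  Subtype.ext (innerDer_swap _ _)

variable (K) in
/-- The action of `Der K` on imaginary elements. -/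
noncomputable def derIm : DerK K →ₗ[ℝ] Module.End ℝ (Im K) :=
  LinearMap.mk₂ ℝ (fun D a => ⟨D.1 a, Der.ip_one D.2 _⟩)
    (fun _ _ _ => rfl) (fun _ _ _ => rfl)
    (fun D _ _ => Subtype.ext <| map_add D.1 _ _) (fun _ D _ => Subtype.ext <| map_smul D.1 _ _)

theorem coe_derIm (D : DerK K) (a : Im K) : (derIm K D a : K) = D.1 a := rfl

theorem derIm_imComm (D : DerK K) (a b : Im K) :
    derIm K D (imComm K a b) = imComm K (derIm K D a) b + imComm K a (derIm K D b) := by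
  apply Subtype.ext
  simp only [Submodule.coe_add, coe_derIm, coe_imComm, map_smul, map_sub, Der.map_mul D.2]
  module

theorem derComm_imInnerDer (D : DerK K) (a b : Im K) : derComm D (imInnerDer K a b) =
    imInnerDer K (derIm K D a) b + imInnerDer K a (derIm K D b) :=
  Subtype.ext (endComm_innerDer D.2 _ _)

theorem associator_mem_Im (a b c : Im K) : associator (a : K) b c ∈ Im K := by
  have h := congrArg (ip K 1) (mul_sub_mul_imaginary a.2 b.2 c.2)
  rw [mem_Im.mp (commutator_mem_Im _ _)] at h
  rw [mem_Im]
  simpa [mem_Im.mp b.2, mem_Im.mp c.2] using h.symm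

/-- The associator of imaginary elements. -/
def imAssociator (a b c : Im K) : Im K := ⟨associator (a : K) b c, associator_mem_Im a b c⟩

theorem imAssociator_rotate (a b c : Im K) : imAssociator a b c = imAssociator b c a :=
  Subtype.ext (associator_rotate _ _ _)

theorem imComm_imComm (a b c : Im K) : imComm K a (imComm K b c) =
    (ip K a.1 c.1) • b - (ip K a.1 b.1) • c - (1 / 2 : ℝ) • imAssociator a b c := by
  apply Subtype.ext
  have h := commutator_commutator_imaginary a.2 b.2 c.2
  simp only [coe_imComm, Submodule.coe_sub, Submodule.coe_smul, imAssociator, mul_smul_comm,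
    smul_mul_assoc]
  linear_combination (norm := module) -(1 / 4 : ℝ) • h

theorem derIm_imInnerDer (a b c : Im K) : derIm K (imInnerDer K b c) a =
    (4 * ip K a.1 b.1) • c - (4 * ip K a.1 c.1) • b - imAssociator a b c :=
  Subtype.ext (innerDer_apply_imaginary a.2 b.2 c.2)

/-- Sum over cyclic permutations of `D_{[a,b],c}` vanishes. -/
theorem imInnerDer_cyclic (a b c : Im K) : imInnerDer K a (imComm K b c)
    + imInnerDer K b (imComm K c a) + imInnerDer K c (imComm K a b) = 0 := by
  apply Subtype.ext
  have h1 := innerDer_mul_cyclic a.1 b.1 c.1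
  have h2 := innerDer_mul_cyclic b.1 a.1 c.1
  simp only [Submodule.coe_add, coe_imInnerDer, coe_imComm, map_smul, map_sub,
    innerDer_swap (a : K) (_ * _), innerDer_swap (b : K) (_ * _), innerDer_swap (c : K) (_ * _)]
  rw [Submodule.coe_zero]
  linear_combination (norm := module) (1 / 2 : ℝ) • (h2 - h1)

/-- Left and right multiplications by an imaginary element are skew. -/
theorem ip_imComm_cyclic (a b c : Im K) :
    ip K a.1 (imComm K b c).1 = ip K b.1 (imComm K c a).1 := by
  have h2 := ip_mul_right_adj b.1 c.1 a.1
  have h3 := ip_mul_left_adj c.1 b.1 a.1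
  rw [conj_eq_neg c.2] at h2 h3
  rw [mul_neg, map_neg] at h2
  rw [neg_mul, map_neg] at h3
  simp only [coe_imComm, map_smul, map_sub, smul_eq_mul]
  rw [ip_comm a.1, ip_comm a.1 (c.1 * b.1), h2, h3]
  ring

theorem ip_derIm (D : DerK K) (a b : Im K) :
    ip K (derIm K D a).1 b.1 + ip K a.1 (derIm K D b).1 = 0 := Der.ip_skew D.2 _ _

end Imaginary

/-! ### Checking additive identities on pure tensors. -/

section TensorInduction

variable {M N P : Type*} [AddCommGroup M] [Module ℝ M] [AddCommGroup N] [Module ℝ N]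
  [AddCommGroup P]

/-- Only additivity is asked of F, so that differences of composite expressions need not be packaged
as linear maps. -/
theorem eq_zero_of_tmul {F : M ⊗[ℝ] N → P} (hF : ∀ x y, F (x + y) = F x + F y)
    (h : ∀ a m, F (a ⊗ₜ m) = 0) (x : M ⊗[ℝ] N) : F x = 0 := by
  induction x using TensorProduct.induction_on with
  | zero => simpa using hF 0 0
  | tmul a m => exact h a m
  | add x y hx hy => rw [hF, hx, hy, add_zero]

theorem eq_zero_of_tmul₂ {F : M ⊗[ℝ] N → M ⊗[ℝ] N → P}
    (h₁ : ∀ x x' y, F (x + x') y = F x y + F x' y)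
    (h₂ : ∀ x y y', F x (y + y') = F x y + F x y')
    (h : ∀ a m b n, F (a ⊗ₜ m) (b ⊗ₜ n) = 0) (x y : M ⊗[ℝ] N) : F x y = 0 :=
  eq_zero_of_tmul (F := fun x => F x y) (fun x x' => h₁ x x' y)
    (fun a m => eq_zero_of_tmul (h₂ (a ⊗ₜ m)) (h a m) y) x

theorem eq_zero_of_tmul₃ {F : M ⊗[ℝ] N → M ⊗[ℝ] N → M ⊗[ℝ] N → P}
    (h₁ : ∀ x x' y z, F (x + x') y z = F x y z + F x' y z)
    (h₂ : ∀ x y y' z, F x (y + y') z = F x y z + F x y' z)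
    (h₃ : ∀ x y z z', F x y (z + z') = F x y z + F x y z')
    (h : ∀ a m b n c k, F (a ⊗ₜ m) (b ⊗ₜ n) (c ⊗ₜ k) = 0) (x y z : M ⊗[ℝ] N) : F x y z = 0 :=
  eq_zero_of_tmul (F := fun x => F x y z) (fun x x' => h₁ x x' y z)
    (fun a m => eq_zero_of_tmul₂ (h₂ (a ⊗ₜ m)) (h₃ (a ⊗ₜ m)) (h a m) y z) x

end TensorInduction

/-! ### A criterion for a Lie bracket on G₁ ∔ G₂ ∔ W. -/

section Extension

variable {G₁ G₂ W : Type*} [AddCommGroup G₁] [Module ℝ G₁] [AddCommGroup G₂] [Module ℝ G₂]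
  [AddCommGroup W] [Module ℝ W]

/-- The bracket on `G₁ ∔ G₂ ∔ W` given by brackets on `G₁` and `G₂`, actions of `G₁` and `G₂` on
`W`, and alternating maps from `W × W` to the three summands. -/
noncomputable def extBracket (β₁ : G₁ →ₗ[ℝ] G₁ →ₗ[ℝ] G₁) (β₂ : G₂ →ₗ[ℝ] G₂ →ₗ[ℝ] G₂)
    (ρ₁ : G₁ →ₗ[ℝ] Module.End ℝ W) (ρ₂ : G₂ →ₗ[ℝ] Module.End ℝ W)
    (κ₁ : W →ₗ[ℝ] W →ₗ[ℝ] G₁) (κ₂ : W →ₗ[ℝ] W →ₗ[ℝ] G₂) (μ : W →ₗ[ℝ] W →ₗ[ℝ] W) :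
    (G₁ × G₂ × W) →ₗ[ℝ] (G₁ × G₂ × W) →ₗ[ℝ] (G₁ × G₂ × W) :=
  LinearMap.mk₂ ℝ (fun x y => (β₁ x.1 y.1 + κ₁ x.2.2 y.2.2, β₂ x.2.1 y.2.1 + κ₂ x.2.2 y.2.2,
      ρ₁ x.1 y.2.2 + ρ₂ x.2.1 y.2.2 - ρ₁ y.1 x.2.2 - ρ₂ y.2.1 x.2.2 + μ x.2.2 y.2.2))
    (fun x x' y => by
      simp only [Prod.fst_add, Prod.snd_add, map_add, LinearMap.add_apply, Prod.mk_add_mk]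
      refine Prod.ext ?_ (Prod.ext ?_ ?_) <;> dsimp only <;> abel)
    (fun c x y => by
      simp only [Prod.smul_fst, Prod.smul_snd, map_smul, LinearMap.smul_apply, Prod.smul_mk,
        smul_add, smul_sub])
    (fun x y y' => by
      simp only [Prod.fst_add, Prod.snd_add, map_add, LinearMap.add_apply, Prod.mk_add_mk]
      refine Prod.ext ?_ (Prod.ext ?_ ?_) <;> dsimp only <;> abel)
    (fun c x y => by
      simp only [Prod.smul_fst, Prod.smul_snd, map_smul, LinearMap.smul_apply, Prod.smul_mk,
        smul_add, smul_sub])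

variable {β₁ : G₁ →ₗ[ℝ] G₁ →ₗ[ℝ] G₁} {β₂ : G₂ →ₗ[ℝ] G₂ →ₗ[ℝ] G₂}
    {ρ₁ : G₁ →ₗ[ℝ] Module.End ℝ W} {ρ₂ : G₂ →ₗ[ℝ] Module.End ℝ W}
    {κ₁ : W →ₗ[ℝ] W →ₗ[ℝ] G₁} {κ₂ : W →ₗ[ℝ] W →ₗ[ℝ] G₂} {μ : W →ₗ[ℝ] W →ₗ[ℝ] W}

theorem extBracket_apply (x y : G₁ × G₂ × W) : extBracket β₁ β₂ ρ₁ ρ₂ κ₁ κ₂ μ x y =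
    (β₁ x.1 y.1 + κ₁ x.2.2 y.2.2, β₂ x.2.1 y.2.1 + κ₂ x.2.2 y.2.2,
      ρ₁ x.1 y.2.2 + ρ₂ x.2.1 y.2.2 - ρ₁ y.1 x.2.2 - ρ₂ y.2.1 x.2.2 + μ x.2.2 y.2.2) := rfl

theorem alternating_of_skew {V : Type*} [AddCommGroup V] [Module ℝ V] {f : W →ₗ[ℝ] W →ₗ[ℝ] V}
    (h : ∀ v w, f v w = -f w v) (w : W) : f w w = 0 := by
  linear_combination (norm := module) (1 / 2 : ℝ) • h w w

/-- Jacobi splits by the number of arguments in W. None: the brackets on G₁ and G₂. One: commuting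
representations. Two: equivariance of κ₁, κ₂ and μ, where each form is invariant under the other
algebra. Three: the cyclic conditions j₁, j₂, j₃, one for each summand. -/
theorem isLieBracket_extBracket (hβ₁ : IsLieBracket β₁) (hβ₂ : IsLieBracket β₂)
    (hρ₁ : ∀ a b w, ρ₁ (β₁ a b) w = ρ₁ a (ρ₁ b w) - ρ₁ b (ρ₁ a w))
    (hρ₂ : ∀ a b w, ρ₂ (β₂ a b) w = ρ₂ a (ρ₂ b w) - ρ₂ b (ρ₂ a w))
    (hρ : ∀ a b w, ρ₁ a (ρ₂ b w) = ρ₂ b (ρ₁ a w))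
    (hκ₁ : ∀ v w, κ₁ v w = -κ₁ w v) (hκ₂ : ∀ v w, κ₂ v w = -κ₂ w v)
    (hμ : ∀ v w, μ v w = -μ w v)
    (h₁₁ : ∀ a v w, β₁ a (κ₁ v w) = κ₁ (ρ₁ a v) w + κ₁ v (ρ₁ a w))
    (h₁₂ : ∀ a v w, κ₂ (ρ₁ a v) w + κ₂ v (ρ₁ a w) = 0)
    (h₁₃ : ∀ a v w, ρ₁ a (μ v w) = μ (ρ₁ a v) w + μ v (ρ₁ a w))
    (h₂₁ : ∀ a v w, κ₁ (ρ₂ a v) w + κ₁ v (ρ₂ a w) = 0)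
    (h₂₂ : ∀ a v w, β₂ a (κ₂ v w) = κ₂ (ρ₂ a v) w + κ₂ v (ρ₂ a w))
    (h₂₃ : ∀ a v w, ρ₂ a (μ v w) = μ (ρ₂ a v) w + μ v (ρ₂ a w))
    (j₁ : ∀ u v w, κ₁ u (μ v w) + κ₁ v (μ w u) + κ₁ w (μ u v) = 0)
    (j₂ : ∀ u v w, κ₂ u (μ v w) + κ₂ v (μ w u) + κ₂ w (μ u v) = 0)
    (j₃ : ∀ u v w, μ u (μ v w) + μ v (μ w u) + μ w (μ u v) -
      (ρ₁ (κ₁ v w) u + ρ₁ (κ₁ w u) v + ρ₁ (κ₁ u v) w) -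
      (ρ₂ (κ₂ v w) u + ρ₂ (κ₂ w u) v + ρ₂ (κ₂ u v) w) = 0) :
    IsLieBracket (extBracket β₁ β₂ ρ₁ ρ₂ κ₁ κ₂ μ) where
  alternating x := by
    rw [extBracket_apply, hβ₁.alternating, hβ₂.alternating, alternating_of_skew hκ₁,
      alternating_of_skew hκ₂, alternating_of_skew hμ]
    ext <;> simp
  jacobi := by
    rintro ⟨a, a', u⟩ ⟨b, b', v⟩ ⟨c, c', w⟩
    have J₁ := hβ₁.jacobi a b c
    have J₂ := hβ₂.jacobi a' b' c'
    simp only [extBracket_apply, Prod.mk_add_mk, map_add, map_sub, LinearMap.add_apply,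
      h₁₁, h₂₂, h₁₃, h₂₃, hρ₁, hρ₂]
    refine Prod.ext ?_ (Prod.ext ?_ ?_)
    · simp only [Prod.fst_zero]
      linear_combination (norm := abel) J₁ + j₁ u v w + hκ₁ (ρ₁ a v) w + hκ₁ (ρ₁ b w) u
        + hκ₁ (ρ₁ c u) v - h₂₁ a' v w - h₂₁ b' w u - h₂₁ c' u v + hκ₁ w (ρ₂ a' v)
        + hκ₁ u (ρ₂ b' w) + hκ₁ v (ρ₂ c' u)
    · simp only [Prod.snd_zero, Prod.fst_zero]
      linear_combination (norm := abel) J₂ + j₂ u v w + hκ₂ (ρ₂ a' v) w + hκ₂ (ρ₂ b' w) u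
        + hκ₂ (ρ₂ c' u) v - h₁₂ a v w - h₁₂ b w u - h₁₂ c u v + hκ₂ w (ρ₁ a v)
        + hκ₂ u (ρ₁ b w) + hκ₂ v (ρ₁ c u)
    · simp only [Prod.snd_zero]
      linear_combination (norm := abel) j₃ u v w + hμ (ρ₁ a v) w + hμ (ρ₁ b w) u
        + hμ (ρ₁ c u) v + hμ (ρ₂ a' v) w + hμ (ρ₂ b' w) u + hμ (ρ₂ c' u) v
        + hρ a b' w - hρ a c' v + hρ b c' u - hρ b a' w + hρ c a' v - hρ c b' u

end Extension

/-! ### Tits's bracket and its Jacobi identity. -/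

section TitsConstruction

variable (K₁ K₂ : Type*)
  [NonAssocRing K₁] [Module ℝ K₁] [IsScalarTower ℝ K₁ K₁] [SMulCommClass ℝ K₁ K₁]
  [CompositionAlgebra K₁]
  [NonAssocRing K₂] [Module ℝ K₂] [IsScalarTower ℝ K₂ K₂] [SMulCommClass ℝ K₂ K₂]
  [CompositionAlgebra K₂]

/-- The commutator of derivations as a bilinear map. -/
noncomputable def derBracket {A : Type*} [AddCommGroup A] [Module ℝ A] (m : A →ₗ[ℝ] A →ₗ[ℝ] A) :
    Der m →ₗ[ℝ] Der m →ₗ[ℝ] Der m :=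
  LinearMap.mk₂ ℝ derComm
    (fun D D' E => Subtype.ext <| by
      simp only [derComm, Submodule.coe_add, map_add, LinearMap.add_apply])
    (fun c D E => Subtype.ext <| by
      simp only [derComm, Submodule.coe_smul, map_smul, LinearMap.smul_apply])
    (fun D E E' => Subtype.ext <| by simp only [derComm, Submodule.coe_add, map_add])
    (fun c D E => Subtype.ext <| by simp only [derComm, Submodule.coe_smul, map_smul])

theorem derBracket_apply {A : Type*} [AddCommGroup A] [Module ℝ A] {m : A →ₗ[ℝ] A →ₗ[ℝ] A}
    (D E : Der m) : derBracket m D E = derComm D E := rfl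

theorem isLieBracket_derBracket {A : Type*} [AddCommGroup A] [Module ℝ A]
    (m : A →ₗ[ℝ] A →ₗ[ℝ] A) : IsLieBracket (derBracket m) where
  alternating D := Subtype.ext (sub_self _)
  jacobi D E F := by
    apply Subtype.ext
    simp only [derBracket_apply, derComm, Submodule.coe_add, endComm_eq, mul_sub, sub_mul,
      mul_assoc, Submodule.coe_zero]
    abel

/-- The action of `Der K₁` on `K₁' ⊗ H₃'(K₂)`. -/
noncomputable def titsAct₁ : DerK K₁ →ₗ[ℝ] Module.End ℝ (Im K₁ ⊗[ℝ] H3Traceless K₂) :=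
  LinearMap.rTensorHom (H3Traceless K₂) ∘ₗ derIm K₁

/-- The action of `Der H₃(K₂)` on `K₁' ⊗ H₃'(K₂)`. -/
noncomputable def titsAct₂ : DerH3 K₂ →ₗ[ℝ] Module.End ℝ (Im K₁ ⊗[ℝ] H3Traceless K₂) :=
  LinearMap.lTensorHom (Im K₁) ∘ₗ derTraceless K₂

/-- The `Der K₁` part of Tits's bracket on `K₁' ⊗ H₃'(K₂)`. -/
noncomputable def titsForm₁ :
    Im K₁ ⊗[ℝ] H3Traceless K₂ →ₗ[ℝ] Im K₁ ⊗[ℝ] H3Traceless K₂ →ₗ[ℝ] DerK K₁ :=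
  (1 / 3 : ℝ) • (TensorProduct.map₂ (imInnerDer K₁)
    ((hermForm K₂).compl₁₂ (H3Traceless K₂).subtype (H3Traceless K₂).subtype)).compr₂
    (TensorProduct.rid ℝ (DerK K₁)).toLinearMap

/-- The `Der H₃(K₂)` part of Tits's bracket on `K₁' ⊗ H₃'(K₂)`. -/
noncomputable def titsForm₂ :
    Im K₁ ⊗[ℝ] H3Traceless K₂ →ₗ[ℝ] Im K₁ ⊗[ℝ] H3Traceless K₂ →ₗ[ℝ] DerH3 K₂ :=
  (-1 : ℝ) • (TensorProduct.map₂ ((ip K₁).compl₁₂ (Im K₁).subtype (Im K₁).subtype)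
    jordanInnerDer).compr₂ (TensorProduct.lid ℝ (DerH3 K₂)).toLinearMap

/-- The `K₁' ⊗ H₃'(K₂)` part of Tits's bracket on `K₁' ⊗ H₃'(K₂)`. -/
noncomputable def titsMul : Im K₁ ⊗[ℝ] H3Traceless K₂ →ₗ[ℝ] Im K₁ ⊗[ℝ] H3Traceless K₂ →ₗ[ℝ]
    Im K₁ ⊗[ℝ] H3Traceless K₂ :=
  TensorProduct.map₂ (imComm K₁) (starForm K₂)

/-- Tits's bracket. -/
noncomputable def titsBracket :
    TitsSpace K₁ K₂ →ₗ[ℝ] TitsSpace K₁ K₂ →ₗ[ℝ] TitsSpace K₁ K₂ :=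
  extBracket (derBracket _) (derBracket _) (titsAct₁ K₁ K₂) (titsAct₂ K₁ K₂) (titsForm₁ K₁ K₂)
    (titsForm₂ K₁ K₂) (titsMul K₁ K₂)

variable {K₁ K₂}

theorem titsAct₁_tmul (D : DerK K₁) (a : Im K₁) (A : H3Traceless K₂) :
    titsAct₁ K₁ K₂ D (a ⊗ₜ A) = derIm K₁ D a ⊗ₜ A := rfl

theorem titsAct₂_tmul (D : DerH3 K₂) (a : Im K₁) (A : H3Traceless K₂) :
    titsAct₂ K₁ K₂ D (a ⊗ₜ A) = a ⊗ₜ derTraceless K₂ D A := rfl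

theorem titsForm₁_tmul (a b : Im K₁) (A B : H3Traceless K₂) :
    titsForm₁ K₁ K₂ (a ⊗ₜ A) (b ⊗ₜ B) =
      (1 / 3 * hermForm K₂ A.1 B.1) • imInnerDer K₁ a b := by
  simp [titsForm₁, mul_smul]

theorem titsForm₂_tmul (a b : Im K₁) (A B : H3Traceless K₂) :
    titsForm₂ K₁ K₂ (a ⊗ₜ A) (b ⊗ₜ B) = -(ip K₁ a.1 b.1 • jordanInnerDer A B) := by
  simp [titsForm₂]

theorem titsMul_tmul (a b : Im K₁) (A B : H3Traceless K₂) :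
    titsMul K₁ K₂ (a ⊗ₜ A) (b ⊗ₜ B) = imComm K₁ a b ⊗ₜ starForm K₂ A B := by
  simp [titsMul]

theorem jordanInnerDer_swap (A B : H3Traceless K₂) :
    jordanInnerDer A B = -jordanInnerDer B A :=
  Subtype.ext (by rw [Submodule.coe_neg, coe_jordanInnerDer, coe_jordanInnerDer, endComm_eq,
    endComm_eq, neg_sub])

/-- Multiplication by the identity matrix is a scalar operator, so A * B may be replaced by A · B
inside the commutators; the linearised Jordan identity remains. -/
theorem jordanInnerDer_cyclic (A B C : H3Traceless K₂) : jordanInnerDer A (starForm K₂ B C)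
    + jordanInnerDer B (starForm K₂ C A) + jordanInnerDer C (starForm K₂ A B) = 0 := by
  apply Subtype.ext
  have h1 : ∀ X : H3 K₂, endComm (H3 K₂) (jordanMul K₂ X) (jordanMul K₂ (H3.one K₂)) = 0 :=
    fun X => by
      refine LinearMap.ext fun Y => ?_
      rw [endComm_apply, jordanMul_comm (H3.one K₂), jordanMul_one, jordanMul_comm (H3.one K₂),
        jordanMul_one, map_smul, sub_self, LinearMap.zero_apply]
  have h := jordan_identity A.1 B.1 C.1
  have h2 : ∀ X Y : Module.End ℝ (H3 K₂), endComm _ X Y = -endComm _ Y X := fun X Y => by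
    rw [endComm_eq, endComm_eq, neg_sub]
  rw [h2 _ (jordanMul K₂ A.1), h2 _ (jordanMul K₂ B.1), h2 _ (jordanMul K₂ C.1)] at h
  simp only [Submodule.coe_add, coe_jordanInnerDer, coe_starForm, map_sub, map_smul, h1, smul_zero,
    sub_zero, Submodule.coe_zero]
  linear_combination (norm := module) -h

theorem isLieBracket_titsBracket : IsLieBracket (titsBracket K₁ K₂) := by
  refine isLieBracket_extBracket (isLieBracket_derBracket _) (isLieBracket_derBracket _)
    ?_ ?_ ?_ ?_ ?_ ?_ ?_ ?_ ?_ ?_ ?_ ?_ ?_ ?_ ?_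
  · intro D E w
    refine sub_eq_zero.mp (eq_zero_of_tmul (F := fun w => titsAct₁ K₁ K₂ (derBracket _ D E) w -
      (titsAct₁ K₁ K₂ D (titsAct₁ K₁ K₂ E w) - titsAct₁ K₁ K₂ E (titsAct₁ K₁ K₂ D w)))
      (fun x y => by simp only [map_add]; abel) (fun a A => ?_) w)
    simp only [titsAct₁_tmul, ← TensorProduct.sub_tmul]
    rw [sub_eq_zero.mpr (by rfl), TensorProduct.zero_tmul]
  · intro D E w
    refine sub_eq_zero.mp (eq_zero_of_tmul (F := fun w => titsAct₂ K₁ K₂ (derBracket _ D E) w -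
      (titsAct₂ K₁ K₂ D (titsAct₂ K₁ K₂ E w) - titsAct₂ K₁ K₂ E (titsAct₂ K₁ K₂ D w)))
      (fun x y => by simp only [map_add]; abel) (fun a A => ?_) w)
    simp only [titsAct₂_tmul, ← TensorProduct.tmul_sub]
    rw [sub_eq_zero.mpr (by rfl), TensorProduct.tmul_zero]
  · intro D E w
    exact sub_eq_zero.mp (eq_zero_of_tmul (F := fun w =>
      titsAct₁ K₁ K₂ D (titsAct₂ K₁ K₂ E w) - titsAct₂ K₁ K₂ E (titsAct₁ K₁ K₂ D w))
      (fun x y => by simp only [map_add]; abel) (fun a A => sub_self _) w)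
  · intro v w
    refine eq_neg_of_add_eq_zero_left (eq_zero_of_tmul₂ (F := fun v w =>
      titsForm₁ K₁ K₂ v w + titsForm₁ K₁ K₂ w v) ?_ ?_ ?_ v w)
    · intro x x' y; simp only [map_add, LinearMap.add_apply]; abel
    · intro x x' y; simp only [map_add, LinearMap.add_apply]; abel
    · intro a A b B
      simp only [titsForm₁_tmul]
      rw [imInnerDer_swap, hermForm_comm]
      module
  · intro v w
    refine eq_neg_of_add_eq_zero_left (eq_zero_of_tmul₂ (F := fun v w =>
      titsForm₂ K₁ K₂ v w + titsForm₂ K₁ K₂ w v) ?_ ?_ ?_ v w)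
    · intro x x' y; simp only [map_add, LinearMap.add_apply]; abel
    · intro x x' y; simp only [map_add, LinearMap.add_apply]; abel
    · intro a A b B
      simp only [titsForm₂_tmul]
      rw [jordanInnerDer_swap, ip_comm]
      module
  · intro v w
    refine eq_neg_of_add_eq_zero_left (eq_zero_of_tmul₂ (F := fun v w =>
      titsMul K₁ K₂ v w + titsMul K₁ K₂ w v) ?_ ?_ ?_ v w)
    · intro x x' y; simp only [map_add, LinearMap.add_apply]; abel
    · intro x x' y; simp only [map_add, LinearMap.add_apply]; abel
    · intro a A b B
      simp only [titsMul_tmul]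
      rw [imComm_swap, starForm_comm, TensorProduct.neg_tmul, neg_add_cancel]
  · intro D v w
    refine sub_eq_zero.mp (eq_zero_of_tmul₂ (F := fun v w => derBracket _ D (titsForm₁ K₁ K₂ v w) -
      (titsForm₁ K₁ K₂ (titsAct₁ K₁ K₂ D v) w + titsForm₁ K₁ K₂ v (titsAct₁ K₁ K₂ D w)))
      ?_ ?_ ?_ v w)
    · intro x x' y; simp only [map_add, LinearMap.add_apply]; abel
    · intro x x' y; simp only [map_add]; abel
    · intro a A b B
      simp only [titsForm₁_tmul, titsAct₁_tmul, map_smul, derBracket_apply, derComm_imInnerDer]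
      module
  · intro D v w
    refine eq_zero_of_tmul₂ (F := fun v w =>
      titsForm₂ K₁ K₂ (titsAct₁ K₁ K₂ D v) w + titsForm₂ K₁ K₂ v (titsAct₁ K₁ K₂ D w))
      ?_ ?_ ?_ v w
    · intro x x' y; simp only [map_add, LinearMap.add_apply]; abel
    · intro x x' y; simp only [map_add]; abel
    · intro a A b B
      simp only [titsForm₂_tmul, titsAct₁_tmul]
      rw [← neg_add, ← add_smul, ip_derIm, zero_smul, neg_zero]
  · intro D v w
    refine sub_eq_zero.mp (eq_zero_of_tmul₂ (F := fun v w => titsAct₁ K₁ K₂ D (titsMul K₁ K₂ v w) -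
      (titsMul K₁ K₂ (titsAct₁ K₁ K₂ D v) w + titsMul K₁ K₂ v (titsAct₁ K₁ K₂ D w)))
      ?_ ?_ ?_ v w)
    · intro x x' y; simp only [map_add, LinearMap.add_apply]; abel
    · intro x x' y; simp only [map_add]; abel
    · intro a A b B
      simp only [titsMul_tmul, titsAct₁_tmul, derIm_imComm, TensorProduct.add_tmul, sub_self]
  · intro D v w
    refine eq_zero_of_tmul₂ (F := fun v w =>
      titsForm₁ K₁ K₂ (titsAct₂ K₁ K₂ D v) w + titsForm₁ K₁ K₂ v (titsAct₂ K₁ K₂ D w))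
      ?_ ?_ ?_ v w
    · intro x x' y; simp only [map_add, LinearMap.add_apply]; abel
    · intro x x' y; simp only [map_add]; abel
    · intro a A b B
      simp only [titsForm₁_tmul, titsAct₂_tmul, hermForm_apply, coe_derTraceless]
      rw [← add_smul, ← mul_add, hermIp_derivation D.2, mul_zero, zero_smul]
  · intro D v w
    refine sub_eq_zero.mp (eq_zero_of_tmul₂ (F := fun v w => derBracket _ D (titsForm₂ K₁ K₂ v w) -
      (titsForm₂ K₁ K₂ (titsAct₂ K₁ K₂ D v) w + titsForm₂ K₁ K₂ v (titsAct₂ K₁ K₂ D w)))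
      ?_ ?_ ?_ v w)
    · intro x x' y; simp only [map_add, LinearMap.add_apply]; abel
    · intro x x' y; simp only [map_add]; abel
    · intro a A b B
      simp only [titsForm₂_tmul, titsAct₂_tmul, map_smul, map_neg, derBracket_apply,
        derComm_jordanInnerDer]
      module
  · intro D v w
    refine sub_eq_zero.mp (eq_zero_of_tmul₂ (F := fun v w => titsAct₂ K₁ K₂ D (titsMul K₁ K₂ v w) -
      (titsMul K₁ K₂ (titsAct₂ K₁ K₂ D v) w + titsMul K₁ K₂ v (titsAct₂ K₁ K₂ D w)))
      ?_ ?_ ?_ v w)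
    · intro x x' y; simp only [map_add, LinearMap.add_apply]; abel
    · intro x x' y; simp only [map_add]; abel
    · intro a A b B
      simp only [titsMul_tmul, titsAct₂_tmul, derTraceless_starForm, TensorProduct.tmul_add,
        sub_self]
  · refine eq_zero_of_tmul₃ ?_ ?_ ?_ ?_
    · intro x x' y z; simp only [map_add, LinearMap.add_apply]; abel
    · intro x x' y z; simp only [map_add, LinearMap.add_apply]; abel
    · intro x x' y z; simp only [map_add, LinearMap.add_apply]; abel
    · intro a A b B c C
      simp only [titsMul_tmul, titsForm₁_tmul]
      -- ⟨A, B * C⟩ is invariant under cyclic permutation, so it factors out and leaves the cyclic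
      -- sum of D_{a,[b,c]}.
      rw [← hermForm_starForm B C A, hermForm_comm _ A.1, hermForm_comm C.1, hermForm_starForm A B C,
        ← smul_add, ← smul_add, imInnerDer_cyclic, smul_zero]
  · refine eq_zero_of_tmul₃ ?_ ?_ ?_ ?_
    · intro x x' y z; simp only [map_add, LinearMap.add_apply]; abel
    · intro x x' y z; simp only [map_add, LinearMap.add_apply]; abel
    · intro x x' y z; simp only [map_add, LinearMap.add_apply]; abel
    · intro a A b B c C
      simp only [titsMul_tmul, titsForm₂_tmul]
      -- Here the common factor is the cyclic form ⟨a, [b, c]⟩, and the Jordan identity is left.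
      rw [← ip_imComm_cyclic b c a, ← ip_imComm_cyclic a b c, ← neg_add, ← neg_add, ← smul_add,
        ← smul_add, jordanInnerDer_cyclic, smul_zero, neg_zero]
  · refine eq_zero_of_tmul₃ ?_ ?_ ?_ ?_
    · intro x x' y z; simp only [map_add, LinearMap.add_apply]; abel
    · intro x x' y z; simp only [map_add, LinearMap.add_apply]; abel
    · intro x x' y z; simp only [map_add, LinearMap.add_apply]; abel
    · intro a A b B c C
      -- After expansion the terms with a scalar product in K₁ cancel by themselves. The terms in
      -- (a, b, c) come from the double commutator with factor -½ and from D with factor ⅓; together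
      -- they are -½ times this instance of Cayley–Hamilton.
      have h := congrArg (imAssociator a b c ⊗ₜ[ℝ] ·) (starForm_cyclic A B C)
      simp only [titsMul_tmul, titsForm₁_tmul, titsForm₂_tmul, map_smul, map_neg,
        LinearMap.smul_apply, LinearMap.neg_apply, titsAct₁_tmul, titsAct₂_tmul,
        imComm_imComm, derIm_imInnerDer, derTraceless_jordanInnerDer,
        ← imAssociator_rotate a b c, imAssociator_rotate c a b, TensorProduct.sub_tmul,
        TensorProduct.tmul_sub, TensorProduct.tmul_add, ← TensorProduct.smul_tmul',
        TensorProduct.tmul_smul, ip_comm b.1 a.1, ip_comm c.1 a.1, ip_comm c.1 b.1,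
        hermForm_comm C.1 A.1] at *
      linear_combination (norm := module) -(1 / 2 : ℝ) • h

theorem isTitsBracket_titsBracket : IsTitsBracket (titsBracket K₁ K₂) where
  der_der D₁ E₁ D₂ E₂ := by
    simp [titsBracket, extBracket_apply, derBracket_apply]
  der_tensor D₁ D₂ t := by
    simp only [titsBracket, extBracket_apply, map_zero, LinearMap.zero_apply, add_zero, sub_zero,
      true_and]
    refine sub_eq_zero.mp (eq_zero_of_tmul (F := fun t => tensorIncl K₁ K₂
      (titsAct₁ K₁ K₂ D₁ t + titsAct₂ K₁ K₂ D₂ t) -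
      (LinearMap.rTensor (H3 K₂) D₁.1 + LinearMap.lTensor K₁ D₂.1) (tensorIncl K₁ K₂ t)) ?_ ?_ t)
    · intro x y; simp only [map_add]; abel
    · intro a A
      rw [map_add, titsAct₁_tmul, titsAct₂_tmul, sub_eq_zero]
      rfl
  tensor_tensor a b A B := by
    simp only [titsBracket, extBracket_apply, map_zero, LinearMap.zero_apply, add_zero, zero_add,
      sub_zero, titsForm₁_tmul, titsForm₂_tmul, titsMul_tmul]
    refine ⟨rfl, rfl, ?_⟩
    rw [tensorIncl, TensorProduct.map_tmul, Submodule.subtype_apply, coe_imComm,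
      ← TensorProduct.smul_tmul']
    rfl

end TitsConstruction

/-! ### The linear isomorphism between Vinberg's and Tits's spaces. -/

section VinbergConstruction

variable (K₁ K₂ : Type*)
  [NonAssocRing K₁] [Module ℝ K₁] [IsScalarTower ℝ K₁ K₁] [SMulCommClass ℝ K₁ K₁]
  [CompositionAlgebra K₁]
  [NonAssocRing K₂] [Module ℝ K₂] [IsScalarTower ℝ K₂ K₂] [SMulCommClass ℝ K₂ K₂]
  [CompositionAlgebra K₂]

/-- The decomposition `Der H₃(K) = A₃'(K) ∔ Der K`. -/
noncomputable def derH3Equiv : (antihermitianTraceless (conj K₂) × DerK K₂) ≃ₗ[ℝ] DerH3 K₂ :=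
  LinearEquiv.ofBijective
    (LinearMap.codRestrict (DerH3 K₂) ((adOp K₂).coprod (derOp K₂)) fun p =>
      Submodule.add_mem _ (adOp_mem_der p.1) (derOp_mem_der p.2))
    ⟨by
      refine (injective_iff_map_eq_zero _).mpr fun p hp => ?_
      have h := adOp_add_derOp_injective (A := p.1) (d := p.2) (congrArg Subtype.val hp)
      exact Prod.ext h.1 h.2, fun D => by
      obtain ⟨A, d, h⟩ := exists_adOp_add_derOp D.2
      exact ⟨(A, d), Subtype.ext h⟩⟩

/-- The matrix `u ⊗ X` with entries `u ⊗ x_ij`. -/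
noncomputable def tensMat : K₁ →ₗ[ℝ] Matrix (Fin 3) (Fin 3) K₂ →ₗ[ℝ]
    Matrix (Fin 3) (Fin 3) (K₁ ⊗[ℝ] K₂) :=
  LinearMap.mk₂ ℝ (fun u X => X.map (u ⊗ₜ[ℝ] ·))
    (fun u u' X => by ext i j; simp [TensorProduct.add_tmul])
    (fun c u X => by ext i j; simp [TensorProduct.smul_tmul'])
    (fun u X X' => by ext i j; simp [TensorProduct.tmul_add])
    (fun c u X => by ext i j; simp)

/-- The map `a ⊗ X ↦ (a ⊗ x_ij)` from `K₁' ⊗ H₃'(K₂)` to matrices. -/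
noncomputable def tensorMatrix : Im K₁ ⊗[ℝ] H3Traceless K₂ →ₗ[ℝ]
    Matrix (Fin 3) (Fin 3) (K₁ ⊗[ℝ] K₂) :=
  TensorProduct.lift ((tensMat K₁ K₂).compl₁₂ (Im K₁).subtype
    (mat K₂ ∘ₗ (H3Traceless K₂).subtype))

variable {K₁ K₂}

theorem coe_derH3Equiv (A : antihermitianTraceless (conj K₂)) (D : DerK K₂) :
    (derH3Equiv K₂ (A, D)).1 = adOp K₂ A + derOp K₂ D := rfl

theorem tensMat_apply (u : K₁) (X : Matrix (Fin 3) (Fin 3) K₂) (i j : Fin 3) :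
    tensMat K₁ K₂ u X i j = u ⊗ₜ X i j := rfl

theorem tensorMatrix_tmul (a : Im K₁) (X : H3Traceless K₂) :
    tensorMatrix K₁ K₂ (a ⊗ₜ X) = tensMat K₁ K₂ a (mat K₂ X) := rfl

theorem trace_tensMat (u : K₁) (X : Matrix (Fin 3) (Fin 3) K₂) :
    (tensMat K₁ K₂ u X).trace = u ⊗ₜ X.trace := by
  simp only [Matrix.trace, Matrix.diag_apply, tensMat_apply, TensorProduct.tmul_sum]

theorem tracelessPart_tensMat (u : K₁) (X : Matrix (Fin 3) (Fin 3) K₂) :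
    tracelessPart (tensMat K₁ K₂ u X) = tensMat K₁ K₂ u (tracelessPart X) := by
  ext i j
  rw [tracelessPart, Matrix.sub_apply, trace_tensMat, tensMat_apply, tensMat_apply, tracelessPart,
    Matrix.sub_apply, TensorProduct.tmul_sub]
  by_cases h : i = j
  · subst h
    rw [Matrix.diagonal_apply_eq, Matrix.diagonal_apply_eq, TensorProduct.tmul_smul]
  · rw [Matrix.diagonal_apply_ne _ h, Matrix.diagonal_apply_ne _ h, TensorProduct.tmul_zero]

theorem tensMat_mul (u v : K₁) (X Y : Matrix (Fin 3) (Fin 3) K₂) :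
    tensMat K₁ K₂ u X * tensMat K₁ K₂ v Y = tensMat K₁ K₂ (u * v) (X * Y) := by
  ext i j
  simp only [Matrix.mul_apply, tensMat_apply, TensorProduct.tmul_sum,
    Algebra.TensorProduct.tmul_mul_tmul]

theorem tensMat_one_mem (A : antihermitianTraceless (conj K₂)) :
    tensMat K₁ K₂ 1 A.1 ∈ A3Tensor K₁ K₂ := by
  refine ⟨fun i j => ?_, by rw [trace_tensMat, A.2.2, TensorProduct.tmul_zero]⟩
  rw [tensMat_apply, tensMat_apply, TensorProduct.map_tmul, A.2.1, conj_one,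
    TensorProduct.tmul_neg]

theorem tensorMatrix_mem (t : Im K₁ ⊗[ℝ] H3Traceless K₂) :
    tensorMatrix K₁ K₂ t ∈ A3Tensor K₁ K₂ := by
  induction t using TensorProduct.induction_on with
  | zero => rw [map_zero]; exact Submodule.zero_mem _
  | add x y hx hy => rw [map_add]; exact Submodule.add_mem _ hx hy
  | tmul a X =>
    rw [tensorMatrix_tmul]
    have hX : (mat K₂ X.1).trace = 0 := X.2
    refine ⟨fun i j => ?_, by rw [trace_tensMat, hX, TensorProduct.tmul_zero]⟩
    rw [tensMat_apply, tensMat_apply, TensorProduct.map_tmul, conj_mat, conj_eq_neg a.2,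
      TensorProduct.neg_tmul]

/-- Matrices u ⊗ X span: an elementary matrix with entry u ⊗ v is u tensored with an elementary
matrix over K₂. -/
theorem tensMat_induction {p : Matrix (Fin 3) (Fin 3) (K₁ ⊗[ℝ] K₂) → Prop} (h0 : p 0)
    (hadd : ∀ M N, p M → p N → p (M + N)) (h : ∀ u X, p (tensMat K₁ K₂ u X))
    (M : Matrix (Fin 3) (Fin 3) (K₁ ⊗[ℝ] K₂)) : p M := by
  induction M using Matrix.induction_on' with
  | h_zero => exact h0
  | h_add M N hM hN => exact hadd M N hM hN
  | h_std_basis i j x =>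
    induction x using TensorProduct.induction_on with
    | zero => simpa using h0
    | add x y hx hy => rw [Matrix.single_add]; exact hadd _ _ hx hy
    | tmul u v =>
      convert h u (Matrix.single i j v)
      ext k l
      rw [tensMat_apply, Matrix.single_apply, Matrix.single_apply]
      split_ifs <;> simp

variable (K₁ K₂) in
/-- The map `(A, t) ↦ 1 ⊗ A + t` from `A₃'(K₂) ∔ K₁' ⊗ H₃'(K₂)` to `A₃'(K₁ ⊗ K₂)`. -/
noncomputable def antiSum :
    (antihermitianTraceless (conj K₂) × Im K₁ ⊗[ℝ] H3Traceless K₂) →ₗ[ℝ] A3Tensor K₁ K₂ :=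
  LinearMap.codRestrict (A3Tensor K₁ K₂)
    ((tensMat K₁ K₂ 1 ∘ₗ (antihermitianTraceless (conj K₂)).subtype).coprod (tensorMatrix K₁ K₂))
    fun p => Submodule.add_mem _ (tensMat_one_mem p.1) (tensorMatrix_mem p.2)

theorem tensorMatrix_injective : Function.Injective (tensorMatrix K₁ K₂) := by
  obtain ⟨f, hf⟩ := (Im K₁).subtype.exists_leftInverse_of_injective (Submodule.ker_subtype _)
  obtain ⟨g, hg⟩ := (mat K₂ ∘ₗ (H3Traceless K₂).subtype).exists_leftInverse_of_injective
    (LinearMap.ker_eq_bot.mpr (mat_injective.comp Subtype.val_injective))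
  have hf' : ∀ a : Im K₁, f a = a := fun a => LinearMap.congr_fun hf a
  have hg' : ∀ X : H3Traceless K₂, g (mat K₂ X) = X := fun X => LinearMap.congr_fun hg X
  refine (injective_iff_map_eq_zero _).mpr fun t ht => ?_
  -- Retractions f and g of the two inclusions give an explicit left inverse: apply f ⊗ g entry by
  -- entry and reassemble. No bases are needed.
  have key : ∀ t : Im K₁ ⊗[ℝ] H3Traceless K₂, ∑ i, ∑ j,
      TensorProduct.map f (g ∘ₗ Matrix.singleLinearMap ℝ i j) (tensorMatrix K₁ K₂ t i j) = t := by
    intro t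
    refine sub_eq_zero.mp (eq_zero_of_tmul (F := fun t => ∑ i, ∑ j,
      TensorProduct.map f (g ∘ₗ Matrix.singleLinearMap ℝ i j) (tensorMatrix K₁ K₂ t i j) - t)
      ?_ ?_ t)
    · intro x y
      simp only [map_add, Matrix.add_apply, Finset.sum_add_distrib]
      abel
    · intro a X
      rw [sub_eq_zero]
      simp only [tensorMatrix_tmul, tensMat_apply, TensorProduct.map_tmul, hf',
        ← TensorProduct.tmul_sum, LinearMap.comp_apply, ← map_sum]
      congr 1
      conv_rhs => rw [← hg' X, Matrix.matrix_eq_sum_single (mat K₂ X.1)]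
      rfl
  rw [← key t, ht]
  simp

/-- The linear map `u ⊗ v ↦ ⟨1, u⟩ v`. -/
noncomputable def realPart : K₁ ⊗[ℝ] K₂ →ₗ[ℝ] K₂ :=
  (TensorProduct.lid ℝ K₂).toLinearMap ∘ₗ LinearMap.rTensor K₂ (ip K₁ 1)

theorem realPart_tmul (u : K₁) (v : K₂) : realPart (u ⊗ₜ[ℝ] v) = ip K₁ 1 u • v := by
  simp [realPart]

theorem realPart_tensorMatrix (t : Im K₁ ⊗[ℝ] H3Traceless K₂) (i j : Fin 3) :
    realPart (tensorMatrix K₁ K₂ t i j) = 0 := by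
  refine eq_zero_of_tmul (F := fun t => realPart (tensorMatrix K₁ K₂ t i j)) ?_ ?_ t
  · intro x y
    rw [map_add, Matrix.add_apply, map_add]
  · intro a X
    rw [tensorMatrix_tmul, tensMat_apply, realPart_tmul, mem_Im.mp a.2, zero_smul]

/-- The functional ⟨1, ·⟩ on K₁ annihilates the imaginary summand and recovers A, leaving the
injectivity of `tensorMatrix`. -/
theorem antiSum_injective : Function.Injective (antiSum K₁ K₂) := by
  refine (injective_iff_map_eq_zero _).mpr ?_
  rintro ⟨A, t⟩ h
  have h' : tensMat K₁ K₂ 1 A.1 + tensorMatrix K₁ K₂ t = 0 := congrArg Subtype.val h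
  have hA : A = 0 := by
    apply Subtype.ext
    ext i j
    have h2 := congrArg (fun M => realPart (M i j)) h'
    simpa [realPart_tensorMatrix, tensMat_apply, realPart_tmul, ip_one_one] using h2
  rw [hA, Submodule.coe_zero, map_zero, zero_add] at h'
  exact Prod.ext hA (tensorMatrix_injective (h'.trans (map_zero _).symm))

/-- The conjugate transpose of a matrix with respect to the conjugation `c`. -/
noncomputable def adjoint {R : Type*} [AddCommGroup R] [Module ℝ R] (c : R →ₗ[ℝ] R) :
    Matrix (Fin 3) (Fin 3) R →ₗ[ℝ] Matrix (Fin 3) (Fin 3) R where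
  toFun M := Matrix.of fun i j => c (M j i)
  map_add' M N := by ext i j; simp
  map_smul' r M := by ext i j; simp

theorem adjoint_apply {R : Type*} [AddCommGroup R] [Module ℝ R] (c : R →ₗ[ℝ] R)
    (M : Matrix (Fin 3) (Fin 3) R) (i j : Fin 3) : adjoint c M i j = c (M j i) := rfl

theorem antiSum_surjective : Function.Surjective (antiSum K₁ K₂) := by
  -- For u = r + u' with r real and u' imaginary, u ⊗ X minus its adjoint is r ⊗ (X - X*) + u' ⊗ (X
  -- + X*), which displays the two components.
  have key : ∀ M : Matrix (Fin 3) (Fin 3) (K₁ ⊗[ℝ] K₂), ∃ p, (antiSum K₁ K₂ p).1 =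
      tracelessPart (M - adjoint (TensorProduct.map (conj K₁) (conj K₂)) M) := by
    refine tensMat_induction ?_ ?_ ?_
    · exact ⟨0, by simp [tracelessPart]⟩
    · rintro M N ⟨p, hp⟩ ⟨q, hq⟩
      refine ⟨p + q, ?_⟩
      rw [map_add, Submodule.coe_add, hp, hq, ← tracelessPart_add, map_add]
      congr 1
      abel
    · intro u X
      have hA : ∀ i j, conj K₂ ((X - adjoint (conj K₂) X) j i) = -(X - adjoint (conj K₂) X) i j :=
        fun i j => by simp [adjoint_apply, conj_conj]
      have hH : X + adjoint (conj K₂) X ∈ hermitian (conj K₂) :=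
        fun i j => by simp [adjoint_apply, conj_conj, add_comm]
      have hu : u - ip K₁ 1 u • (1 : K₁) ∈ Im K₁ := by
        rw [mem_Im, map_sub, map_smul, ip_one_one]; simp
      refine ⟨(ip K₁ 1 u • ⟨_, tracelessPart_mem_antihermitian hA⟩, ⟨_, hu⟩ ⊗ₜ
        ⟨H3.mk K₂ _ (tracelessPart_mem_hermitian hH), trace_tracelessPart _⟩), ?_⟩
      have e : tensMat K₁ K₂ u X - adjoint (TensorProduct.map (conj K₁) (conj K₂))
          (tensMat K₁ K₂ u X) = tensMat K₁ K₂ (ip K₁ 1 u • 1) (X - adjoint (conj K₂) X) +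
            tensMat K₁ K₂ (u - ip K₁ 1 u • (1 : K₁)) (X + adjoint (conj K₂) X) := by
        ext i j
        simp only [Matrix.sub_apply, Matrix.add_apply, adjoint_apply, tensMat_apply,
          TensorProduct.map_tmul,
          TensorProduct.tmul_add, TensorProduct.tmul_sub, TensorProduct.sub_tmul,
          ← TensorProduct.smul_tmul', conj_apply u]
        module
      have e' := congrArg tracelessPart e
      rw [tracelessPart_add (tensMat K₁ K₂ _ _), tracelessPart_tensMat, tracelessPart_tensMat,
        map_smul, LinearMap.smul_apply, ← map_smul] at e'
      exact e'.symm
  intro M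
  -- An antihermitian M is ½M minus the adjoint of ½M.
  obtain ⟨p, hp⟩ := key ((1 / 2 : ℝ) • M.1)
  refine ⟨p, Subtype.ext ?_⟩
  have e : (1 / 2 : ℝ) • M.1 - adjoint (TensorProduct.map (conj K₁) (conj K₂))
      ((1 / 2 : ℝ) • M.1) = M.1 := by
    ext i j
    rw [Matrix.sub_apply, map_smul, Matrix.smul_apply, Matrix.smul_apply, adjoint_apply, M.2.1]
    module
  rw [hp, e, tracelessPart, M.2.2]
  simp

variable (K₁ K₂) in
/-- The decomposition `A₃'(K₁ ⊗ K₂) = A₃'(K₂) ∔ K₁' ⊗ H₃'(K₂)`. -/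
noncomputable def antiEquiv :
    (antihermitianTraceless (conj K₂) × Im K₁ ⊗[ℝ] H3Traceless K₂) ≃ₗ[ℝ] A3Tensor K₁ K₂ :=
  LinearEquiv.ofBijective (antiSum K₁ K₂) ⟨antiSum_injective, antiSum_surjective⟩

theorem coe_antiEquiv (A : antihermitianTraceless (conj K₂)) (t : Im K₁ ⊗[ℝ] H3Traceless K₂) :
    (antiEquiv K₁ K₂ (A, t)).1 = tensMat K₁ K₂ 1 A.1 + tensorMatrix K₁ K₂ t := rfl

variable (K₁ K₂) in
/-- The linear isomorphism between Vinberg's and Tits's spaces. -/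
noncomputable def vinbergEquiv : VinbergSpace K₁ K₂ ≃ₗ[ℝ] TitsSpace K₁ K₂ where
  toFun v := (v.2.1, derH3Equiv K₂ (((antiEquiv K₁ K₂).symm v.1).1, v.2.2),
    ((antiEquiv K₁ K₂).symm v.1).2)
  map_add' v w := by
    simp only [Prod.fst_add, Prod.snd_add, map_add, ← Prod.mk_add_mk]
  map_smul' r v := by
    simp only [Prod.smul_fst, Prod.smul_snd, map_smul, ← Prod.smul_mk, RingHom.id_apply]
  invFun x := (antiEquiv K₁ K₂ (((derH3Equiv K₂).symm x.2.1).1, x.2.2), x.1,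
    ((derH3Equiv K₂).symm x.2.1).2)
  left_inv v := by simp
  right_inv x := by simp

theorem vinbergEquiv_apply (A : antihermitianTraceless (conj K₂))
    (t : Im K₁ ⊗[ℝ] H3Traceless K₂) (D₁ : DerK K₁) (D₂ : DerK K₂) :
    vinbergEquiv K₁ K₂ (antiEquiv K₁ K₂ (A, t), D₁, D₂) = (D₁, derH3Equiv K₂ (A, D₂), t) := by
  simp [vinbergEquiv]

end VinbergConstruction

/-! ### Transport of a Lie bracket along a linear isomorphism. -/

section Transport

variable {V W : Type*} [AddCommGroup V] [Module ℝ V] [AddCommGroup W] [Module ℝ W]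

/-- The bilinear map obtained from `γ` by transport along a linear isomorphism. -/
noncomputable def transport (e : V ≃ₗ[ℝ] W) (γ : W →ₗ[ℝ] W →ₗ[ℝ] W) : V →ₗ[ℝ] V →ₗ[ℝ] V :=
  (γ.compl₁₂ e.toLinearMap e.toLinearMap).compr₂ e.symm.toLinearMap

theorem transport_apply (e : V ≃ₗ[ℝ] W) (γ : W →ₗ[ℝ] W →ₗ[ℝ] W) (x y : V) :
    transport e γ x y = e.symm (γ (e x) (e y)) := rfl

theorem isLieBracket_transport (e : V ≃ₗ[ℝ] W) {γ : W →ₗ[ℝ] W →ₗ[ℝ] W} (hγ : IsLieBracket γ) :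
    IsLieBracket (transport e γ) where
  alternating x := by rw [transport_apply, hγ.alternating, map_zero]
  jacobi x y z := by
    simp only [transport_apply, LinearEquiv.apply_symm_apply, ← map_add, hγ.jacobi, map_zero]

/-- A linear isomorphism is an isomorphism from the transported Lie algebra. -/
noncomputable def transportLieEquiv (e : V ≃ₗ[ℝ] W) {γ : W →ₗ[ℝ] W →ₗ[ℝ] W} (hγ : IsLieBracket γ) :
    WithBracket V (transport e γ) (isLieBracket_transport e hγ) ≃ₗ⁅ℝ⁆ WithBracket W γ hγ where
  toFun x := e x
  map_add' x y := e.map_add x y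
  map_smul' r x := e.map_smul r x
  map_lie' {x y} := e.apply_symm_apply (γ (e x) (e y))
  invFun y := e.symm y
  left_inv x := e.symm_apply_apply x
  right_inv y := e.apply_symm_apply y

end Transport

/-! ### Vinberg's formulas for the transported bracket. -/

section VinbergFormulas

variable {K₁ K₂ : Type*}
  [NonAssocRing K₁] [Module ℝ K₁] [IsScalarTower ℝ K₁ K₁] [SMulCommClass ℝ K₁ K₁]
  [CompositionAlgebra K₁]
  [NonAssocRing K₂] [Module ℝ K₂] [IsScalarTower ℝ K₂ K₂] [SMulCommClass ℝ K₂ K₂]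
  [CompositionAlgebra K₂]

variable (K₁ K₂) in
/-- Vinberg's bracket. -/
noncomputable def vinbergBracket :
    VinbergSpace K₁ K₂ →ₗ[ℝ] VinbergSpace K₁ K₂ →ₗ[ℝ] VinbergSpace K₁ K₂ :=
  transport (vinbergEquiv K₁ K₂) (titsBracket K₁ K₂)

theorem tensMat_map (D₁ : Module.End ℝ K₁) (D₂ : Module.End ℝ K₂) (u : K₁)
    (X : Matrix (Fin 3) (Fin 3) K₂) :
    (tensMat K₁ K₂ u X).map ⇑(LinearMap.rTensor K₂ D₁ + LinearMap.lTensor K₁ D₂) =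
      tensMat K₁ K₂ (D₁ u) X + tensMat K₁ K₂ u (X.map D₂) := by
  ext i j
  simp [tensMat_apply]

theorem tensorMatrix_act (D₁ : DerK K₁) (D₂ : DerK K₂) (t : Im K₁ ⊗[ℝ] H3Traceless K₂) :
    tensorMatrix K₁ K₂ (titsAct₁ K₁ K₂ D₁ t + titsAct₂ K₁ K₂ (derH3Equiv K₂ (0, D₂)) t) =
      (tensorMatrix K₁ K₂ t).map
        ⇑(LinearMap.rTensor K₂ D₁.1 + LinearMap.lTensor K₁ D₂.1) := by
  refine sub_eq_zero.mp (eq_zero_of_tmul (F := fun t => tensorMatrix K₁ K₂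
    (titsAct₁ K₁ K₂ D₁ t + titsAct₂ K₁ K₂ (derH3Equiv K₂ (0, D₂)) t) -
    (tensorMatrix K₁ K₂ t).map ⇑(LinearMap.rTensor K₂ D₁.1 + LinearMap.lTensor K₁ D₂.1)) ?_ ?_ t)
  · intro x y
    simp only [map_add, Matrix.map_add _ (map_add _)]
    abel
  · intro a X
    have h : (derTraceless K₂ (derH3Equiv K₂ (0, D₂)) X).1 = derOp K₂ D₂ X.1 := by
      rw [coe_derTraceless, coe_derH3Equiv, map_zero, zero_add]
    rw [map_add, titsAct₁_tmul, titsAct₂_tmul, tensorMatrix_tmul, tensorMatrix_tmul,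
      tensorMatrix_tmul, tensMat_map, h, sub_eq_zero]
    rfl

theorem tracelessPart_commutator_one_one (P Q : antihermitianTraceless (conj K₂)) :
    tracelessPart (tensMat K₁ K₂ 1 P.1 * tensMat K₁ K₂ 1 Q.1
      - tensMat K₁ K₂ 1 Q.1 * tensMat K₁ K₂ 1 P.1) = tensMat K₁ K₂ 1 (antiComm P Q).1 := by
  rw [tensMat_mul, tensMat_mul, mul_one, ← map_sub, tracelessPart_tensMat]
  rfl

theorem tracelessPart_eq_self {R : Type*} [AddCommGroup R] [Module ℝ R]
    {X : Matrix (Fin 3) (Fin 3) R} (h : X.trace = 0) : tracelessPart X = X := by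
  simp [tracelessPart, h]

theorem tracelessPart_neg {R : Type*} [AddCommGroup R] [Module ℝ R]
    (X : Matrix (Fin 3) (Fin 3) R) : tracelessPart (-X) = -tracelessPart X := by
  refine eq_neg_of_add_eq_zero_left ?_
  rw [← tracelessPart_add, neg_add_cancel]
  simp [tracelessPart]

/-- The factor 1 commutes with a, so [1 ⊗ P, a ⊗ X] = a ⊗ [P, X], and [P, X] is already traceless.
-/
theorem tracelessPart_commutator_one_tensor (P : antihermitianTraceless (conj K₂))
    (t : Im K₁ ⊗[ℝ] H3Traceless K₂) :
    tracelessPart (tensMat K₁ K₂ 1 P.1 * tensorMatrix K₁ K₂ t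
      - tensorMatrix K₁ K₂ t * tensMat K₁ K₂ 1 P.1) =
      tensorMatrix K₁ K₂ (titsAct₂ K₁ K₂ (derH3Equiv K₂ (P, 0)) t) := by
  refine sub_eq_zero.mp (eq_zero_of_tmul (F := fun t => tracelessPart
    (tensMat K₁ K₂ 1 P.1 * tensorMatrix K₁ K₂ t - tensorMatrix K₁ K₂ t * tensMat K₁ K₂ 1 P.1) -
    tensorMatrix K₁ K₂ (titsAct₂ K₁ K₂ (derH3Equiv K₂ (P, 0)) t)) ?_ ?_ t)
  · intro x y
    simp only [map_add, mul_add, add_mul, add_sub_add_comm, tracelessPart_add]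
  · intro a X
    have h : (derTraceless K₂ (derH3Equiv K₂ (P, 0)) X).1 = adOp K₂ P X.1 := by
      rw [coe_derTraceless, coe_derH3Equiv, map_zero, add_zero]
    have ht : (mat K₂ (adOp K₂ P X.1)).trace = 0 := by
      rw [trace_eq_reTrace, reTrace_adOp, zero_smul]
    rw [titsAct₂_tmul, tensorMatrix_tmul, tensorMatrix_tmul, h, tensMat_mul, tensMat_mul, one_mul,
      mul_one, ← map_sub, ← mat_adOp, tracelessPart_tensMat, tracelessPart_eq_self ht, sub_self]

/-- Reads -⟨a, b⟩[L_X, L_Y] through `endComm_jordanMul_jordanMul`; the first component enters the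
matrix part of Vinberg's bracket and the second the Der K₂ part. -/
theorem titsForm₂_tmul_eq (a b : Im K₁) (X Y : H3Traceless K₂) :
    titsForm₂ K₁ K₂ (a ⊗ₜ X) (b ⊗ₜ Y) = derH3Equiv K₂ (-(ip K₁ a.1 b.1 • hermComm X.1 Y.1),
      (1 / 3 * ip K₁ a.1 b.1 : ℝ) • sumInnerDer (mat K₂ X.1) (mat K₂ Y.1)) := by
  apply Subtype.ext
  rw [titsForm₂_tmul, coe_derH3Equiv, Submodule.coe_neg, Submodule.coe_smul, coe_jordanInnerDer,
    endComm_jordanMul_jordanMul]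
  simp only [map_smul, map_neg]
  module

theorem mul_eq_imComm (a b : Im K₁) :
    (a * b : K₁) = -(ip K₁ a.1 b.1 • (1 : K₁)) + (imComm K₁ a b : K₁) := by
  have h := mul_add_mul_swap a.1 b.1
  rw [mem_Im.mp a.2, mem_Im.mp b.2] at h
  rw [coe_imComm]
  linear_combination (norm := module) (1 / 2 : ℝ) • h

/-- In ab = -⟨a, b⟩1 + ½[a, b] the symmetric part multiplies [X, Y], giving the antihermitian
component, and the skew part multiplies X · Y, giving [a, b] ⊗ (X * Y) with factor ½. -/
theorem tracelessPart_commutator_tensor_tensor (s t : Im K₁ ⊗[ℝ] H3Traceless K₂) :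
    tracelessPart (tensorMatrix K₁ K₂ s * tensorMatrix K₁ K₂ t
      - tensorMatrix K₁ K₂ t * tensorMatrix K₁ K₂ s) =
      tensMat K₁ K₂ 1 ((derH3Equiv K₂).symm (titsForm₂ K₁ K₂ s t)).1.1 +
        tensorMatrix K₁ K₂ (titsMul K₁ K₂ s t) := by
  refine sub_eq_zero.mp (eq_zero_of_tmul₂ (F := fun s t => tracelessPart
    (tensorMatrix K₁ K₂ s * tensorMatrix K₁ K₂ t - tensorMatrix K₁ K₂ t * tensorMatrix K₁ K₂ s) -
    (tensMat K₁ K₂ 1 ((derH3Equiv K₂).symm (titsForm₂ K₁ K₂ s t)).1.1 +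
        tensorMatrix K₁ K₂ (titsMul K₁ K₂ s t))) ?_ ?_ ?_ s t)
  · intro x y z
    simp only [map_add, LinearMap.add_apply, mul_add, add_mul, add_sub_add_comm,
      tracelessPart_add, Prod.fst_add, Submodule.coe_add]
    abel
  · intro x y z
    simp only [map_add, mul_add, add_mul, add_sub_add_comm,
      tracelessPart_add, Prod.fst_add, Submodule.coe_add]
    abel
  · intro a X b Y
    have e : tensMat K₁ K₂ (a * b : K₁) (mat K₂ X.1 * mat K₂ Y.1)
        - tensMat K₁ K₂ (b * a : K₁) (mat K₂ Y.1 * mat K₂ X.1) =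
        tensMat K₁ K₂ (-(ip K₁ a.1 b.1 • (1 : K₁)))
          (mat K₂ X.1 * mat K₂ Y.1 - mat K₂ Y.1 * mat K₂ X.1)
        + tensMat K₁ K₂ (imComm K₁ a b) (mat K₂ (jordanMul K₂ X.1 Y.1)) := by
      rw [mul_eq_imComm a b, mul_eq_imComm b a, imComm_swap b a, ip_comm b.1, mat_jordanMul,
        Submodule.coe_neg]
      simp only [map_add, map_neg, map_sub, LinearMap.add_apply, LinearMap.neg_apply]
      abel
    rw [titsForm₂_tmul_eq, LinearEquiv.symm_apply_apply, titsMul_tmul, tensorMatrix_tmul,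
      tensorMatrix_tmul, tensorMatrix_tmul, tensMat_mul, tensMat_mul, e, tracelessPart_add,
      tracelessPart_tensMat, tracelessPart_tensMat, sub_eq_zero]
    congr 1
    rw [map_neg, LinearMap.neg_apply, map_smul, LinearMap.smul_apply, Submodule.coe_neg,
      Submodule.coe_smul, map_neg, map_smul]
    rfl

theorem tensorDer₁_tmul (p u : K₁) (q v : K₂) : tensorDer₁ K₁ K₂ (p ⊗ₜ q) (u ⊗ₜ v) =
    ip K₂ q v • innerDer K₁ p u := by
  simp [tensorDer₁]

theorem tensorDer₂_tmul (p u : K₁) (q v : K₂) : tensorDer₂ K₁ K₂ (p ⊗ₜ q) (u ⊗ₜ v) =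
    ip K₁ p u • innerDer K₂ q v := by
  simp [tensorDer₂]

variable (K₁ K₂) in
/-- The sum `∑ D_{a_ij, b_ij}` over the entries of two matrices, as a bilinear map in the
matrices. -/
noncomputable def entrySum {V : Type*} [AddCommGroup V] [Module ℝ V]
    (f : K₁ ⊗[ℝ] K₂ →ₗ[ℝ] K₁ ⊗[ℝ] K₂ →ₗ[ℝ] V) (M N : Matrix (Fin 3) (Fin 3) (K₁ ⊗[ℝ] K₂)) : V :=
  ∑ i, ∑ j, f (M i j) (N i j)

section entrySum

variable {V : Type*} [AddCommGroup V] [Module ℝ V] (f : K₁ ⊗[ℝ] K₂ →ₗ[ℝ] K₁ ⊗[ℝ] K₂ →ₗ[ℝ] V)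

theorem entrySum_add_left (M M' N : Matrix (Fin 3) (Fin 3) (K₁ ⊗[ℝ] K₂)) :
    entrySum K₁ K₂ f (M + M') N = entrySum K₁ K₂ f M N + entrySum K₁ K₂ f M' N := by
  simp only [entrySum, Matrix.add_apply, map_add, LinearMap.add_apply, Finset.sum_add_distrib]

theorem entrySum_add_right (M N N' : Matrix (Fin 3) (Fin 3) (K₁ ⊗[ℝ] K₂)) :
    entrySum K₁ K₂ f M (N + N') = entrySum K₁ K₂ f M N + entrySum K₁ K₂ f M N' := by
  simp only [entrySum, Matrix.add_apply, map_add, Finset.sum_add_distrib]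

end entrySum

/-- D_{1,u} = 0, so real components contribute nothing to Der K₁. -/
theorem entrySum_tensorDer₁_one_left (X : Matrix (Fin 3) (Fin 3) K₂)
    (N : Matrix (Fin 3) (Fin 3) (K₁ ⊗[ℝ] K₂)) :
    entrySum K₁ K₂ (tensorDer₁ K₁ K₂) (tensMat K₁ K₂ 1 X) N = 0 := by
  refine tensMat_induction
    (p := fun N => entrySum K₁ K₂ (tensorDer₁ K₁ K₂) (tensMat K₁ K₂ 1 X) N = 0) (by simp [entrySum])
    (fun M N hM hN => by rw [entrySum_add_right, hM, hN, add_zero]) (fun u Y => ?_) N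
  simp [entrySum, tensMat_apply, tensorDer₁_tmul, innerDer_swap_one_left]

theorem entrySum_tensorDer₁_one_right (X : Matrix (Fin 3) (Fin 3) K₂)
    (N : Matrix (Fin 3) (Fin 3) (K₁ ⊗[ℝ] K₂)) :
    entrySum K₁ K₂ (tensorDer₁ K₁ K₂) N (tensMat K₁ K₂ 1 X) = 0 := by
  refine tensMat_induction
    (p := fun N => entrySum K₁ K₂ (tensorDer₁ K₁ K₂) N (tensMat K₁ K₂ 1 X) = 0) (by simp [entrySum])
    (fun M N hM hN => by rw [entrySum_add_left, hM, hN, add_zero]) (fun u Y => ?_) N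
  simp [entrySum, tensMat_apply, tensorDer₁_tmul, innerDer_swap_one_right]

/-- On pure tensors the entrywise products ⟨x_ij, y_ij⟩ add up to ⟨X, Y⟩, which is Tits's
coefficient. -/
theorem entrySum_tensorDer₁_tensor (s t : Im K₁ ⊗[ℝ] H3Traceless K₂) :
    (1 / 3 : ℝ) • entrySum K₁ K₂ (tensorDer₁ K₁ K₂) (tensorMatrix K₁ K₂ s)
      (tensorMatrix K₁ K₂ t) = (titsForm₁ K₁ K₂ s t).1 := by
  refine sub_eq_zero.mp (eq_zero_of_tmul₂ (F := fun s t => (1 / 3 : ℝ) •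
    entrySum K₁ K₂ (tensorDer₁ K₁ K₂) (tensorMatrix K₁ K₂ s)
      (tensorMatrix K₁ K₂ t) - (titsForm₁ K₁ K₂ s t).1) ?_ ?_ ?_ s t)
  · intro x y z
    simp only [map_add, entrySum_add_left, LinearMap.add_apply, Submodule.coe_add, smul_add]
    abel
  · intro x y z
    simp only [map_add, entrySum_add_right, Submodule.coe_add, smul_add]
    abel
  · intro a X b Y
    rw [titsForm₁_tmul, Submodule.coe_smul, coe_imInnerDer, hermForm_apply, hermIp_eq, sub_eq_zero]
    simp only [entrySum, tensorMatrix_tmul, tensMat_apply, tensorDer₁_tmul, ← Finset.sum_smul,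
      smul_smul]

/-- Mixed terms vanish because imaginary elements are orthogonal to 1. -/
theorem entrySum_tensorDer₂_one_tensor (X : Matrix (Fin 3) (Fin 3) K₂)
    (t : Im K₁ ⊗[ℝ] H3Traceless K₂) :
    entrySum K₁ K₂ (tensorDer₂ K₁ K₂) (tensMat K₁ K₂ 1 X) (tensorMatrix K₁ K₂ t) = 0 := by
  refine eq_zero_of_tmul (F := fun t =>
    entrySum K₁ K₂ (tensorDer₂ K₁ K₂) (tensMat K₁ K₂ 1 X) (tensorMatrix K₁ K₂ t)) ?_ ?_ t
  · intro x y
    rw [map_add, entrySum_add_right]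
  · intro a Y
    simp [entrySum, tensorMatrix_tmul, tensMat_apply, tensorDer₂_tmul, mem_Im.mp a.2]

theorem entrySum_tensorDer₂_tensor_one (X : Matrix (Fin 3) (Fin 3) K₂)
    (t : Im K₁ ⊗[ℝ] H3Traceless K₂) :
    entrySum K₁ K₂ (tensorDer₂ K₁ K₂) (tensorMatrix K₁ K₂ t) (tensMat K₁ K₂ 1 X) = 0 := by
  refine eq_zero_of_tmul (F := fun t =>
    entrySum K₁ K₂ (tensorDer₂ K₁ K₂) (tensorMatrix K₁ K₂ t) (tensMat K₁ K₂ 1 X)) ?_ ?_ t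
  · intro x y
    rw [map_add, entrySum_add_left]
  · intro a Y
    simp [entrySum, tensorMatrix_tmul, tensMat_apply, tensorDer₂_tmul, ip_comm a.1,
      mem_Im.mp a.2]

theorem entrySum_tensorDer₂_one_one (X Y : Matrix (Fin 3) (Fin 3) K₂) :
    entrySum K₁ K₂ (tensorDer₂ K₁ K₂) (tensMat K₁ K₂ 1 X) (tensMat K₁ K₂ 1 Y) =
      (sumInnerDer X Y).1 := by
  simp [entrySum, tensMat_apply, tensorDer₂_tmul, ip_one_one, sumInnerDer]

theorem entrySum_tensorDer₂_tensor (s t : Im K₁ ⊗[ℝ] H3Traceless K₂) :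
    (1 / 3 : ℝ) • entrySum K₁ K₂ (tensorDer₂ K₁ K₂) (tensorMatrix K₁ K₂ s)
      (tensorMatrix K₁ K₂ t) = ((derH3Equiv K₂).symm (titsForm₂ K₁ K₂ s t)).2.1 := by
  refine sub_eq_zero.mp (eq_zero_of_tmul₂ (F := fun s t => (1 / 3 : ℝ) •
    entrySum K₁ K₂ (tensorDer₂ K₁ K₂) (tensorMatrix K₁ K₂ s) (tensorMatrix K₁ K₂ t) -
      ((derH3Equiv K₂).symm (titsForm₂ K₁ K₂ s t)).2.1) ?_ ?_ ?_ s t)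
  · intro x y z
    simp only [map_add, entrySum_add_left, LinearMap.add_apply, Submodule.coe_add, smul_add,
      Prod.snd_add]
    abel
  · intro x y z
    simp only [map_add, entrySum_add_right, Submodule.coe_add, smul_add, Prod.snd_add]
    abel
  · intro a X b Y
    rw [titsForm₂_tmul_eq, LinearEquiv.symm_apply_apply, Submodule.coe_smul, sub_eq_zero]
    simp only [entrySum, tensorMatrix_tmul, tensMat_apply, tensorDer₂_tmul, ← Finset.smul_sum,
      smul_smul]
    rfl

theorem vinbergBracket_eq {v w x : VinbergSpace K₁ K₂} (h : titsBracket K₁ K₂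
    (vinbergEquiv K₁ K₂ v) (vinbergEquiv K₁ K₂ w) = vinbergEquiv K₁ K₂ x) :
    vinbergBracket K₁ K₂ v w = x := by
  rw [vinbergBracket, transport_apply, h, LinearEquiv.symm_apply_apply]

theorem vinbergEquiv_der (D₁ : DerK K₁) (D₂ : DerK K₂) :
    vinbergEquiv K₁ K₂ (0, D₁, D₂) = (D₁, derH3Equiv K₂ (0, D₂), 0) := by
  rw [← vinbergEquiv_apply, Prod.mk_zero_zero, map_zero]

theorem vinbergEquiv_matrix (A : antihermitianTraceless (conj K₂))
    (t : Im K₁ ⊗[ℝ] H3Traceless K₂) :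
    vinbergEquiv K₁ K₂ (antiEquiv K₁ K₂ (A, t), 0) = (0, derH3Equiv K₂ (A, 0), t) :=
  vinbergEquiv_apply A t 0 0

theorem derComm_derH3Equiv_derOp_adOp (D : DerK K₂) (A : antihermitianTraceless (conj K₂)) :
    derComm (derH3Equiv K₂ (0, D)) (derH3Equiv K₂ (A, 0)) = derH3Equiv K₂ (derAnti D A, 0) := by
  apply Subtype.ext
  simp only [derComm, coe_derH3Equiv, map_zero, zero_add, add_zero, endComm_derOp_adOp]

theorem derComm_derH3Equiv_derOp_derOp (D E : DerK K₂) :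
    derComm (derH3Equiv K₂ (0, D)) (derH3Equiv K₂ (0, E)) = derH3Equiv K₂ (0, derComm D E) := by
  apply Subtype.ext
  simp only [coe_derH3Equiv, map_zero, zero_add, ← endComm_derOp_derOp]
  simp only [derComm, coe_derH3Equiv, map_zero, zero_add]

theorem derComm_derH3Equiv_adOp_adOp (P Q : antihermitianTraceless (conj K₂)) :
    derComm (derH3Equiv K₂ (P, 0)) (derH3Equiv K₂ (Q, 0)) =
      derH3Equiv K₂ (antiComm P Q, (1 / 3 : ℝ) • sumInnerDer P.1 Q.1) := by
  apply Subtype.ext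
  simp only [derComm, coe_derH3Equiv, map_zero, add_zero, endComm_adOp_adOp]

/-- On Tits's side P and Q are derivations of H₃(K₂), so one bracket of matrices collects the
commutator of two derivations, their actions on t and s, and the bracket of two tensors. Each is
then split again by `derH3Equiv`. -/
theorem vinbergBracket_matrix_matrix (P Q : antihermitianTraceless (conj K₂))
    (s t : Im K₁ ⊗[ℝ] H3Traceless K₂) :
    vinbergBracket K₁ K₂ (antiEquiv K₁ K₂ (P, s), 0) (antiEquiv K₁ K₂ (Q, t), 0) =
      (antiEquiv K₁ K₂ (antiComm P Q + ((derH3Equiv K₂).symm (titsForm₂ K₁ K₂ s t)).1,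
          titsAct₂ K₁ K₂ (derH3Equiv K₂ (P, 0)) t - titsAct₂ K₁ K₂ (derH3Equiv K₂ (Q, 0)) s +
            titsMul K₁ K₂ s t), titsForm₁ K₁ K₂ s t,
        (1 / 3 : ℝ) • sumInnerDer P.1 Q.1 + ((derH3Equiv K₂).symm (titsForm₂ K₁ K₂ s t)).2) := by
  refine vinbergBracket_eq ?_
  rw [vinbergEquiv_matrix, vinbergEquiv_matrix, vinbergEquiv_apply, titsBracket, extBracket_apply]
  simp only [map_zero, LinearMap.zero_apply, zero_add, sub_zero, derBracket_apply,
    derComm_derH3Equiv_adOp_adOp]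
  have e : derH3Equiv K₂ (antiComm P Q + ((derH3Equiv K₂).symm (titsForm₂ K₁ K₂ s t)).1,
      (1 / 3 : ℝ) • sumInnerDer P.1 Q.1 + ((derH3Equiv K₂).symm (titsForm₂ K₁ K₂ s t)).2) =
      derH3Equiv K₂ (antiComm P Q, (1 / 3 : ℝ) • sumInnerDer P.1 Q.1) +
        titsForm₂ K₁ K₂ s t := by
    rw [← Prod.mk_add_mk, map_add, Prod.mk.eta, LinearEquiv.apply_symm_apply]
  rw [e]

theorem isVinbergBracket_vinbergBracket : IsVinbergBracket (vinbergBracket K₁ K₂) where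
  der_der D₁ E₁ D₂ E₂ := by
    refine vinbergBracket_eq ?_
    rw [vinbergEquiv_der, vinbergEquiv_der, vinbergEquiv_der, titsBracket, extBracket_apply]
    simp only [map_zero, add_zero, sub_zero, derBracket_apply, derComm_derH3Equiv_derOp_derOp]
  der_matrix D₁ D₂ A := by
    obtain ⟨⟨B, t⟩, rfl⟩ := (antiEquiv K₁ K₂).surjective A
    have h : vinbergBracket K₁ K₂ (0, D₁, D₂) (antiEquiv K₁ K₂ (B, t), 0) =
        (antiEquiv K₁ K₂ (derAnti D₂ B,
          titsAct₁ K₁ K₂ D₁ t + titsAct₂ K₁ K₂ (derH3Equiv K₂ (0, D₂)) t), 0) := by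
      refine vinbergBracket_eq ?_
      rw [vinbergEquiv_der, vinbergEquiv_matrix, vinbergEquiv_matrix, titsBracket,
        extBracket_apply]
      simp only [map_zero, LinearMap.zero_apply, add_zero, sub_zero, derBracket_apply,
        derComm_derH3Equiv_derOp_adOp]
    rw [h]
    refine ⟨?_, rfl⟩
    rw [coe_antiEquiv, coe_antiEquiv, tensorMatrix_act, Matrix.map_add _ (map_add _),
      tensMat_map, Der.map_one D₁.2, map_zero, LinearMap.zero_apply, zero_add]
    rfl
  matrix_matrix A B := by
    obtain ⟨⟨P, s⟩, rfl⟩ := (antiEquiv K₁ K₂).surjective A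
    obtain ⟨⟨Q, t⟩, rfl⟩ := (antiEquiv K₁ K₂).surjective B
    rw [vinbergBracket_matrix_matrix]
    refine ⟨?_, ?_, ?_⟩
    · have h1 := tracelessPart_commutator_one_one (K₁ := K₁) P Q
      have h2 := tracelessPart_commutator_one_tensor P t
      have h3 := tracelessPart_commutator_one_tensor Q s
      have h4 := tracelessPart_commutator_tensor_tensor s t
      rw [coe_antiEquiv, coe_antiEquiv, coe_antiEquiv, Submodule.coe_add, map_add, map_add,
        map_sub, ← h1, ← h2, ← h3]
      have e : ∀ p q s t : Matrix (Fin 3) (Fin 3) (K₁ ⊗[ℝ] K₂),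
          (p + s) * (q + t) - (q + t) * (p + s) =
            (p * q - q * p) + (p * t - t * p) + -(q * s - s * q) + (s * t - t * s) := by
        intro p q s t
        simp only [mul_add, add_mul]
        abel
      rw [e, tracelessPart_add, tracelessPart_add, tracelessPart_add, tracelessPart_neg, h4]
      abel
    · change _ = (1 / 3 : ℝ) • entrySum K₁ K₂ (tensorDer₁ K₁ K₂) _ _
      rw [coe_antiEquiv, coe_antiEquiv, entrySum_add_left, entrySum_add_right,
        entrySum_tensorDer₁_one_left, entrySum_tensorDer₁_one_left, entrySum_add_right,
        entrySum_tensorDer₁_one_right, zero_add, zero_add, zero_add, entrySum_tensorDer₁_tensor]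
    · change _ = (1 / 3 : ℝ) • entrySum K₁ K₂ (tensorDer₂ K₁ K₂) _ _
      rw [coe_antiEquiv, coe_antiEquiv, entrySum_add_left, entrySum_add_right,
        entrySum_tensorDer₂_one_one, entrySum_tensorDer₂_one_tensor, entrySum_add_right,
        entrySum_tensorDer₂_tensor_one, add_zero, zero_add, smul_add, entrySum_tensorDer₂_tensor]
      rfl

end VinbergFormulas

end MagicSquare


theorem theorem4p3 (K₁ K₂ : Type*)
    [NonAssocRing K₁] [Module ℝ K₁] [IsScalarTower ℝ K₁ K₁] [SMulCommClass ℝ K₁ K₁]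
    [MagicSquare.CompositionAlgebra K₁]
    [NonAssocRing K₂] [Module ℝ K₂] [IsScalarTower ℝ K₂ K₂] [SMulCommClass ℝ K₂ K₂]
    [MagicSquare.CompositionAlgebra K₂] :
    ∃ (β : MagicSquare.VinbergSpace K₁ K₂ →ₗ[ℝ] MagicSquare.VinbergSpace K₁ K₂ →ₗ[ℝ]
          MagicSquare.VinbergSpace K₁ K₂)
      (γ : MagicSquare.TitsSpace K₁ K₂ →ₗ[ℝ] MagicSquare.TitsSpace K₁ K₂ →ₗ[ℝ]
          MagicSquare.TitsSpace K₁ K₂)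
      (hβ : MagicSquare.IsLieBracket β) (hγ : MagicSquare.IsLieBracket γ),
      MagicSquare.IsVinbergBracket β ∧ MagicSquare.IsTitsBracket γ ∧
        Nonempty (MagicSquare.WithBracket (MagicSquare.VinbergSpace K₁ K₂) β hβ ≃ₗ⁅ℝ⁆
          MagicSquare.WithBracket (MagicSquare.TitsSpace K₁ K₂) γ hγ) :=
  ⟨MagicSquare.vinbergBracket K₁ K₂, MagicSquare.titsBracket K₁ K₂,
    MagicSquare.isLieBracket_transport _ MagicSquare.isLieBracket_titsBracket,
    MagicSquare.isLieBracket_titsBracket, MagicSquare.isVinbergBracket_vinbergBracket,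
    MagicSquare.isTitsBracket_titsBracket, ⟨MagicSquare.transportLieEquiv _ _⟩⟩
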